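/- **Setting.** Hilbert C$^*$-modules are right modules with inner products linear in the first variable; $\mathcal L(E,F)$ denotes the adjointable maps, $M(B)$ the multiplier algebra, and a C$^*$-algebra $B$ is a Hilbert module over itself via $\langle x,y\rangle=y^*x$. A completely positive map $\rho\colon A\to M(B)$ is *strict* if it is strictly continuous on bounded sets; it then extends uniquely to a linear map on $M(A)$, strictly continuous on bounded sets, again denoted $\rho$. A *C$^*$-valued weight* $\varphi$ from $A$ into $M(B)$ consists of a hereditary cone $\mathcal M_\varphi^+\subseteq A^+$ and a linear map $\varphi\colon\mathcal M_\varphi=\operatorname{span}\mathcal M_\varphi^+\to M(B)$ with $\sum_{i,j} b_j^*\varphi(a_j^*a_i)b_i\ge 0$ for all finite families $a_i\in\mathcal N_\varphi=\{a\in A: a^*a\in\mathcal M_\varphi^+\}$, $b_i\in B$. A *KSGNS-construction* for $\varphi$ is a triple $(E,\Lambda,\pi)$ of a Hilbert $B$-module $E$, a linear map $\Lambda\colon\mathcal N_\varphi\to\mathcal L(B,E)$ such that $\operatorname{span}\{\Lambda(a)b\}$ is dense in $E$ and $\langle\Lambda(a_1)b_1,\Lambda(a_2)b_2\rangle=b_2^*\varphi(a_2^*a_1)b_1$,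 and a $^*$-homomorphism $\pi\colon A\to\mathcal L(E)$ with $\pi(x)\Lambda(a)=\Lambda(xa)$. Let $\mathcal F_\varphi$ be the set of strict completely positive maps $\rho\colon A\to M(B)$ for which there is $T\in\mathcal L(E)$, $0\le T\le 1$, with $b_2^*\rho(a_2^*a_1)b_1=\langle T\Lambda(a_1)b_1,\Lambda(a_2)b_2\rangle$ for all $a_1,a_2\in\mathcal N_\varphi$, $b_1,b_2\in B$, and let $\mathcal G_\varphi=\{\lambda\rho:\lambda\in[0,1),\rho\in\mathcal F_\varphi\}$, directed by $\rho_1\le\rho_2$ iff $\rho_2-\rho_1$ is completely positive. A $\varphi$ with $\mathcal M_\varphi$ dense in $A$ is *lower semi-continuous* if $\mathcal M_\varphi^+$ is the set of $x\in A^+$ for which $(\rho(x))_{\rho\in\mathcal G_\varphi}$ converges strictly in $M(B)$, and the limit is $\varphi(x)$ for each $x\in\mathcal M_\varphi^+$. A *truncating net* for $\varphi$ is a net $(u_i)_{i\in I}$ in $M(A)$ with $\|u_i\|\le1$, $\mathcal N_\varphi u_i\subseteq\mathcal N_\varphi$ and $u_i\to1$ strictly, for which there are $S_i\in\mathcal L(E)$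 with $\|S_i\|\le1$, $S_i\Lambda(a)=\Lambda(au_i)$ for $a\in\mathcal N_\varphi$, $S_i\to1$ strongly, and for each $i$ a strict completely positive $\rho_i\colon A\to M(B)$ with $b_2^*\rho_i(a_2^*a_1)b_1=\langle S_i\Lambda(a_1)b_1,S_i\Lambda(a_2)b_2\rangle$ for all $a_1,a_2\in\mathcal N_\varphi$, $b_1,b_2\in B$. The weight $\varphi$ is *regular* if it is densely defined, lower semi-continuous and has a truncating net. Finally let $\overline{\mathcal N}_\varphi$ be the set of $a\in M(A)$ such that $(b^*\rho(a^*a)b)_{\rho\in\mathcal G_\varphi}$ converges in $B$ for every $b\in B$, and let $\overline\Lambda$ be the closure of $\Lambda$ for the strict topology on $M(A)$ and the strong topology on the linear maps $B\to E$. Strong$^*$ convergence means strong convergence together with strong convergence of the adjoints. **Proposition.** Let $\varphi$ be a regular C$^*$-valued weight from $A$ into $M(B)$ with KSGNS-construction $(E,\Lambda,\pi)$ and truncating net $(u_i)_{i\in I}$. Let $K$ be a dense subspace of $A$ and $L=\operatorname{span}\{au_i: a\in K,\ i\in I\}$. Then $L\subseteq\mathcal N_\varphi$, and: 1. If $a\in\mathcal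 N_\varphi$ and $\Lambda(a)\ne0$, there is a net $(a_j)_{j\in J}$ in $L$ with $\|a_j\|\le\|a\|$ and $\|\Lambda(a_j)\|\le\|\Lambda(a)\|$ for all $j$, such that $a_j\to a$ in norm and $\Lambda(a_j)\to\Lambda(a)$ strongly$^*$. 2. If $a\in\mathcal N_\varphi$ and $M>\|\Lambda(a)\|$, there is a net $(a_j)_{j\in J}$ in $L$ with $\|a_j\|\le\|a\|$ and $\|\Lambda(a_j)\|\le M$ for all $j$, such that $a_j\to a$ in norm and $\Lambda(a_j)\to\Lambda(a)$ strongly$^*$. 3. Let $a\in\overline{\mathcal N}_\varphi$. Then $a$ lies in the domain of $\overline\Lambda$, the value $\overline\Lambda(a)$ is uniquely determined, and $\overline\Lambda(a)\in\mathcal L(B,E)$. If $\overline\Lambda(a)\neq0$, there is a net $(a_j)_{j\in J}$ in $L$ with $\|a_j\|\le\|a\|$ and $\|\Lambda(a_j)\|\le\|\overline\Lambda(a)\|$ for all $j$, such that $a_j\to a$ strictly and $\Lambda(a_j)\to\overline\Lambda(a)$ strongly$^*$. For every $M>\|\overline\Lambda(a)\|$ there is a net $(a_j)_{j\in J}$ in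 $L$ with $\|a_j\|\le\|a\|$ and $\|\Lambda(a_j)\|\le M$ for all $j$, such that $a_j\to a$ strictly and $\Lambda(a_j)\to\overline\Lambda(a)$ strongly$^*$. -/

import Mathlib

open Filter Topology MultiplierAlgebra

universe uA uB uE uI

noncomputable section

/-! ### Multiplier algebras

`𝓜(ℂ, A)` is Mathlib's C*-algebra of multipliers of `A`; a multiplier `x` acts on `A` by
`x.fst a = x a` and `x.snd a = a x`. -/

/-- Convergence of `f` to `y` along `l` in the strict topology of the multiplier algebra. -/
def StrictTendsto {A ι : Type*} [NonUnitalCStarAlgebra A]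
    (f : ι → 𝓜(ℂ, A)) (l : Filter ι) (y : 𝓜(ℂ, A)) : Prop :=
  ∀ c : A, Tendsto (fun i => (f i).fst c) l (𝓝 (y.fst c)) ∧
    Tendsto (fun i => (f i).snd c) l (𝓝 (y.snd c))

/-- A map from `A` into `M(B)` is strict: it is strictly continuous on bounded subsets of `A`. -/
def IsStrict {A B : Type*} [NonUnitalCStarAlgebra A] [NonUnitalCStarAlgebra B]
    (ρ : A →ₗ[ℂ] 𝓜(ℂ, B)) : Prop :=
  ∀ (r : ℝ) (l : Filter A) (x : A), (∀ᶠ y in l, ‖y‖ ≤ r) →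
    StrictTendsto (fun y : A => (y : 𝓜(ℂ, A))) l (x : 𝓜(ℂ, A)) → StrictTendsto ρ l (ρ x)

/-- `σ` is a linear extension of `ρ` to `M(A)`, strictly continuous on bounded subsets of `M(A)`.
For a strict completely positive `ρ` there is exactly one such `σ`. -/
def IsStrictExtension {A B : Type*} [NonUnitalCStarAlgebra A] [NonUnitalCStarAlgebra B]
    (ρ : A →ₗ[ℂ] 𝓜(ℂ, B)) (σ : 𝓜(ℂ, A) →ₗ[ℂ] 𝓜(ℂ, B)) : Prop :=
  (∀ a : A, σ (a : 𝓜(ℂ, A)) = ρ a) ∧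
  ∀ (r : ℝ) (l : Filter 𝓜(ℂ, A)) (x : 𝓜(ℂ, A)), (∀ᶠ y in l, ‖y‖ ≤ r) →
    StrictTendsto (fun y => y) l x → StrictTendsto σ l (σ x)

open Classical in
/-- The extension of a strict completely positive map `ρ` to `M(A)`. -/
def strictExtension {A B : Type*} [NonUnitalCStarAlgebra A] [NonUnitalCStarAlgebra B]
    (ρ : A →ₗ[ℂ] 𝓜(ℂ, B)) : 𝓜(ℂ, A) →ₗ[ℂ] 𝓜(ℂ, B) :=
  if h : ∃ σ, IsStrictExtension ρ σ then h.choose else 0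

/-- Complete positivity of a linear map from `A` into `M(B)`. -/
def IsCP {A B : Type*} [NonUnitalCStarAlgebra A] [NonUnitalCStarAlgebra B]
    [PartialOrder B] [StarOrderedRing B] (ρ : A →ₗ[ℂ] 𝓜(ℂ, B)) : Prop :=
  ∀ (n : ℕ) (a : Fin n → A) (b : Fin n → B),
    0 ≤ ∑ i, ∑ j, star (b j) * (ρ (star (a j) * a i)).fst (b i)

/-! ### Hilbert C*-modules -/

/-- A (right) pre-Hilbert C*-module over `B`, with norm `‖⟨x, x⟩‖ ^ (1/2)` and with an inner
product that is linear in the first variable. It is a Hilbert C*-module if `E` is complete.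
The remaining laws of the right action `x b = MulOpposite.op b • x` follow from the axioms.
(Mathlib's `CStarModule` has the action on the left.) -/
class HilbertModule (B E : Type*) [NonUnitalCStarAlgebra B] [PartialOrder B] [StarOrderedRing B]
    [NormedAddCommGroup E] [NormedSpace ℂ E] [SMul Bᵐᵒᵖ E] where
  ip : E → E → B
  ip_add_left : ∀ x y z : E, ip (x + y) z = ip x z + ip y z
  ip_smul_left : ∀ (c : ℂ) (x y : E), ip (c • x) y = c • ip x y
  ip_op_smul_left : ∀ (b : B) (x y : E), ip (MulOpposite.op b • x) y = ip x y * b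
  star_ip : ∀ x y : E, star (ip x y) = ip y x
  ip_self_nonneg : ∀ x : E, 0 ≤ ip x x
  ip_self_eq_zero : ∀ x : E, ip x x = 0 → x = 0
  norm_eq : ∀ x : E, ‖x‖ = √‖ip x x‖

/-- The `B`-valued inner product `⟨x, y⟩`. -/
abbrev rip (B : Type*) {E : Type*} [NonUnitalCStarAlgebra B] [PartialOrder B] [StarOrderedRing B]
    [NormedAddCommGroup E] [NormedSpace ℂ E] [SMul Bᵐᵒᵖ E] [HilbertModule B E] (x y : E) : B :=
  HilbertModule.ip x y

/-- `B` as a Hilbert C*-module over itself: `⟨x, y⟩ = y* x`. -/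
instance HilbertModule.self (B : Type*) [NonUnitalCStarAlgebra B] [PartialOrder B]
    [StarOrderedRing B] : HilbertModule B B where
  ip x y := star y * x
  ip_add_left x y z := mul_add _ _ _
  ip_smul_left c x y := mul_smul_comm _ _ _
  ip_op_smul_left b x y := by simp [mul_assoc]
  star_ip x y := by simp
  ip_self_nonneg x := star_mul_self_nonneg x
  ip_self_eq_zero x h := CStarRing.star_mul_self_eq_zero_iff x |>.1 h
  norm_eq x := by rw [CStarRing.norm_star_mul_self, Real.sqrt_mul_self (norm_nonneg x)]

section Adjointable

variable (B : Type*) [NonUnitalCStarAlgebra B] [PartialOrder B] [StarOrderedRing B]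
variable (E F : Type*) [NormedAddCommGroup E] [NormedSpace ℂ E] [SMul Bᵐᵒᵖ E] [HilbertModule B E]
variable [NormedAddCommGroup F] [NormedSpace ℂ F] [SMul Bᵐᵒᵖ F] [HilbertModule B F]

variable {E} in
theorem rip_add_right (x y z : E) : rip B x (y + z) = rip B x y + rip B x z := by
  rw [rip, ← HilbertModule.star_ip, HilbertModule.ip_add_left, star_add,
    HilbertModule.star_ip, HilbertModule.star_ip]

variable {E} in
theorem rip_smul_right (c : ℂ) (x y : E) : rip B x (c • y) = star c • rip B x y := by
  rw [rip, ← HilbertModule.star_ip, HilbertModule.ip_smul_left, star_smul,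
    HilbertModule.star_ip]

/-- `ℒ(E, F)`, the adjointable maps from `E` to `F`, with the operator norm. -/
def AdjointableMap : Submodule ℂ (E →L[ℂ] F) where
  carrier := {T | ∃ S : F →L[ℂ] E, ∀ x y, rip B (T x) y = rip B x (S y)}
  zero_mem' := by
    refine ⟨0, fun x y => ?_⟩
    have h1 := HilbertModule.ip_smul_left (B := B) 0 (0 : F) y
    have h2 := rip_smul_right B 0 x (0 : E)
    simp only [zero_smul, star_zero] at h1 h2
    exact h1.trans h2.symm
  add_mem' := by
    rintro T₁ T₂ ⟨S₁, h₁⟩ ⟨S₂, h₂⟩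
    refine ⟨S₁ + S₂, fun x y => ?_⟩
    simp only [_root_.add_apply, rip_add_right]
    rw [rip, HilbertModule.ip_add_left]
    exact congrArg₂ _ (h₁ x y) (h₂ x y)
  smul_mem' := by
    rintro c T ⟨S, h⟩
    refine ⟨star c • S, fun x y => ?_⟩
    simp only [_root_.smul_apply, rip_smul_right, star_star]
    rw [rip, HilbertModule.ip_smul_left]
    exact congrArg _ (h x y)

variable {B E F}

/-- The adjoint `T*` of an adjointable map `T`. -/
def AdjointableMap.adj (T : AdjointableMap B E F) : F →L[ℂ] E := T.2.choose

theorem AdjointableMap.rip_adj (T : AdjointableMap B E F) (x : E) (y : F) :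
    rip B ((T : E →L[ℂ] F) x) y = rip B x (AdjointableMap.adj T y) := T.2.choose_spec x y

/-- Strong* convergence of adjointable maps. -/
def StrongStarTendsto {ι : Type*} (T : ι → AdjointableMap B E F) (l : Filter ι)
    (T₀ : AdjointableMap B E F) : Prop :=
  (∀ x : E, Tendsto (fun i => (T i : E →L[ℂ] F) x) l (𝓝 ((T₀ : E →L[ℂ] F) x))) ∧
  ∀ y : F, Tendsto (fun i => AdjointableMap.adj (T i) y) l (𝓝 (AdjointableMap.adj T₀ y))

end Adjointable

/-! ### C*-valued weights -/

/-- A hereditary cone in `A⁺`. -/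
structure HereditaryCone (A : Type*) [NonUnitalCStarAlgebra A] [PartialOrder A]
    [StarOrderedRing A] where
  carrier : Set A
  nonneg : ∀ x ∈ carrier, 0 ≤ x
  zero_mem : 0 ∈ carrier
  add_mem : ∀ x ∈ carrier, ∀ y ∈ carrier, x + y ∈ carrier
  smul_mem : ∀ r : ℝ, 0 ≤ r → ∀ x ∈ carrier, r • x ∈ carrier
  hereditary : ∀ x ∈ carrier, ∀ y, 0 ≤ y → y ≤ x → y ∈ carrier

namespace HereditaryCone

variable {A : Type*} [NonUnitalCStarAlgebra A] [PartialOrder A] [StarOrderedRing A]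
variable (P : HereditaryCone A)

/-- `ℳ = span P`. -/
def M : Submodule ℂ A := Submodule.span ℂ P.carrier

theorem star_mul_self_add_mem {a b : A} (ha : star a * a ∈ P.carrier)
    (hb : star b * b ∈ P.carrier) : star (a + b) * (a + b) ∈ P.carrier := by
  refine P.hereditary _ (P.smul_mem 2 (by norm_num) _ (P.add_mem _ ha _ hb)) _
    (star_mul_self_nonneg _) ?_
  have h := star_mul_self_nonneg (a - b)
  rw [← sub_nonneg]
  have e : (2 : ℝ) • (star a * a + star b * b) - star (a + b) * (a + b)
      = star (a - b) * (a - b) := by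
    simp only [two_smul, star_add, star_sub, add_mul, mul_add, sub_mul, mul_sub]
    abel
  rw [e]; exact h

theorem star_mul_self_smul_mem (c : ℂ) {a : A} (ha : star a * a ∈ P.carrier) :
    star (c • a) * (c • a) ∈ P.carrier := by
  have e : star (c • a) * (c • a) = (Complex.normSq c) • (star a * a) := by
    rw [star_smul, smul_mul_smul_comm, ← Complex.coe_smul, Complex.normSq_eq_conj_mul_self]
    rfl
  rw [e]; exact P.smul_mem _ (Complex.normSq_nonneg c) _ ha

/-- `𝒩 = {a ∈ A | a* a ∈ P}`. -/
def N : Submodule ℂ A where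
  carrier := {a | star a * a ∈ P.carrier}
  zero_mem' := by simpa using P.zero_mem
  add_mem' := fun ha hb => P.star_mul_self_add_mem ha hb
  smul_mem' := fun c _ ha => P.star_mul_self_smul_mem c ha

theorem mul_mem_N (x : A) {a : A} (ha : a ∈ P.N) : x * a ∈ P.N := by
  refine P.hereditary _ (P.smul_mem ‖star x * x‖ (norm_nonneg _) _ ha) _
    (star_mul_self_nonneg _) ?_
  have h := CStarAlgebra.star_left_conjugate_le_norm_smul (a := a) (b := star x * x)
    (IsSelfAdjoint.star_mul_self x)
  simpa [mul_assoc] using h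

theorem star_mul_mem_M {a b : A} (ha : a ∈ P.N) (hb : b ∈ P.N) : star a * b ∈ P.M := by
  have key : ∀ c : ℂ, star (b + c • a) * (b + c • a) ∈ P.M := fun c =>
    Submodule.subset_span (P.N.add_mem hb (P.N.smul_mem c ha))
  have e : star a * b = (1 / 4 : ℂ) • (star (b + (1 : ℂ) • a) * (b + (1 : ℂ) • a)
      - star (b + (-1 : ℂ) • a) * (b + (-1 : ℂ) • a)
      + Complex.I • (star (b + Complex.I • a) * (b + Complex.I • a))
      - Complex.I • (star (b + (-Complex.I) • a) * (b + (-Complex.I) • a))) := by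
    simp only [star_add, star_smul, add_mul, mul_add, smul_mul_assoc, mul_smul_comm, smul_add,
      smul_smul, smul_sub]
    simp only [RCLike.star_def, map_one, map_neg, Complex.conj_I]
    match_scalars <;> ring_nf <;> simp [Complex.I_sq] <;> norm_num
  rw [e]
  exact P.M.smul_mem _ (P.M.sub_mem (P.M.add_mem (P.M.sub_mem (key _) (key _))
    (P.M.smul_mem _ (key _))) (P.M.smul_mem _ (key _)))

end HereditaryCone

/-- A C*-valued weight from `A` into `M(B)`. Here `carrier` is `ℳ_φ⁺`, `M` is the domain `ℳ_φ`
of `φ`, `N` is `𝒩_φ` and `map` is the map `φ`. -/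
structure CStarWeight (A B : Type*) [NonUnitalCStarAlgebra A] [PartialOrder A]
    [StarOrderedRing A] [NonUnitalCStarAlgebra B] [PartialOrder B] [StarOrderedRing B]
    extends HereditaryCone A where
  map : toHereditaryCone.M →ₗ[ℂ] 𝓜(ℂ, B)
  cp : ∀ (n : ℕ) (a : Fin n → toHereditaryCone.N) (b : Fin n → B),
    0 ≤ ∑ i, ∑ j, star (b j) *
      (map ⟨star (a j : A) * a i, toHereditaryCone.star_mul_mem_M (a j).2 (a i).2⟩).fst (b i)

namespace CStarWeight

variable {A B : Type*} [NonUnitalCStarAlgebra A] [PartialOrder A] [StarOrderedRing A]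
variable [NonUnitalCStarAlgebra B] [PartialOrder B] [StarOrderedRing B]

def DenselyDefined (φ : CStarWeight A B) : Prop := Dense (φ.M : Set A)

/-- `φ(a₂* a₁)` for `a₁, a₂ ∈ 𝒩_φ`. -/
def sesq (φ : CStarWeight A B) (a₂ a₁ : φ.N) : 𝓜(ℂ, B) :=
  φ.map ⟨star (a₂ : A) * a₁, φ.star_mul_mem_M a₂.2 a₁.2⟩

end CStarWeight

/-- A KSGNS-construction `(E, Λ, π)` for the C*-valued weight `φ`. -/
structure KSGNS {A B : Type*} [NonUnitalCStarAlgebra A] [PartialOrder A] [StarOrderedRing A]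
    [NonUnitalCStarAlgebra B] [PartialOrder B] [StarOrderedRing B] (φ : CStarWeight A B)
    (E : Type*) [NormedAddCommGroup E] [NormedSpace ℂ E] [CompleteSpace E] [SMul Bᵐᵒᵖ E]
    [HilbertModule B E] where
  Λ : φ.N →ₗ[ℂ] AdjointableMap B B E
  dense_span : Dense
    (Submodule.span ℂ {v : E | ∃ (a : φ.N) (b : B), v = (Λ a : B →L[ℂ] E) b} : Set E)
  rip_Λ : ∀ (a₁ a₂ : φ.N) (b₁ b₂ : B),
    rip B ((Λ a₁ : B →L[ℂ] E) b₁) ((Λ a₂ : B →L[ℂ] E) b₂)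
      = star b₂ * (φ.sesq a₂ a₁).fst b₁
  π : A →ₙₐ[ℂ] (E →L[ℂ] E)
  /-- `π` is a *-homomorphism into the adjointable maps. -/
  rip_π : ∀ (x : A) (v w : E), rip B (π x v) w = rip B v (π (star x) w)
  π_Λ : ∀ (x : A) (a : φ.N) (b : B),
    π x ((Λ a : B →L[ℂ] E) b) = (Λ ⟨x * a, φ.mul_mem_N x a.2⟩ : B →L[ℂ] E) b

namespace KSGNS

variable {A B : Type*} [NonUnitalCStarAlgebra A] [PartialOrder A] [StarOrderedRing A]
variable [NonUnitalCStarAlgebra B] [PartialOrder B] [StarOrderedRing B] {φ : CStarWeight A B}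
variable {E : Type*} [NormedAddCommGroup E] [NormedSpace ℂ E] [CompleteSpace E] [SMul Bᵐᵒᵖ E]
variable [HilbertModule B E] (g : KSGNS φ E)

/-- `ℱ_φ`: the strict completely positive maps `ρ` from `A` into `M(B)` for which there is
`T ∈ ℒ(E)` with `0 ≤ T ≤ 1` and `b₂* ρ(a₂* a₁) b₁ = ⟨T Λ(a₁) b₁, Λ(a₂) b₂⟩`. -/
def FSet : Set (A →ₗ[ℂ] 𝓜(ℂ, B)) :=
  {ρ | IsStrict ρ ∧ IsCP ρ ∧ ∃ T : AdjointableMap B E E,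
    (∀ v : E, 0 ≤ rip B ((T : E →L[ℂ] E) v) v) ∧
    (∀ v : E, rip B ((T : E →L[ℂ] E) v) v ≤ rip B v v) ∧
    ∀ (a₁ a₂ : φ.N) (b₁ b₂ : B),
      star b₂ * (ρ (star (a₂ : A) * a₁)).fst b₁
        = rip B ((T : E →L[ℂ] E) ((g.Λ a₁ : B →L[ℂ] E) b₁)) ((g.Λ a₂ : B →L[ℂ] E) b₂)}

/-- `𝒢_φ = {λ ρ | λ ∈ [0, 1), ρ ∈ ℱ_φ}`. -/
def G : Type _ :=
  {ρ : A →ₗ[ℂ] 𝓜(ℂ, B) // ∃ t : ℝ, 0 ≤ t ∧ t < 1 ∧ ∃ η ∈ g.FSet, ρ = (t : ℂ) • η}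

/-- `ρ₁ ≤ ρ₂` in `𝒢_φ` means that `ρ₂ - ρ₁` is completely positive. For this (directed) preorder,
`atTop` describes convergence of nets indexed by `𝒢_φ`. -/
instance : Preorder g.G where
  le ρ₁ ρ₂ := IsCP (ρ₂.1 - ρ₁.1)
  le_refl ρ := by
    intro n a b
    simp
  le_trans ρ₁ ρ₂ ρ₃ h₁₂ h₂₃ := by
    intro n a b
    refine (add_nonneg (h₁₂ n a b) (h₂₃ n a b)).trans_eq ?_
    simp only [← Finset.sum_add_distrib, ← mul_add]
    refine Finset.sum_congr rfl fun i _ => Finset.sum_congr rfl fun j _ => ?_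
    simp

/-- Lower semi-continuity: `ℳ_φ⁺` consists of all `x ∈ A⁺` for which the net `(ρ(x))`,
`ρ ∈ 𝒢_φ`, is strictly convergent, and for such `x` the limit is `φ(x)`. -/
def LowerSemicontinuous : Prop :=
  φ.carrier = {x : A | 0 ≤ x ∧
    ∃ y : 𝓜(ℂ, B), StrictTendsto (fun ρ : g.G => ρ.1 x) atTop y} ∧
  ∀ (x : A) (hx : x ∈ φ.carrier),
    StrictTendsto (fun ρ : g.G => ρ.1 x) atTop (φ.map ⟨x, Submodule.subset_span hx⟩)

/-- `u` is a truncating net for `φ`, relative to the KSGNS-construction `g`. (The operators `S i`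
and the maps `ρ` are automatically unique if `φ` is densely defined.) -/
def IsTruncatingNet {I : Type*} [Preorder I] (u : I → 𝓜(ℂ, A)) : Prop :=
  ∃ S : I → AdjointableMap B E E,
    (∀ i, ‖u i‖ ≤ 1 ∧ ‖S i‖ ≤ 1 ∧
      (∃ h : ∀ a ∈ φ.N, (u i).snd a ∈ φ.N, ∀ (a : φ.N) (b : B),
        (S i : E →L[ℂ] E) ((g.Λ a : B →L[ℂ] E) b)
          = (g.Λ ⟨(u i).snd a, h a a.2⟩ : B →L[ℂ] E) b) ∧
      ∃ ρ : A →ₗ[ℂ] 𝓜(ℂ, B), IsStrict ρ ∧ IsCP ρ ∧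
        ∀ (a₁ a₂ : φ.N) (b₁ b₂ : B),
          star b₂ * (ρ (star (a₂ : A) * a₁)).fst b₁
            = rip B ((S i : E →L[ℂ] E) ((g.Λ a₁ : B →L[ℂ] E) b₁))
                ((S i : E →L[ℂ] E) ((g.Λ a₂ : B →L[ℂ] E) b₂))) ∧
    StrictTendsto u atTop 1 ∧
    ∀ v : E, Tendsto (fun i => (S i : E →L[ℂ] E) v) atTop (𝓝 v)

/-- `ℳ̄_φ⁺`: the positive multipliers `x` of `A` for which `(b* ρ(x) b)`, `ρ ∈ 𝒢_φ`, converges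
for every `b ∈ B`. -/
def MbarPos : Set 𝓜(ℂ, A) :=
  {x | (∃ y, x = star y * y) ∧ ∀ b : B, ∃ c : B,
    Tendsto (fun ρ : g.G => star b * (strictExtension ρ.1 x).fst b) atTop (𝓝 c)}

/-- `𝒩̄_φ = {a ∈ M(A) | a* a ∈ ℳ̄_φ⁺}`. -/
def Nbar : Set 𝓜(ℂ, A) := {a | star a * a ∈ g.MbarPos}

/-- The graph of `Λ̄`, the closure of `Λ` for the strict topology on `M(A)` and the strong topology
on the space of all linear maps from `B` into `E`. -/
def LambdaBarGraph (a : 𝓜(ℂ, A)) (t : B →ₗ[ℂ] E) : Prop :=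
  ∃ l : Filter φ.N, l.NeBot ∧
    StrictTendsto (fun x : φ.N => ((x : A) : 𝓜(ℂ, A))) l a ∧
    ∀ b : B, Tendsto (fun x : φ.N => (g.Λ x : B →L[ℂ] E) b) l (𝓝 (t b))

end KSGNS

/-- `L = span {a uᵢ | a ∈ K, i ∈ I}`, a subspace of `A`. -/
def truncatedSpan {A I : Type*} [NonUnitalCStarAlgebra A] (K : Submodule ℂ A)
    (u : I → 𝓜(ℂ, A)) : Submodule ℂ A :=
  Submodule.span ℂ {y | ∃ a ∈ K, ∃ i, y = (u i).snd a}

end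

/-! Let `t` be `Λ a`, or the value of the closure of `Λ` at a multiplier `a`. For `e` in an
approximate unit of `A` and an index `i`, the element `e a uᵢ` satisfies `Λ(e a uᵢ) = π(e) Sᵢ t`.
Both `π(e)` and `Sᵢ` are contractions tending strongly to `1`, and so are their adjoints. Hence `e a
uᵢ` stays in the ball of radius `‖a‖`, its image under `Λ` stays in the ball of radius `‖t‖`, and
the net tends to `a` strictly (in norm if `a ∈ A`) while the images tend to `t` strongly*
(`IsValue.strongStarTendsto_cutNet`).

To land in `L` without leaving either ball, `e a` is replaced by some `k ∈ K` close to `(1 - δ) e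
a`. For fixed `i` the map `x ↦ Λ(x uᵢ)` is norm bounded on all of `A`, so the error in both `k uᵢ`
and `Λ(k uᵢ)` fits into the slack left by the factor `1 - δ` (`IsValue.exists_mem_truncatedSpan`).
That `x uᵢ` lies in `𝒩_φ` for every `x ∈ A` holds because `x ↦ Λ(x uᵢ)` is bounded on the dense
subspace `𝒩_φ` and `Λ` is norm closed by lower semi-continuity.

For `a ∈ 𝒩̄_φ` the operator `t` has to be constructed, as the limit of `f = Λ(e a uᵢ) b`
(`cauchy_Λ_cutNet`). Each `σ ∈ 𝒢_φ` is represented by an operator `T` with `0 ≤ T ≤ 1`, and `‖f - T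
f‖² ≤ ‖⟨f, f⟩ - ⟨T f, f⟩‖`. Here `⟨f, f⟩` is at most the limit `c` of `b* σ(a* a) b`, since
multiples of `ρᵢ` belong to `𝒢_φ`, while `⟨T f, f⟩` is close to `c` for suitable `σ`. As `T Λ(·) b`
is strictly continuous at `0` on bounded sets, the net is Cauchy. This uses that `𝒢_φ` is directed
(`TruncationNet.isDirectedOrder`). The relation `π(f) Sⱼ t = Λ(f a uⱼ)`, called `IsValue`, then
gives uniqueness and adjointability of `t`. -/

noncomputable section

/-! ### Hilbert modules: the Cauchy–Schwarz inequality and separation of points. -/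

section HilbertModules

variable {B : Type*} [NonUnitalCStarAlgebra B] [PartialOrder B] [StarOrderedRing B]
variable {E F : Type*} [NormedAddCommGroup E] [NormedSpace ℂ E] [SMul Bᵐᵒᵖ E] [HilbertModule B E]
variable [NormedAddCommGroup F] [NormedSpace ℂ F] [SMul Bᵐᵒᵖ F] [HilbertModule B F]

theorem star_rip (x y : E) : star (rip B x y) = rip B y x := HilbertModule.star_ip x y

theorem rip_add_left (x y z : E) : rip B (x + y) z = rip B x z + rip B y z :=
  HilbertModule.ip_add_left x y z

theorem rip_smul_left (c : ℂ) (x y : E) : rip B (c • x) y = c • rip B x y :=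
  HilbertModule.ip_smul_left c x y

/-- The inner product as a linear map in its first variable. -/
def ripLeft (B : Type*) [NonUnitalCStarAlgebra B] [PartialOrder B] [StarOrderedRing B]
    {E : Type*} [NormedAddCommGroup E] [NormedSpace ℂ E] [SMul Bᵐᵒᵖ E] [HilbertModule B E]
    (y : E) : E →ₗ[ℂ] B where
  toFun x := rip B x y
  map_add' x x' := rip_add_left x x' y
  map_smul' c x := rip_smul_left c x y

/-- The inner product as an additive map in its second variable. -/
def ripRight (B : Type*) [NonUnitalCStarAlgebra B] [PartialOrder B] [StarOrderedRing B]
    {E : Type*} [NormedAddCommGroup E] [NormedSpace ℂ E] [SMul Bᵐᵒᵖ E] [HilbertModule B E]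
    (x : E) : E →+ B :=
  AddMonoidHom.mk' (fun y => rip B x y) (rip_add_right B x)

theorem rip_sub_left (x y z : E) : rip B (x - y) z = rip B x z - rip B y z :=
  map_sub (ripLeft B z) x y

theorem rip_sub_right (x y z : E) : rip B x (y - z) = rip B x y - rip B x z :=
  map_sub (ripRight B x) y z

theorem rip_zero_right (x : E) : rip B x 0 = 0 := map_zero (ripRight B x)

theorem rip_sum_left {ι : Type*} (s : Finset ι) (f : ι → E) (x : E) :
    rip B (∑ i ∈ s, f i) x = ∑ i ∈ s, rip B (f i) x := map_sum (ripLeft B x) f s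

theorem rip_sum_right {ι : Type*} (s : Finset ι) (f : ι → E) (x : E) :
    rip B x (∑ i ∈ s, f i) = ∑ i ∈ s, rip B x (f i) := map_sum (ripRight B x) f s

theorem rip_real_smul_left (c : ℝ) (x y : E) : rip B ((c : ℂ) • x) y = c • rip B x y := by
  rw [rip_smul_left, Complex.coe_smul]

theorem rip_real_smul_right (c : ℝ) (x y : E) : rip B x ((c : ℂ) • y) = c • rip B x y := by
  rw [rip_smul_right, RCLike.star_def, Complex.conj_ofReal, Complex.coe_smul]

theorem rip_self_nonneg (x : E) : 0 ≤ rip B x x := HilbertModule.ip_self_nonneg x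

variable (B) in
theorem norm_sq_eq_norm_rip (x : E) : ‖x‖ ^ 2 = ‖rip B x x‖ := by
  rw [HilbertModule.norm_eq (B := B) x, Real.sq_sqrt (norm_nonneg _)]

-- Cauchy–Schwarz: subtract from `x` the vector `w = ‖y‖⁻² y⟨x, y⟩`. Positivity of `⟨x - w, x - w⟩`
-- gives `‖y‖⁻² p* p ≤ ⟨x, x⟩` for `p = ⟨x, y⟩`, and norms of positive elements are monotone.
variable (B) in
theorem norm_rip_le (x y : E) : ‖rip B x y‖ ≤ ‖x‖ * ‖y‖ := by
  rcases eq_or_ne y 0 with rfl | hy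
  · rw [rip_zero_right]; simp
  have hy' : 0 < ‖y‖ ^ 2 := by positivity
  set p : B := rip B x y with hp
  have hp' : rip B y x = star p := (star_rip x y).symm
  set t : ℝ := (‖y‖ ^ 2)⁻¹ with ht
  have ht0 : 0 < t := inv_pos.2 hy'
  set w : E := (t : ℂ) • (MulOpposite.op p • y) with hw
  have h1 : rip B w x = t • (star p * p) := by
    rw [hw, rip_real_smul_left, rip, HilbertModule.ip_op_smul_left, ← hp']
  have h2 : rip B x w = t • (star p * p) := by
    rw [← star_rip, h1, star_smul, star_mul, star_star, star_trivial]
  have h3 : rip B w w ≤ t • (star p * p) := by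
    have e : rip B w w = (t ^ 2) • (star p * rip B y y * p) := by
      have e1 : rip B y w = t • (star p * rip B y y) := by
        rw [hw, rip_real_smul_right, ← star_rip, rip, HilbertModule.ip_op_smul_left, star_mul]
        exact congrArg (fun z => t • (star p * z)) (star_rip y y)
      conv_lhs => rw [hw, rip_real_smul_left, rip, HilbertModule.ip_op_smul_left]
      have e1' : HilbertModule.ip y w = t • (star p * rip B y y) := e1
      rw [← hw, e1', smul_mul_assoc, smul_smul, sq]
    rw [e]
    have h := CStarAlgebra.star_left_conjugate_le_norm_smul (a := p) (b := rip B y y)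
      (IsSelfAdjoint.of_nonneg (rip_self_nonneg y))
    refine (smul_le_smul_of_nonneg_left h (by positivity)).trans_eq ?_
    rw [smul_smul, ← norm_sq_eq_norm_rip, ht]
    congr 1
    field_simp
  have h4 : t • (star p * p) ≤ rip B x x := by
    have h := rip_self_nonneg (B := B) (x - w)
    rw [rip_sub_left, rip_sub_right, rip_sub_right, h1, h2] at h
    have h5 : rip B x x - t • (star p * p) - (t • (star p * p) - rip B w w) ≤
        rip B x x - t • (star p * p) - 0 := by
      exact sub_le_sub_left (sub_nonneg.2 h3) _
    have := h.trans h5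
    rwa [sub_zero, sub_nonneg] at this
  have h5 := CStarAlgebra.norm_le_norm_of_nonneg_of_le
    (smul_nonneg ht0.le (star_mul_self_nonneg p)) h4
  rw [norm_smul, CStarRing.norm_star_mul_self, ← norm_sq_eq_norm_rip, Real.norm_of_nonneg ht0.le,
    ht, inv_mul_le_iff₀ hy'] at h5
  refine abs_le_of_sq_le_sq' ?_ (by positivity) |>.2
  nlinarith

theorem Filter.Tendsto.rip {ι : Type*} {l : Filter ι} {f h : ι → E} {x y : E}
    (hf : Tendsto f l (𝓝 x)) (hh : Tendsto h l (𝓝 y)) :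
    Tendsto (fun i => _root_.rip B (f i) (h i)) l (𝓝 (_root_.rip B x y)) := by
  rw [tendsto_iff_norm_sub_tendsto_zero]
  have h0 : Tendsto (fun i => ‖f i - x‖ * ‖h i‖ + ‖x‖ * ‖h i - y‖) l (𝓝 0) := by
    have := ((tendsto_iff_norm_sub_tendsto_zero.1 hf).mul hh.norm).add
      ((tendsto_iff_norm_sub_tendsto_zero.1 hh).const_mul ‖x‖)
    simpa using this
  refine squeeze_zero (fun _ => norm_nonneg _) (fun i => ?_) h0
  have e : _root_.rip B (f i) (h i) - _root_.rip B x y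
      = _root_.rip B (f i - x) (h i) + _root_.rip B x (h i - y) := by
    rw [rip_sub_left, rip_sub_right]; abel
  rw [e]
  exact (norm_add_le _ _).trans (add_le_add (norm_rip_le B _ _) (norm_rip_le B _ _))

theorem continuous_rip_right (x : E) : Continuous fun y : E => rip B x y :=
  continuous_iff_continuousAt.2 fun _ => Tendsto.rip tendsto_const_nhds tendsto_id

variable (B) in
theorem eq_of_rip_left {x y : E} (h : ∀ v, rip B x v = rip B y v) : x = y := by
  rw [← sub_eq_zero]
  apply HilbertModule.ip_self_eq_zero (B := B)
  have := h (x - y)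
  rwa [← sub_eq_zero, ← rip_sub_left] at this

variable (B) in
theorem eq_of_rip_right {x y : E} (h : ∀ v, rip B v x = rip B v y) : x = y :=
  eq_of_rip_left B fun v => by rw [← star_rip, h, star_rip]

variable (B) in
theorem eq_of_rip_left_of_dense {s : Set E} (hs : Dense (Submodule.span ℂ s : Set E)) {x y : E}
    (h : ∀ v ∈ s, rip B x v = rip B y v) : x = y := by
  refine eq_of_rip_left B fun v => ?_
  refine congrFun (Continuous.ext_on hs (continuous_rip_right x) (continuous_rip_right y) ?_) v
  intro v hv
  induction hv using Submodule.span_induction with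
  | mem v hv => exact h v hv
  | zero => simp only [rip_zero_right]
  | add v w _ _ hv hw => simp only [rip_add_right, hv, hw]
  | smul c v _ hv => simp only [rip_smul_right, hv]

/-! ### Adjointable maps -/

/-- `S` is an adjoint of `T`. -/
def IsAdjointPair (B : Type*) [NonUnitalCStarAlgebra B] [PartialOrder B] [StarOrderedRing B]
    {E F : Type*} [NormedAddCommGroup E] [NormedSpace ℂ E] [SMul Bᵐᵒᵖ E] [HilbertModule B E]
    [NormedAddCommGroup F] [NormedSpace ℂ F] [SMul Bᵐᵒᵖ F] [HilbertModule B F]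
    (T : E → F) (S : F → E) : Prop :=
  ∀ x y, rip B (T x) y = rip B x (S y)

theorem IsAdjointPair.symm {T : E → F} {S : F → E} (h : IsAdjointPair B T S) :
    IsAdjointPair B S T := fun x y => by rw [← star_rip, ← h, star_rip]

theorem IsAdjointPair.eq {T : E → F} {S S' : F → E} (h : IsAdjointPair B T S)
    (h' : IsAdjointPair B T S') : S = S' :=
  funext fun y => eq_of_rip_right B fun v => by rw [← h, ← h']

theorem AdjointableMap.isAdjointPair (T : AdjointableMap B E F) :
    IsAdjointPair B (T : E →L[ℂ] F) (AdjointableMap.adj T) := AdjointableMap.rip_adj T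

theorem AdjointableMap.rip_adj_left (T : AdjointableMap B E F) (y : F) (x : E) :
    rip B (AdjointableMap.adj T y) x = rip B y ((T : E →L[ℂ] F) x) :=
  (AdjointableMap.isAdjointPair T).symm y x

theorem AdjointableMap.adj_eq {T : AdjointableMap B E F} {S : F → E}
    (h : IsAdjointPair B (T : E →L[ℂ] F) S) : ⇑(AdjointableMap.adj T) = S :=
  (AdjointableMap.isAdjointPair T).eq h

theorem AdjointableMap.adj_sub (T T' : AdjointableMap B E F) (y : F) :
    AdjointableMap.adj (T - T') y = AdjointableMap.adj T y - AdjointableMap.adj T' y := by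
  refine congrFun (AdjointableMap.adj_eq (T := T - T')
    (S := fun y => AdjointableMap.adj T y - AdjointableMap.adj T' y) fun x y => ?_) y
  rw [rip_sub_right, ← AdjointableMap.rip_adj T, ← AdjointableMap.rip_adj T', ← rip_sub_left]
  rfl

theorem AdjointableMap.norm_adj_apply_le (T : AdjointableMap B E F) (y : F) :
    ‖AdjointableMap.adj T y‖ ≤ ‖T‖ * ‖y‖ := by
  set z := AdjointableMap.adj T y with hz
  have h1 : ‖z‖ ^ 2 ≤ ‖T‖ * ‖z‖ * ‖y‖ := by
    rw [norm_sq_eq_norm_rip B]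
    conv_lhs => rw [hz, ← AdjointableMap.rip_adj T, ← hz]
    refine (norm_rip_le B _ _).trans ?_
    gcongr
    exact (T : E →L[ℂ] F).le_opNorm z
  rcases eq_or_ne ‖z‖ 0 with h0 | h0
  · rw [h0]; positivity
  · have : 0 < ‖z‖ := lt_of_le_of_ne (norm_nonneg _) (Ne.symm h0)
    nlinarith

theorem rip_self_eq (x y : B) : rip B x y = star y * x := rfl

/-- The vectors `v` at which the adjoint of `t` is defined. -/
def adjointDomain (t : E →ₗ[ℂ] F) : Submodule ℂ F where
  carrier := {v | ∃ w, ∀ x, rip B (t x) v = rip B x w}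
  zero_mem' := ⟨0, fun x => by rw [rip_zero_right, rip_zero_right]⟩
  add_mem' := by
    rintro v v' ⟨w, h⟩ ⟨w', h'⟩
    exact ⟨w + w', fun x => by rw [rip_add_right, rip_add_right, h, h']⟩
  smul_mem' := by
    rintro c v ⟨w, h⟩
    exact ⟨c • w, fun x => by rw [rip_smul_right, rip_smul_right, h]⟩

/-- A linear map between Hilbert modules whose adjoint is densely defined is adjointable. -/
theorem exists_adjointable_of_dense [CompleteSpace E] [CompleteSpace F] (t : E →ₗ[ℂ] F) {D : Set F}
    (hD : Dense (Submodule.span ℂ D : Set F)) (h : ∀ v ∈ D, ∃ w, ∀ x, rip B (t x) v = rip B x w) :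
    ∃ T : AdjointableMap B E F, ((T : E →L[ℂ] F) : E →ₗ[ℂ] F) = t := by
  have hle : Submodule.span ℂ D ≤ adjointDomain (B := B) t := Submodule.span_le.2 h
  -- Closed graph theorem: the limit of `t (u n)` is identified by pairing with the dense set `D`,
  -- where the pairing moves onto `u n`.
  have hcont : Continuous t := by
    refine LinearMap.continuous_of_seq_closed_graph t fun u x y hu hy => ?_
    refine eq_of_rip_left_of_dense B hD fun v hv => ?_
    obtain ⟨w, hw⟩ := h v hv
    have h1 : Tendsto (fun n => rip B (t (u n)) v) atTop (𝓝 (rip B y v)) :=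
      Tendsto.rip hy tendsto_const_nhds
    have h2 : Tendsto (fun n => rip B (t (u n)) v) atTop (𝓝 (rip B (t x) v)) := by
      simp only [hw]
      exact Tendsto.rip hu tendsto_const_nhds
    exact tendsto_nhds_unique h1 h2
  set T : E →L[ℂ] F := ⟨t, hcont⟩ with hT
  have hTt : ∀ x, T x = t x := fun _ => rfl
  -- The partial adjoint is bounded by `‖T‖`, so it extends by continuity from the span of `D` to
  -- all of `F`.
  have hbound : ∀ v w, (∀ x, rip B (t x) v = rip B x w) → ‖w‖ ≤ ‖T‖ * ‖v‖ := by
    intro v w hw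
    have h1 : ‖w‖ ^ 2 ≤ ‖T‖ * ‖w‖ * ‖v‖ := by
      rw [norm_sq_eq_norm_rip B, ← hw]
      refine (norm_rip_le B _ _).trans ?_
      gcongr
      exact T.le_opNorm w
    rcases eq_or_ne ‖w‖ 0 with h0 | h0
    · rw [h0]; positivity
    · have : 0 < ‖w‖ := lt_of_le_of_ne (norm_nonneg _) (Ne.symm h0)
      nlinarith
  have hall : ∀ v, ∃ w, ∀ x, rip B (t x) v = rip B x w := by
    intro v
    obtain ⟨u, hu, huv⟩ := mem_closure_iff_seq_limit.1 (hD v)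
    choose w hw using fun n => hle (hu n)
    have hcau : CauchySeq w := by
      rw [cauchySeq_iff_tendsto_dist_atTop_0]
      have h0 := cauchySeq_iff_tendsto_dist_atTop_0.1 huv.cauchySeq
      refine squeeze_zero (fun _ => dist_nonneg) (fun p => ?_)
        (by simpa using h0.const_mul ‖T‖)
      rw [dist_eq_norm, dist_eq_norm]
      refine hbound _ _ fun x => ?_
      rw [rip_sub_right, rip_sub_right, hw, hw]
    obtain ⟨w0, hw0⟩ := cauchySeq_tendsto_of_complete hcau
    refine ⟨w0, fun x => tendsto_nhds_unique (Tendsto.rip tendsto_const_nhds huv) ?_⟩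
    simp only [hw]
    exact Tendsto.rip tendsto_const_nhds hw0
  choose S hS using hall
  have hSuniq : ∀ v w, (∀ x, rip B x w = rip B x (S v)) → w = S v := fun v w =>
    eq_of_rip_right B
  let S' : F →ₗ[ℂ] E :=
    { toFun := S
      map_add' := fun v v' => (hSuniq _ _ fun x => by
        rw [← hS, rip_add_right, rip_add_right, hS, hS]).symm
      map_smul' := fun c v => (hSuniq _ _ fun x => by
        rw [← hS, RingHom.id_apply, rip_smul_right, rip_smul_right, hS]).symm }
  exact ⟨⟨T, S'.mkContinuous ‖T‖ fun v => hbound v _ (hS v), fun x v => hS v x⟩, rfl⟩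

/-! ### Positive operators -/

/-- An operator with self-adjoint quadratic form is symmetric. -/
theorem isAdjointPair_self_of_star_eq {D : E →ₗ[ℂ] E}
    (h : ∀ v, star (rip B (D v) v) = rip B (D v) v) : IsAdjointPair B D D := by
  intro x y
  -- Polarization: `x + y` gives the sum of the two cross terms and `x + i y` their difference.
  have h1 := h (x + y)
  have h2 := h (x + Complex.I • y)
  simp only [map_add, map_smul, rip_add_left, rip_add_right, rip_smul_left, rip_smul_right,
    star_add, star_smul, h x, h y, RCLike.star_def, Complex.conj_I, map_neg, neg_neg] at h1 h2
  rw [← star_rip (D y)]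
  set p := rip B (D x) y
  set q := rip B (D y) x
  set r := rip B (D x) x
  set s := rip B (D y) y
  have e1 : star p + star q = p + q := by
    have e : star p + star q - (p + q)
      = (r + star q + (star p + s)) - (r + q + (p + s)) := by abel
    rw [← sub_eq_zero, e, h1, sub_self]
  have e2 : Complex.I • star p - Complex.I • star q = Complex.I • q - Complex.I • p := by
    have e : Complex.I • star p - Complex.I • star q - (Complex.I • q - Complex.I • p) =
       (r + -Complex.I • star q + (Complex.I • star p + -Complex.I • (Complex.I • s)))
        - (r + Complex.I • q + (-Complex.I • p + -Complex.I • (Complex.I • s))) := by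
      module
    rw [← sub_eq_zero, e, sub_eq_zero]
    convert h2 using 2
    all_goals module
  rw [← smul_sub, ← smul_sub] at e2
  have e3 : star p - star q = q - p := (smul_right_injective B Complex.I_ne_zero) e2
  have e4 : (2 : ℂ) • star p = (2 : ℂ) • q := by
    have e : (2 : ℂ) • star p - (2 : ℂ) • q =
      (star p + star q - (p + q)) + (star p - star q - (q - p)) := by module
    rw [← sub_eq_zero, e, e1, e3, sub_self, sub_self, add_zero]
  have e5 : star p = q := (smul_right_injective B (two_ne_zero (α := ℂ))) e4
  rw [← star_star p, e5]

theorem isAdjointPair_self_of_nonneg {D : E →ₗ[ℂ] E} (h : ∀ v, 0 ≤ rip B (D v) v) :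
    IsAdjointPair B D D :=
  isAdjointPair_self_of_star_eq fun v => (IsSelfAdjoint.of_nonneg (h v)).star_eq

/-- `D² ≤ s D` if `0 ≤ D ≤ s`. -/
theorem rip_apply_apply_le {D : E →ₗ[ℂ] E} (h : ∀ v, 0 ≤ rip B (D v) v) {s : ℝ} (hs : 0 < s)
    (h' : ∀ v, rip B (D v) v ≤ s • rip B v v) (v : E) :
    rip B (D v) (D v) ≤ s • rip B (D v) v := by
  have hsa := isAdjointPair_self_of_nonneg h
  set w := D v with hw
  -- Positivity of the form of `D` at `v - s⁻¹ D v`. The quadratic term is bounded through `⟨D w, w⟩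
  -- ≤ s ⟨w, w⟩`, which cancels one of the two cross terms.
  have h1 := h (v - ((s⁻¹ : ℝ) : ℂ) • w)
  have h2 := h' w
  simp only [map_sub, map_smul, rip_sub_left, rip_sub_right, rip_real_smul_left,
    rip_real_smul_right] at h1
  rw [← hw, hsa w v, ← hw] at h1
  have h3 : s⁻¹ • s⁻¹ • rip B (D w) w ≤ s⁻¹ • rip B w w := by
    refine (smul_le_smul_of_nonneg_left (smul_le_smul_of_nonneg_left h2 ?_) ?_).trans_eq ?_
    · positivity
    · positivity
    · rw [inv_smul_smul₀ hs.ne']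
  have h4 : 0 ≤ rip B w v - s⁻¹ • rip B w w := by
    rw [smul_sub] at h1
    exact h1.trans (sub_le_self _ (sub_nonneg.2 h3))
  have h5 := smul_le_smul_of_nonneg_left (sub_nonneg.1 h4) hs.le
  rwa [smul_inv_smul₀ hs.ne'] at h5

theorem norm_apply_sq_le {D : E →ₗ[ℂ] E} (h : ∀ v, 0 ≤ rip B (D v) v) {s : ℝ} (hs : 0 < s)
    (h' : ∀ v, rip B (D v) v ≤ s • rip B v v) (v : E) :
    ‖D v‖ ^ 2 ≤ s * ‖rip B (D v) v‖ := by
  rw [norm_sq_eq_norm_rip B]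
  refine (CStarAlgebra.norm_le_norm_of_nonneg_of_le (rip_self_nonneg _)
    (rip_apply_apply_le h hs h' v)).trans ?_
  rw [norm_smul, Real.norm_of_nonneg hs.le]

theorem norm_apply_le_of_nonneg {D : E →ₗ[ℂ] E} (h : ∀ v, 0 ≤ rip B (D v) v) {s : ℝ} (hs : 0 < s)
    (h' : ∀ v, rip B (D v) v ≤ s • rip B v v) (v : E) : ‖D v‖ ≤ s * ‖v‖ := by
  have h1 := norm_apply_sq_le h hs h' v
  have h2 : ‖rip B (D v) v‖ ≤ s * ‖v‖ ^ 2 := by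
    rw [norm_sq_eq_norm_rip B]
    have e : s * ‖rip B v v‖ = ‖s • rip B v v‖ := by rw [norm_smul, Real.norm_of_nonneg hs.le]
    rw [e]
    exact CStarAlgebra.norm_le_norm_of_nonneg_of_le (h v) (h' v)
  refine abs_le_of_sq_le_sq' ?_ (by positivity) |>.2
  nlinarith

/-- A symmetric operator whose powers are bounded at `v` satisfies `D ≤ 1` at `v`. -/
theorem rip_apply_le_of_bounded_pow {D : E →ₗ[ℂ] E} (h : IsAdjointPair B D D) (v : E) {C : ℝ}
    (hC : ∀ n : ℕ, ‖(D ^ n) v‖ ≤ C) : rip B (D v) v ≤ rip B v v := by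
  have hpow : ∀ n : ℕ, IsAdjointPair B ⇑(D ^ n) ⇑(D ^ n) := by
    intro n
    induction n with
    | zero => intro x y; rfl
    | succ n ih =>
      intro x y
      rw [pow_succ', Module.End.mul_apply, h, ih, ← Module.End.mul_apply, ← pow_succ, pow_succ']
  -- With `G = D ^ (2 ^ n)`, positivity of `(1 - G)²` gives `G - 1 ≤ (G² - 1) / 2`. Iterating halves
  -- the remainder, which tends to `0` because the powers are bounded at `v`; no spectral theory is
  -- needed.
  have key : ∀ n : ℕ, rip B (D v) v ≤ rip B v v
      + ((1 / 2 : ℝ) ^ n) • (rip B ((D ^ (2 ^ n)) v) v - rip B v v) := by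
    intro n
    induction n with
    | zero => simp
    | succ n ih =>
      refine ih.trans (add_le_add_right ?_ _)
      set G := D ^ (2 ^ n) with hG
      have hG2 : D ^ (2 ^ (n + 1)) = G * G := by rw [hG, ← pow_add]; ring_nf
      have h1 := rip_self_nonneg (B := B) (v - G v)
      simp only [rip_sub_left, rip_sub_right] at h1
      have e1 : rip B v (G v) = rip B (G v) v := (hpow _ v v).symm
      have e2 : rip B (G v) (G v) = rip B ((D ^ (2 ^ (n + 1))) v) v := by
        rw [hG2, Module.End.mul_apply, hpow (2 ^ n) (G v) v]
      rw [e1, e2] at h1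
      rw [pow_succ, mul_smul]
      refine smul_le_smul_of_nonneg_left ?_ (by positivity)
      set X := rip B ((D ^ (2 ^ (n + 1))) v) v
      have e3 : (1 / 2 : ℝ) • (X - rip B v v) - (rip B (G v) v - rip B v v)
        = (1 / 2 : ℝ) • (rip B v v - rip B (G v) v - (rip B (G v) v - X)) := by module
      rw [← sub_nonneg, e3]
      exact smul_nonneg (by norm_num) h1
  have hlim : Tendsto (fun n : ℕ => rip B v v
      + ((1 / 2 : ℝ) ^ n) • (rip B ((D ^ (2 ^ n)) v) v - rip B v v)) atTop (𝓝 (rip B v v + 0)) := by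
    refine tendsto_const_nhds.add ?_
    rw [tendsto_zero_iff_norm_tendsto_zero]
    have h0 : Tendsto (fun n : ℕ => (1 / 2 : ℝ) ^ n * (C * ‖v‖ + ‖rip B v v‖)) atTop (𝓝 0) := by
      simpa using (tendsto_pow_atTop_nhds_zero_of_lt_one (r := (1 / 2 : ℝ)) (by norm_num)
        (by norm_num)).mul_const (C * ‖v‖ + ‖rip B v v‖)
    refine squeeze_zero (fun _ => norm_nonneg _) (fun n => ?_) h0
    rw [norm_smul, Real.norm_of_nonneg (by positivity)]
    gcongr
    refine (norm_sub_le _ _).trans (add_le_add_left ((norm_rip_le B _ _).trans ?_) _)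
    gcongr
    exact hC _
  rw [add_zero] at hlim
  rw [← sub_nonneg]
  exact CStarAlgebra.isClosed_nonneg.mem_of_tendsto (hlim.sub_const (rip B (D v) v))
    (Eventually.of_forall fun n => sub_nonneg.2 (key n))

/-- A symmetric operator of norm at most `s` satisfies `D ≤ s`. -/
theorem rip_apply_le_of_norm_le {D : E →ₗ[ℂ] E} (h : IsAdjointPair B D D) {s : ℝ} (hs : 0 < s)
    (hD : ∀ v, ‖D v‖ ≤ s * ‖v‖) (v : E) : rip B (D v) v ≤ s • rip B v v := by
  have h1 : rip B ((((s⁻¹ : ℝ) : ℂ) • D) v) v ≤ rip B v v := by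
    refine rip_apply_le_of_bounded_pow (fun x y => ?_) v (C := ‖v‖) fun n => ?_
    · simp only [LinearMap.smul_apply, rip_real_smul_left, rip_real_smul_right, h x y]
    · induction n with
      | zero => simp
      | succ n ih =>
        rw [pow_succ', Module.End.mul_apply, LinearMap.smul_apply, norm_smul, Complex.norm_real,
          Real.norm_of_nonneg (by positivity), inv_mul_le_iff₀ hs]
        exact (hD _).trans (by gcongr)
  rw [LinearMap.smul_apply, rip_real_smul_left] at h1
  have h2 := smul_le_smul_of_nonneg_left h1 hs.le
  rwa [smul_inv_smul₀ hs.ne'] at h2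

/-- The operator `T* T` is symmetric with norm at most `1`. -/
theorem AdjointableMap.rip_apply_self_le {T : AdjointableMap B E F} (hT : ‖T‖ ≤ 1) (v : E) :
    rip B ((T : E →L[ℂ] F) v) ((T : E →L[ℂ] F) v) ≤ rip B v v := by
  have h := rip_apply_le_of_norm_le (B := B)
    (D := ((AdjointableMap.adj T ∘L (T : E →L[ℂ] F) : E →L[ℂ] E) : E →ₗ[ℂ] E))
    (fun x y => (AdjointableMap.rip_adj_left T _ _).trans (AdjointableMap.rip_adj T _ _))
    one_pos (fun w => ?_) v
  · rw [one_smul] at h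
    exact (AdjointableMap.rip_adj_left T _ _).symm.trans_le h
  · refine (AdjointableMap.norm_adj_apply_le T _).trans ?_
    have h1 : ‖(T : E →L[ℂ] F) w‖ ≤ 1 * ‖w‖ := (T : E →L[ℂ] F).le_of_opNorm_le hT w
    calc ‖T‖ * ‖(T : E →L[ℂ] F) w‖ ≤ 1 * (1 * ‖w‖) := by gcongr
      _ = 1 * ‖w‖ := by ring

end HilbertModules

/-! ### Multipliers and the strict topology. -/

section Multipliers

variable {A : Type uA} {B : Type uB} [NonUnitalCStarAlgebra A] [NonUnitalCStarAlgebra B]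

theorem eq_of_forall_mul_left_eq {x y : A} (h : ∀ z, z * x = z * y) : x = y := by
  rw [← sub_eq_zero, ← CStarRing.star_mul_self_eq_zero_iff, mul_sub, h, sub_self]

theorem eq_of_forall_mul_right_eq {x y : A} (h : ∀ z, x * z = y * z) : x = y := by
  rw [← sub_eq_zero, ← CStarRing.mul_star_self_eq_zero_iff, sub_mul, h, sub_self]

namespace DoubleCentralizer

theorem coe_fst_apply (x y : A) : (x : 𝓜(ℂ, A)).fst y = x * y := by simp

theorem coe_snd_apply (x y : A) : (x : 𝓜(ℂ, A)).snd y = y * x := by simp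

theorem ext_fst {m n : 𝓜(ℂ, A)} (h : ∀ c, m.fst c = n.fst c) : m = n := by
  refine DoubleCentralizer.ext ℂ A m n (Prod.ext (ContinuousLinearMap.ext h)
    (ContinuousLinearMap.ext fun c => ?_))
  exact eq_of_forall_mul_right_eq fun z => by rw [m.central, h, ← n.central]

theorem snd_mul_apply (m : 𝓜(ℂ, A)) (x y : A) : m.snd (x * y) = x * m.snd y :=
  eq_of_forall_mul_right_eq fun z => by
    rw [m.central, mul_assoc, mul_assoc, ← m.central]

theorem norm_fst_apply_le (m : 𝓜(ℂ, A)) (x : A) : ‖m.fst x‖ ≤ ‖m‖ * ‖x‖ := by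
  rw [← norm_fst]; exact m.fst.le_opNorm x

theorem norm_snd_apply_le (m : 𝓜(ℂ, A)) (x : A) : ‖m.snd x‖ ≤ ‖m‖ * ‖x‖ := by
  rw [← norm_snd]; exact m.snd.le_opNorm x

theorem coe_snd_eq_mul (m : 𝓜(ℂ, A)) (x : A) : ((m.snd x : A) : 𝓜(ℂ, A)) = x * m :=
  ext_fst fun c => by rw [coe_fst_apply, m.central, mul_fst]; simp

theorem coe_sub (x y : A) : ((x - y : A) : 𝓜(ℂ, A)) = x - y :=
  ext_fst fun c => by simp

theorem coe_star_mul (x y : A) : ((star x * y : A) : 𝓜(ℂ, A)) = star (x : 𝓜(ℂ, A)) * y :=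
  ext_fst fun c => by simp [mul_fst, star_fst, mul_assoc]

theorem coe_zero : ((0 : A) : 𝓜(ℂ, A)) = 0 := ext_fst fun c => by simp

theorem norm_coe (x : A) : ‖(x : 𝓜(ℂ, A))‖ = ‖x‖ := by
  rw [← norm_fst, coe_fst]
  exact ContinuousLinearMap.opNorm_mul_apply ℂ A x

/-- Maps `L` and `R` with `R x * y = x * L y` form a double centralizer. -/
def ofCentral (L R : A → A) (h : ∀ x y, R x * y = x * L y) : 𝓜(ℂ, A) where
  -- Linearity and boundedness are automatic: `z * L x = R z * x` determines `L x`, since left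
  -- multiplication by all `z` separates points of `A`. The closed graph theorem applies for the
  -- same reason, and symmetrically for `R`.
  fst :=
    ContinuousLinearMap.ofSeqClosedGraph (g :=
      { toFun := L
        map_add' := fun x y => eq_of_forall_mul_left_eq fun z => by
          rw [← h, mul_add, mul_add, h, h]
        map_smul' := fun c x => eq_of_forall_mul_left_eq fun z => by
          rw [← h, RingHom.id_apply, mul_smul_comm, mul_smul_comm, h] })
      fun u x y hu hy => eq_of_forall_mul_left_eq fun z => by
        have h1 := hy.const_mul z
        have h2 := hu.const_mul (R z)
        refine tendsto_nhds_unique h1 ?_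
        simp only [h] at h2
        exact h2
  snd :=
    ContinuousLinearMap.ofSeqClosedGraph (g :=
      { toFun := R
        map_add' := fun x y => eq_of_forall_mul_right_eq fun z => by
          rw [h, add_mul, add_mul, h, h]
        map_smul' := fun c x => eq_of_forall_mul_right_eq fun z => by
          rw [h, RingHom.id_apply, smul_mul_assoc, smul_mul_assoc, h] })
      fun u x y hu hy => eq_of_forall_mul_right_eq fun z => by
        have h1 := hy.mul_const z
        have h2 := hu.mul_const (L z)
        refine tendsto_nhds_unique h1 ?_
        simp only [← h] at h2
        exact h2
  central x y := h x y

@[simp]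
theorem ofCentral_fst (L R : A → A) (h : ∀ x y, R x * y = x * L y) (x : A) :
    (ofCentral L R h).fst x = L x := rfl

@[simp]
theorem ofCentral_snd (L R : A → A) (h : ∀ x y, R x * y = x * L y) (x : A) :
    (ofCentral L R h).snd x = R x := rfl

end DoubleCentralizer

open DoubleCentralizer

section StrictTendsto

variable {ι κ : Type*} {l : Filter ι} {f f' : ι → 𝓜(ℂ, A)} {y y' : 𝓜(ℂ, A)}

theorem StrictTendsto.comp (h : StrictTendsto f l y) {l' : Filter κ} {k : κ → ι}
    (hk : Tendsto k l' l) : StrictTendsto (fun i => f (k i)) l' y :=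
  fun c => ⟨(h c).1.comp hk, (h c).2.comp hk⟩

theorem StrictTendsto.sub (h : StrictTendsto f l y) (h' : StrictTendsto f' l y') :
    StrictTendsto (fun i => f i - f' i) l (y - y') :=
  fun c => ⟨(h c).1.sub (h' c).1, (h c).2.sub (h' c).2⟩

theorem StrictTendsto.add (h : StrictTendsto f l y) (h' : StrictTendsto f' l y') :
    StrictTendsto (fun i => f i + f' i) l (y + y') :=
  fun c => ⟨(h c).1.add (h' c).1, (h c).2.add (h' c).2⟩

theorem StrictTendsto.const_smul (c : ℂ) (h : StrictTendsto f l y) :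
    StrictTendsto (fun i => c • f i) l (c • y) :=
  fun b => ⟨(h b).1.const_smul c, (h b).2.const_smul c⟩

theorem strictTendsto_const (y : 𝓜(ℂ, A)) : StrictTendsto (fun _ : ι => y) l y :=
  fun _ => ⟨tendsto_const_nhds, tendsto_const_nhds⟩

theorem StrictTendsto.star (h : StrictTendsto f l y) :
    StrictTendsto (fun i => star (f i)) l (star y) := fun c => by
  simp only [star_fst, star_snd]
  exact ⟨(h _).2.star, (h _).1.star⟩

theorem StrictTendsto.eq [l.NeBot] (h : StrictTendsto f l y) (h' : StrictTendsto f l y') :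
    y = y' := ext_fst fun c => tendsto_nhds_unique (h c).1 (h' c).1

theorem StrictTendsto.congr' (h : StrictTendsto f l y) (e : f =ᶠ[l] f') :
    StrictTendsto f' l y := fun c =>
  ⟨(h c).1.congr' (e.mono fun _ hi => by rw [hi]), (h c).2.congr' (e.mono fun _ hi => by rw [hi])⟩

theorem StrictTendsto.of_tendsto (h : Tendsto f l (𝓝 y)) : StrictTendsto f l y := by
  have h0 := tendsto_iff_norm_sub_tendsto_zero.1 h
  intro c
  constructor
  · rw [tendsto_iff_norm_sub_tendsto_zero]
    refine squeeze_zero (fun _ => norm_nonneg _) (fun i => ?_) (by simpa using h0.mul_const ‖c‖)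
    exact norm_fst_apply_le (f i - y) c
  · rw [tendsto_iff_norm_sub_tendsto_zero]
    refine squeeze_zero (fun _ => norm_nonneg _) (fun i => ?_) (by simpa using h0.mul_const ‖c‖)
    exact norm_snd_apply_le (f i - y) c

theorem StrictTendsto.coe_of_tendsto {f : ι → A} {y : A} (h : Tendsto f l (𝓝 y)) :
    StrictTendsto (fun i => (f i : 𝓜(ℂ, A))) l y := fun c => by
  simp only [coe_fst_apply, coe_snd_apply]
  exact ⟨h.mul_const c, h.const_mul c⟩

/-- A uniform bound makes evaluation jointly continuous. This gives products of bounded strictly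
convergent nets, and later the limits of `π(e) Sᵢ`. -/
theorem tendsto_apply_of_bounded {V W : Type*} [NormedAddCommGroup V] [NormedAddCommGroup W]
    [NormedSpace ℂ V] [NormedSpace ℂ W] {T : ι → V →L[ℂ] W} {T₀ : V →L[ℂ] W} {r : ℝ}
    (hr : ∀ᶠ i in l, ‖T i‖ ≤ r) (hT : ∀ v, Tendsto (fun i => T i v) l (𝓝 (T₀ v))) {v : ι → V}
    {v₀ : V} (hv : Tendsto v l (𝓝 v₀)) : Tendsto (fun i => T i (v i)) l (𝓝 (T₀ v₀)) := by
  have h1 : Tendsto (fun i => T i (v i - v₀)) l (𝓝 0) := by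
    rw [tendsto_zero_iff_norm_tendsto_zero]
    have h0 : Tendsto (fun i => r * ‖v i - v₀‖) l (𝓝 0) := by
      simpa using (tendsto_iff_norm_sub_tendsto_zero.1 hv).const_mul r
    refine squeeze_zero' (Eventually.of_forall fun _ => norm_nonneg _) (hr.mono fun i hi => ?_) h0
    exact (T i).le_of_opNorm_le hi _
  simpa using h1.add (hT v₀)

theorem StrictTendsto.mul (h : StrictTendsto f l y) (h' : StrictTendsto f' l y') {r r' : ℝ}
    (hr : ∀ᶠ i in l, ‖f i‖ ≤ r) (hr' : ∀ᶠ i in l, ‖f' i‖ ≤ r') :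
    StrictTendsto (fun i => f i * f' i) l (y * y') := fun c => by
  constructor
  · have h1 := tendsto_apply_of_bounded (T := fun i => (f i).fst) (T₀ := y.fst)
      (v := fun i => (f' i).fst c) (hr.mono fun i hi => (norm_fst _).trans_le hi)
      (fun v => (h v).1) (h' c).1
    rw [mul_fst]
    refine h1.congr fun i => ?_
    rw [mul_fst]; rfl
  · have h1 := tendsto_apply_of_bounded (T := fun i => (f' i).snd) (T₀ := y'.snd)
      (v := fun i => (f i).snd c) (hr'.mono fun i hi => (norm_snd _).trans_le hi)
      (fun v => (h' v).2) (h c).2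
    rw [mul_snd]
    refine h1.congr fun i => ?_
    rw [mul_snd]; rfl

end StrictTendsto

section Approximation

variable [PartialOrder A] [StarOrderedRing A]

theorem tendsto_approximateUnit_mul (a : A) :
    Tendsto (fun e => e * a) (CStarAlgebra.approximateUnit A) (𝓝 a) :=
  (CStarAlgebra.increasingApproximateUnit A).tendsto_mul_right a

theorem tendsto_mul_approximateUnit (a : A) :
    Tendsto (fun e => a * e) (CStarAlgebra.approximateUnit A) (𝓝 a) :=
  (CStarAlgebra.increasingApproximateUnit A).tendsto_mul_left a

theorem eventually_approximateUnit :
    ∀ᶠ e in CStarAlgebra.approximateUnit A, star e = e ∧ ‖e‖ ≤ 1 :=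
  (CStarAlgebra.increasingApproximateUnit A).eventually_star_eq.and
    (CStarAlgebra.increasingApproximateUnit A).eventually_norm

theorem strictTendsto_approximateUnit :
    StrictTendsto (fun e : A => (e : 𝓜(ℂ, A))) (CStarAlgebra.approximateUnit A) 1 := fun c => by
  simp only [coe_fst_apply, coe_snd_apply]
  exact ⟨tendsto_approximateUnit_mul c, tendsto_mul_approximateUnit c⟩

theorem strictTendsto_snd_approximateUnit (m : 𝓜(ℂ, A)) :
    StrictTendsto (fun e : A => ((m.snd e : A) : 𝓜(ℂ, A))) (CStarAlgebra.approximateUnit A) m := by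
  have h := strictTendsto_approximateUnit.mul (strictTendsto_const (A := A) m) (r := 1)
    (eventually_approximateUnit.mono fun e he => (norm_coe e).trans_le he.2)
    (Eventually.of_forall fun _ => le_rfl)
  rw [one_mul] at h
  simpa only [coe_snd_eq_mul] using h

/-- The elements `e m` lie in `A`, tend strictly to `m` and have norm at most `‖m‖`. Moving each
into `D` by at most `1 / (n + 1) ≤ 1` costs at most `1` in the bound. -/
theorem exists_strict_approx (m : 𝓜(ℂ, A)) {D : Set A} (hD : Dense D) :
    ∃ l : Filter A, l.NeBot ∧ (∀ᶠ x in l, x ∈ D ∧ ‖x‖ ≤ ‖m‖ + 1) ∧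
      StrictTendsto (fun x : A => (x : 𝓜(ℂ, A))) l m := by
  choose k hkD hk using fun (e : A) (n : ℕ) =>
    Metric.dense_iff.1 hD (m.snd e) (1 / ((n : ℝ) + 1)) (by positivity)
  set L := CStarAlgebra.approximateUnit A ×ˢ (atTop : Filter ℕ) with hL
  have hk' : ∀ e n, ‖k e n - m.snd e‖ ≤ 1 / ((n : ℝ) + 1) := fun e n => by
    rw [← dist_eq_norm]; exact (hkD e n).le
  have h0 : Tendsto (fun p : A × ℕ => k p.1 p.2 - m.snd p.1) L (𝓝 0) := by
    rw [tendsto_zero_iff_norm_tendsto_zero]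
    exact squeeze_zero (fun _ => norm_nonneg _) (fun p => hk' p.1 p.2)
      (tendsto_one_div_add_atTop_nhds_zero_nat.comp tendsto_snd)
  refine ⟨L.map fun p => k p.1 p.2, inferInstance, ?_, ?_⟩
  · rw [eventually_map]
    filter_upwards [tendsto_fst.eventually (eventually_approximateUnit (A := A))] with p hp
    refine ⟨hk _ _, ?_⟩
    have h1 : ‖m.snd p.1‖ ≤ ‖m‖ * 1 := (norm_snd_apply_le _ _).trans (by gcongr; exact hp.2)
    have h2 : 1 / ((p.2 : ℝ) + 1) ≤ 1 := by
      rw [div_le_one (by positivity)]; linarith [(Nat.cast_nonneg p.2 : (0 : ℝ) ≤ p.2)]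
    have h3 := norm_add_le (k p.1 p.2 - m.snd p.1) (m.snd p.1)
    rw [sub_add_cancel] at h3
    linarith [hk' p.1 p.2]
  · have h1 := (StrictTendsto.coe_of_tendsto h0).add
      ((strictTendsto_snd_approximateUnit m).comp (tendsto_fst (g := (atTop : Filter ℕ))))
    have h2 : StrictTendsto (fun p : A × ℕ => ((k p.1 p.2 : A) : 𝓜(ℂ, A))) L m := by
      simpa only [coe_sub, sub_add_cancel, coe_zero, zero_add] using h1
    exact fun c => ⟨tendsto_map'_iff.2 (h2 c).1, tendsto_map'_iff.2 (h2 c).2⟩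

end Approximation

/-! ### Strict linear maps and their extension to the multiplier algebra. -/

section Strict

theorem IsStrict.tendsto {ρ : A →ₗ[ℂ] 𝓜(ℂ, B)} (hρ : IsStrict ρ) {ι : Type*} {l : Filter ι}
    {f : ι → A} {x : A} {r : ℝ} (hr : ∀ᶠ i in l, ‖f i‖ ≤ r)
    (hf : StrictTendsto (fun i => (f i : 𝓜(ℂ, A))) l x) :
    StrictTendsto (fun i => ρ (f i)) l (ρ x) := by
  have h := hρ r (l.map f) x (eventually_map.2 hr)
    fun c => ⟨tendsto_map'_iff.2 (hf c).1, tendsto_map'_iff.2 (hf c).2⟩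
  exact fun c => ⟨tendsto_map'_iff.1 (h c).1, tendsto_map'_iff.1 (h c).2⟩

/-- Closed graph theorem: a norm convergent sequence is eventually bounded and converges strictly.
-/
theorem IsStrict.continuous {ρ : A →ₗ[ℂ] 𝓜(ℂ, B)} (hρ : IsStrict ρ) : Continuous ρ := by
  refine LinearMap.continuous_of_seq_closed_graph ρ fun u x y hu hy => ?_
  have h1 : ∀ᶠ n in atTop, ‖u n‖ ≤ ‖x‖ + 1 :=
    (hu.norm.eventually (gt_mem_nhds (lt_add_one _))).mono fun _ h => le_of_lt h
  exact (StrictTendsto.of_tendsto hy).eq (hρ.tendsto h1 (StrictTendsto.coe_of_tendsto hu))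

theorem IsStrict.exists_norm_le {ρ : A →ₗ[ℂ] 𝓜(ℂ, B)} (hρ : IsStrict ρ) :
    ∃ C, 0 ≤ C ∧ ∀ x, ‖ρ x‖ ≤ C * ‖x‖ :=
  let R : A →L[ℂ] 𝓜(ℂ, B) := ⟨ρ, hρ.continuous⟩
  ⟨‖R‖, norm_nonneg _, R.le_opNorm⟩

theorem IsStrict.add {ρ σ : A →ₗ[ℂ] 𝓜(ℂ, B)} (hρ : IsStrict ρ) (hσ : IsStrict σ) :
    IsStrict (ρ + σ) := fun r l x hr hl => (hρ r l x hr hl).add (hσ r l x hr hl)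

theorem IsStrict.smul {ρ : A →ₗ[ℂ] 𝓜(ℂ, B)} (hρ : IsStrict ρ) (c : ℂ) :
    IsStrict (c • ρ) := fun r l x hr hl => (hρ r l x hr hl).const_smul c

theorem IsStrict.tendsto_fst_sub {ρ : A →ₗ[ℂ] 𝓜(ℂ, B)} (hρ : IsStrict ρ) {l l' : Filter A}
    {r r' : ℝ} {m : 𝓜(ℂ, A)} (hr : ∀ᶠ x in l, ‖x‖ ≤ r) (hr' : ∀ᶠ x in l', ‖x‖ ≤ r')
    (hl : StrictTendsto (fun x : A => (x : 𝓜(ℂ, A))) l m)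
    (hl' : StrictTendsto (fun x : A => (x : 𝓜(ℂ, A))) l' m) :
    StrictTendsto (fun p : A × A => ρ p.1 - ρ p.2) (l ×ˢ l') 0 := by
  have h1 := (hl.comp (tendsto_fst (g := l'))).sub (hl'.comp (tendsto_snd (f := l)))
  simp only [← coe_sub, sub_self, ← coe_zero] at h1
  have h2 : ∀ᶠ p in l ×ˢ l', ‖p.1 - p.2‖ ≤ r + r' := by
    filter_upwards [hr.prod_mk hr'] with p hp
    exact (norm_sub_le _ _).trans (add_le_add hp.1 hp.2)
  simpa only [map_sub, map_zero] using hρ.tendsto h2 h1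

theorem tendsto_of_tendsto_sub_prod {X V : Type*} [NormedAddCommGroup V] {l l' : Filter X}
    [l'.NeBot] {f : X → V} {v : V}
    (h : Tendsto (fun p : X × X => f p.1 - f p.2) (l ×ˢ l') (𝓝 0)) (h' : Tendsto f l' (𝓝 v)) :
    Tendsto f l (𝓝 v) := by
  have h1 := h.add (h'.comp (tendsto_snd (f := l)))
  simp only [Function.comp_def, sub_add_cancel, zero_add] at h1
  have h2 : Tendsto f (map Prod.fst (l ×ˢ l')) (𝓝 v) := tendsto_map'_iff.2 h1
  rwa [map_fst_prod] at h2

theorem cauchy_map_of_tendsto_sub {X V : Type*} [NormedAddCommGroup V] {l : Filter X} [l.NeBot]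
    {f : X → V} (h : Tendsto (fun p : X × X => f p.1 - f p.2) (l ×ˢ l) (𝓝 0)) :
    Cauchy (map f l) := by
  rw [cauchy_map_iff]
  refine ⟨inferInstance, tendsto_uniformity_iff_dist_tendsto_zero.2 ?_⟩
  simpa only [dist_eq_norm] using tendsto_zero_iff_norm_tendsto_zero.1 h

variable [PartialOrder A] [StarOrderedRing A]

/-- Two bounded nets with the same strict limit differ by a net whose image tends strictly to `0`.
So the image of one approximating net is Cauchy at every `b`, all other nets share its limit, and
the pointwise limits inherit the central identity of a multiplier. -/
theorem IsStrict.exists_strict_limit {ρ : A →ₗ[ℂ] 𝓜(ℂ, B)} (hρ : IsStrict ρ) (m : 𝓜(ℂ, A)) :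
    ∃ y : 𝓜(ℂ, B), ∀ (r : ℝ) (l : Filter A), (∀ᶠ x in l, ‖x‖ ≤ r) →
      StrictTendsto (fun x : A => (x : 𝓜(ℂ, A))) l m → StrictTendsto ρ l y := by
  obtain ⟨l₀, hne, hr, hl⟩ := exists_strict_approx m dense_univ
  have hr₀ := hr.mono fun x hx => hx.2
  have h0 := hρ.tendsto_fst_sub hr₀ hr₀ hl hl
  choose P hP using fun b : B =>
    CompleteSpace.complete (cauchy_map_of_tendsto_sub (f := fun x => (ρ x).fst b) (h0 b).1)
  choose Q hQ using fun b : B =>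
    CompleteSpace.complete (cauchy_map_of_tendsto_sub (f := fun x => (ρ x).snd b) (h0 b).2)
  have hP' : ∀ b, Tendsto (fun x => (ρ x).fst b) l₀ (𝓝 (P b)) := hP
  have hQ' : ∀ b, Tendsto (fun x => (ρ x).snd b) l₀ (𝓝 (Q b)) := hQ
  refine ⟨ofCentral P Q fun b b' => tendsto_nhds_unique ((hQ' b).mul_const b') ?_,
    fun r l hr' hl' b => ?_⟩
  · simp only [(ρ _).central]
    exact (hP' b').const_mul b
  · have h := hρ.tendsto_fst_sub hr' hr₀ hl' hl b
    exact ⟨tendsto_of_tendsto_sub_prod h.1 (hP' b), tendsto_of_tendsto_sub_prod h.2 (hQ' b)⟩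

/-- A strict linear map extends to the multiplier algebra, strictly continuously on bounded sets. -/
theorem IsStrict.exists_isStrictExtension {ρ : A →ₗ[ℂ] 𝓜(ℂ, B)} (hρ : IsStrict ρ) :
    ∃ σ, IsStrictExtension ρ σ := by
  choose s hs using hρ.exists_strict_limit
  have happ : ∀ m : 𝓜(ℂ, A), ∃ l : Filter A, l.NeBot ∧ (∀ᶠ x in l, ‖x‖ ≤ ‖m‖ + 1) ∧
      StrictTendsto (fun x : A => (x : 𝓜(ℂ, A))) l m := fun m => by
    obtain ⟨l, h1, h2, h3⟩ := exists_strict_approx m dense_univ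
    exact ⟨l, h1, h2.mono fun x hx => hx.2, h3⟩
  have hlim : ∀ {ι : Type uA} (l : Filter ι) (f : ι → A) (m : 𝓜(ℂ, A)) (r : ℝ),
      (∀ᶠ i in l, ‖f i‖ ≤ r) → StrictTendsto (fun i => (f i : 𝓜(ℂ, A))) l m →
      StrictTendsto (fun i => ρ (f i)) l (s m) := fun l f m r hr hl => by
    have h := hs m r (l.map f) (eventually_map.2 hr)
      fun c => ⟨tendsto_map'_iff.2 (hl c).1, tendsto_map'_iff.2 (hl c).2⟩
    exact fun c => ⟨tendsto_map'_iff.1 (h c).1, tendsto_map'_iff.1 (h c).2⟩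
  have hcoe : ∀ x y : A, ((x + y : A) : 𝓜(ℂ, A)) = x + y := fun x y =>
    ext_fst fun c => by simp
  have hcoe' : ∀ (c : ℂ) (x : A), ((c • x : A) : 𝓜(ℂ, A)) = c • (x : 𝓜(ℂ, A)) := fun c x =>
    ext_fst fun b => by simp
  let σ : 𝓜(ℂ, A) →ₗ[ℂ] 𝓜(ℂ, B) :=
    { toFun := s
      map_add' := fun m m' => by
        obtain ⟨l, _, hr, hl⟩ := happ m
        obtain ⟨l', _, hr', hl'⟩ := happ m'
        have h1 := hlim (l ×ˢ l') (fun p => p.1 + p.2) (m + m') (‖m‖ + 1 + (‖m'‖ + 1))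
          (by
            filter_upwards [hr.prod_mk hr'] with p hp
            exact (norm_add_le _ _).trans (add_le_add hp.1 hp.2))
          (by
            simp only [hcoe]
            exact (hl.comp tendsto_fst).add (hl'.comp tendsto_snd))
        simp only [map_add] at h1
        exact h1.eq (((hs m _ l hr hl).comp tendsto_fst).add ((hs m' _ l' hr' hl').comp tendsto_snd))
      map_smul' := fun c m => by
        obtain ⟨l, _, hr, hl⟩ := happ m
        have h1 := hlim l (fun x => c • x) (c • m) (‖c‖ * (‖m‖ + 1))
          (hr.mono fun x hx => by rw [norm_smul]; gcongr)
          (by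
            simp only [hcoe']
            exact hl.const_smul c)
        simp only [map_smul] at h1
        exact h1.eq ((hs m _ l hr hl).const_smul c) }
  have hσ : ∀ m, σ m = s m := fun _ => rfl
  refine ⟨σ, fun a => ?_, fun r l x hr hl => ?_⟩
  · exact ((hs a ‖a‖ (pure a) (by simp) (fun c => ⟨tendsto_pure_nhds _ _, tendsto_pure_nhds _ _⟩)).eq
      (fun c => ⟨tendsto_pure_nhds _ _, tendsto_pure_nhds _ _⟩))
  -- Strict continuity on bounded sets is proved with neighbourhoods of `0` in the strict topology
  -- itself.
  · let τ : TopologicalSpace 𝓜(ℂ, A) := TopologicalSpace.induced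
      (fun m => ((fun c => m.fst c, fun c => m.snd c) : (A → A) × (A → A))) inferInstance
    have hτ : ∀ {ι : Type uA} {l' : Filter ι} {f : ι → 𝓜(ℂ, A)} {m : 𝓜(ℂ, A)},
        StrictTendsto f l' m ↔ Tendsto f l' (@nhds _ τ m) := by
      intro ι l' f m
      rw [nhds_induced, tendsto_comap_iff, nhds_prod_eq, tendsto_prod_iff', Function.comp_def,
        tendsto_pi_nhds, tendsto_pi_nhds, ← forall_and]
      rfl
    -- An estimate for `ρ` on a strict neighbourhood of `0` in the `R`-ball of `A` passes to
    -- multipliers: an open neighbourhood containing `m` eventually contains the elements of `A`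
    -- approximating `m`, whose norm is at most `‖m‖ + 1`.
    have key : ∀ (b : B) (R ε : ℝ), 0 < ε → ∀ᶠ m in @nhds _ τ 0, ‖m‖ + 1 ≤ R →
        ‖(σ m).fst b‖ ≤ ε ∧ ‖(σ m).snd b‖ ≤ ε := by
      intro b R ε hε
      set N : Filter A := comap (fun x : A => (x : 𝓜(ℂ, A))) (@nhds _ τ 0) ⊓ 𝓟 {x | ‖x‖ ≤ R}
      have hN : StrictTendsto (fun x : A => (x : 𝓜(ℂ, A))) N (0 : A) := by
        rw [coe_zero, hτ]
        exact tendsto_comap.mono_left inf_le_left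
      have h1 := hρ R N 0 (eventually_inf_principal.2 (Eventually.of_forall fun _ h => h)) hN b
      rw [map_zero] at h1
      have h2 : ∀ᶠ x in N, ‖(ρ x).fst b‖ < ε ∧ ‖(ρ x).snd b‖ < ε := by
        refine (h1.1.norm.eventually (gt_mem_nhds ?_)).and (h1.2.norm.eventually (gt_mem_nhds ?_))
        · simpa using hε
        · simpa using hε
      rw [eventually_inf_principal, eventually_comap] at h2
      filter_upwards [@Filter.Eventually.eventually_nhds _ τ _ _ h2] with m hm hmR
      obtain ⟨l', hne, hr', hl'⟩ := happ m
      have h3 : ∀ᶠ x in l', ‖(ρ x).fst b‖ < ε ∧ ‖(ρ x).snd b‖ < ε := by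
        filter_upwards [hr', (hτ.1 hl').eventually hm] with x hx hx'
        exact hx' x rfl (hx.trans hmR)
      have h4 := hs m _ l' hr' hl' b
      exact ⟨le_of_tendsto h4.1.norm (h3.mono fun x hx => hx.1.le),
        le_of_tendsto h4.2.norm (h3.mono fun x hx => hx.2.le)⟩
    have h0 : Tendsto (fun m => m - x) l (@nhds _ τ 0) := by
      rw [← hτ, ← sub_self x]
      exact hl.sub (strictTendsto_const x)
    have key' : ∀ (b : B) (ε : ℝ), 0 < ε → ∀ᶠ m in l,
        ‖(σ m).fst b - (σ x).fst b‖ ≤ ε ∧ ‖(σ m).snd b - (σ x).snd b‖ ≤ ε := by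
      intro b ε hε
      filter_upwards [hr, h0.eventually (key b (r + ‖x‖ + 1) ε hε)] with m hm hm'
      have h1 := hm' (by linarith [norm_sub_le m x])
      rwa [map_sub] at h1
    intro b
    constructor
    · rw [Metric.tendsto_nhds]
      intro ε hε
      filter_upwards [key' b (ε / 2) (half_pos hε)] with m hm
      rw [dist_eq_norm]
      exact hm.1.trans_lt (half_lt_self hε)
    · rw [Metric.tendsto_nhds]
      intro ε hε
      filter_upwards [key' b (ε / 2) (half_pos hε)] with m hm
      rw [dist_eq_norm]
      exact hm.2.trans_lt (half_lt_self hε)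

theorem IsStrict.isStrictExtension_strictExtension {ρ : A →ₗ[ℂ] 𝓜(ℂ, B)} (hρ : IsStrict ρ) :
    IsStrictExtension ρ (strictExtension ρ) := by
  have h := hρ.exists_isStrictExtension
  rw [strictExtension, dif_pos h]
  exact h.choose_spec

theorem IsStrict.tendsto_strictExtension {ρ : A →ₗ[ℂ] 𝓜(ℂ, B)} (hρ : IsStrict ρ) {ι : Type*}
    {l : Filter ι} {f : ι → A} {m : 𝓜(ℂ, A)} {r : ℝ} (hr : ∀ᶠ i in l, ‖f i‖ ≤ r)
    (hf : StrictTendsto (fun i => (f i : 𝓜(ℂ, A))) l m) :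
    StrictTendsto (fun i => ρ (f i)) l (strictExtension ρ m) := by
  obtain ⟨h1, h2⟩ := hρ.isStrictExtension_strictExtension
  have h := h2 r (l.map fun i => (f i : 𝓜(ℂ, A))) m
    (eventually_map.2 (hr.mono fun i hi => (norm_coe _).trans_le hi))
    fun c => ⟨tendsto_map'_iff.2 (hf c).1, tendsto_map'_iff.2 (hf c).2⟩
  simp only [← h1]
  exact fun c => ⟨tendsto_map'_iff.1 (h c).1, tendsto_map'_iff.1 (h c).2⟩

end Strict

end Multipliers

/-! ### Strong convergence of bounded nets of operators. -/

section GeneralLimits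

variable {V W : Type*} [NormedAddCommGroup V] [NormedAddCommGroup W]
    [NormedSpace ℂ V] [NormedSpace ℂ W]

theorem isClosed_setOf_tendsto_apply {ι : Type*} {l : Filter ι} {T : ι → V →L[ℂ] W}
    {T₀ : V →L[ℂ] W} {r : ℝ} (hr : ∀ᶠ i in l, ‖T i‖ ≤ r) :
    IsClosed {v | Tendsto (fun i => T i v) l (𝓝 (T₀ v))} := by
  rcases l.eq_or_neBot with rfl | hne
  · simp
  have hr0 : 0 ≤ r := by
    obtain ⟨i, hi⟩ := hr.exists
    exact (norm_nonneg _).trans hi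
  refine isClosed_of_closure_subset fun v hv => ?_
  rw [Set.mem_ofPred_eq, Metric.tendsto_nhds]
  intro ε hε
  have hK : 0 < r + ‖T₀‖ + 1 := by positivity
  obtain ⟨w, hw, hvw⟩ := Metric.mem_closure_iff.1 hv (ε / 2 / (r + ‖T₀‖ + 1)) (by positivity)
  rw [dist_eq_norm, lt_div_iff₀ hK] at hvw
  filter_upwards [hr, Metric.tendsto_nhds.1 hw (ε / 2) (half_pos hε)] with i hi hi'
  rw [dist_eq_norm] at hi' ⊢
  have e : T i v - T₀ v = T i (v - w) + (T i w - T₀ w) - T₀ (v - w) := by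
    rw [map_sub, map_sub]; abel
  have h1 := (T i).le_of_opNorm_le hi (v - w)
  have h2 := T₀.le_opNorm (v - w)
  rw [e]
  have h3 := norm_sub_le (T i (v - w) + (T i w - T₀ w)) (T₀ (v - w))
  have h4 := norm_add_le (T i (v - w)) (T i w - T₀ w)
  nlinarith [norm_nonneg (v - w)]

theorem tendsto_apply_of_dense_span {ι : Type*} {l : Filter ι} {T : ι → V →L[ℂ] W}
    {T₀ : V →L[ℂ] W} {r : ℝ} (hr : ∀ᶠ i in l, ‖T i‖ ≤ r) {s : Set V}
    (hs : Dense (Submodule.span ℂ s : Set V))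
    (h : ∀ v ∈ s, Tendsto (fun i => T i v) l (𝓝 (T₀ v))) (v : V) :
    Tendsto (fun i => T i v) l (𝓝 (T₀ v)) := by
  have h1 : (Submodule.span ℂ s : Set V) ⊆ {v | Tendsto (fun i => T i v) l (𝓝 (T₀ v))} := by
    intro v hv
    induction hv using Submodule.span_induction with
    | mem v hv => exact h v hv
    | zero => simpa using tendsto_const_nhds
    | add v w _ _ hv hw =>
      simp only [Set.mem_ofPred_eq, map_add] at *
      exact hv.add hw
    | smul c v _ hv =>
      simp only [Set.mem_ofPred_eq, map_smul] at *
      exact hv.const_smul c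
  have h2 := closure_minimal h1 (isClosed_setOf_tendsto_apply hr)
  rw [hs.closure_eq] at h2
  exact h2 trivial

end GeneralLimits

/-! ### Adjointable maps: multipliers of `B`, and closedness in operator norm. -/

section Adjoints

variable {B : Type*} [NonUnitalCStarAlgebra B] [PartialOrder B] [StarOrderedRing B]
variable {E F : Type*} [NormedAddCommGroup E] [NormedSpace ℂ E] [SMul Bᵐᵒᵖ E] [HilbertModule B E]
variable [NormedAddCommGroup F] [NormedSpace ℂ F] [SMul Bᵐᵒᵖ F] [HilbertModule B F]

/-- An adjointable map from `B` into itself, as a multiplier. -/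
def IsAdjointPair.toMultiplier {W W' : B → B} (h : IsAdjointPair B W W') : 𝓜(ℂ, B) :=
  DoubleCentralizer.ofCentral W (fun b => star (W' (star b))) fun x y => by
    have h1 := h y (star x)
    rw [rip_self_eq, rip_self_eq, star_star] at h1
    exact h1.symm

@[simp]
theorem IsAdjointPair.toMultiplier_fst {W W' : B → B} (h : IsAdjointPair B W W') (b : B) :
    h.toMultiplier.fst b = W b := rfl

@[simp]
theorem IsAdjointPair.toMultiplier_snd {W W' : B → B} (h : IsAdjointPair B W W') (b : B) :
    h.toMultiplier.snd b = star (W' (star b)) := rfl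

/-- Limits of adjointable maps in operator norm are adjointable. -/
theorem isClosed_adjointableMap [CompleteSpace E] :
    IsClosed (AdjointableMap B E F : Set (E →L[ℂ] F)) := by
  refine isClosed_of_closure_subset fun t ht => ?_
  obtain ⟨T, hT, hTt⟩ := mem_closure_iff_seq_limit.1 ht
  set U : ℕ → AdjointableMap B E F := fun n => ⟨T n, hT n⟩ with hU
  have hcau : CauchySeq fun n => ((AdjointableMap.adj (U n) : F →L[ℂ] E)) := by
    rw [cauchySeq_iff_tendsto_dist_atTop_0]
    refine squeeze_zero (fun _ => dist_nonneg) (fun p => ?_)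
      (cauchySeq_iff_tendsto_dist_atTop_0.1 hTt.cauchySeq)
    rw [dist_eq_norm, dist_eq_norm]
    refine ContinuousLinearMap.opNorm_le_bound _ (norm_nonneg _) fun y => ?_
    have h := AdjointableMap.norm_adj_apply_le (U p.1 - U p.2) y
    rw [AdjointableMap.adj_sub] at h
    exact h
  obtain ⟨S, hS⟩ := cauchySeq_tendsto_of_complete hcau
  refine ⟨S, fun x y => ?_⟩
  have h1 : Tendsto (fun n => rip B (T n x) y) atTop (𝓝 (rip B (t x) y)) :=
    Tendsto.rip (((ContinuousLinearMap.apply ℂ F x).continuous.tendsto t).comp hTt)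
      tendsto_const_nhds
  have h2 : Tendsto (fun n => rip B x (AdjointableMap.adj (U n) y)) atTop (𝓝 (rip B x (S y))) :=
    Tendsto.rip tendsto_const_nhds
      (((ContinuousLinearMap.apply ℂ E y).continuous.tendsto S).comp hS)
  refine tendsto_nhds_unique h1 (h2.congr fun n => ?_)
  exact (AdjointableMap.rip_adj (U n) x y).symm

end Adjoints

/-- Positive contractions are of the form `2 z - z²` with `z` self-adjoint. -/
theorem exists_eq_two_smul_sub_mul_self {A : Type*} [NonUnitalCStarAlgebra A] [PartialOrder A]
    [StarOrderedRing A] {h : A} (h0 : 0 ≤ h) (h1 : ‖h‖ ≤ 1) :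
    ∃ z : A, star z = z ∧ h = (2 : ℝ) • z - z * z := by
  have hsa : IsSelfAdjoint h := .of_nonneg h0
  -- Formally `1 - z` is the square root of `1 - h`. As `t ↦ 1 - √(1 - t)` vanishes at `0`, the
  -- element `z` exists in `A` without a unit.
  have hc : ContinuousOn (fun t : ℝ => 1 - √(1 - t)) (quasispectrum ℝ h) := by fun_prop
  have h00 : (fun t : ℝ => 1 - √(1 - t)) 0 = 0 := by simp
  refine ⟨cfcₙ (fun t : ℝ => 1 - √(1 - t)) h, ?_, ?_⟩
  · exact (cfcₙ_predicate (fun t : ℝ => 1 - √(1 - t)) h : IsSelfAdjoint _).star_eq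
  · rw [← cfcₙ_mul _ _ h hc h00 hc h00, ← cfcₙ_smul (2 : ℝ) _ h hc h00,
      ← cfcₙ_sub _ _ h (by fun_prop) (by simp) (by fun_prop) (by simp)]
    conv_lhs => rw [← cfcₙ_id ℝ h]
    refine cfcₙ_congr fun t ht => ?_
    have h3 : ‖t‖ ≤ ‖h‖ :=
      NonUnitalIsometricContinuousFunctionalCalculus.norm_quasispectrum_le h ht hsa
    have h2 : 0 ≤ 1 - t := by linarith [Real.le_norm_self t]
    have := Real.mul_self_sqrt h2
    simp only [smul_eq_mul, id]
    nlinarith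

namespace CStarWeight

variable {A : Type uA} {B : Type uB} [NonUnitalCStarAlgebra A] [PartialOrder A] [StarOrderedRing A]
variable [NonUnitalCStarAlgebra B] [PartialOrder B] [StarOrderedRing B]

/-- If `x = y* y` lies in the cone, then `x* x = y* (y y*) y ≤ ‖y y*‖ x`. So heredity gives `ℳ_φ ⊆
𝒩_φ`. -/
theorem DenselyDefined.dense_N {φ : CStarWeight A B} (hφ : φ.DenselyDefined) :
    Dense (φ.N : Set A) := by
  refine hφ.mono ?_
  have h : φ.M ≤ φ.N := by
    refine Submodule.span_le.2 fun x hx => ?_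
    have hx0 := φ.nonneg x hx
    obtain ⟨y, hy⟩ := CStarAlgebra.nonneg_iff_eq_star_mul_self.1 hx0
    refine φ.hereditary _ (φ.smul_mem ‖y * star y‖ (norm_nonneg _) _ hx) _
      (star_mul_self_nonneg _) ?_
    have h1 := CStarAlgebra.star_left_conjugate_le_norm_smul (a := y) (b := y * star y)
      (IsSelfAdjoint.mul_star_self y)
    have hx1 : star x = x := (IsSelfAdjoint.of_nonneg hx0).star_eq
    rw [hx1]
    rw [hy]
    simpa only [mul_assoc] using h1
  exact h

end CStarWeight

/-! ### The representation `π` and the operators of a truncating net. -/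

namespace KSGNS

variable {A : Type uA} {B : Type uB} [NonUnitalCStarAlgebra A] [PartialOrder A] [StarOrderedRing A]
variable [NonUnitalCStarAlgebra B] [PartialOrder B] [StarOrderedRing B] {φ : CStarWeight A B}
variable {E : Type uE} [NormedAddCommGroup E] [NormedSpace ℂ E] [CompleteSpace E] [SMul Bᵐᵒᵖ E]
variable [HilbertModule B E] (g : KSGNS φ E)

/-- `T` represents `ρ`, in the sense that `b₂* ρ(a₂* a₁) b₁ = ⟨T Λ(a₁) b₁, Λ(a₂) b₂⟩`. -/
def Represents (T : E → E) (ρ : A →ₗ[ℂ] 𝓜(ℂ, B)) : Prop :=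
  ∀ (a₁ a₂ : φ.N) (b₁ b₂ : B),
    star b₂ * (ρ (star (a₂ : A) * a₁)).fst b₁ = rip B (T ((g.Λ a₁).1 b₁)) ((g.Λ a₂).1 b₂)

theorem clm_ext {W : Type*} [NormedAddCommGroup W] [NormedSpace ℂ W] {T T' : E →L[ℂ] W}
    (h : ∀ (a : φ.N) (b : B), T ((g.Λ a).1 b) = T' ((g.Λ a).1 b)) : T = T' := by
  refine ContinuousLinearMap.ext_on g.dense_span ?_
  rintro v ⟨a, b, rfl⟩
  exact h a b

theorem ext_rip {v w : E} (h : ∀ (a : φ.N) (b : B),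
    rip B v ((g.Λ a).1 b) = rip B w ((g.Λ a).1 b)) : v = w := by
  refine eq_of_rip_left_of_dense B g.dense_span ?_
  rintro v ⟨a, b, rfl⟩
  exact h a b

theorem Λ_apply_congr {a a' : φ.N} (h : (a : A) = a') (b : B) : (g.Λ a).1 b = (g.Λ a').1 b := by
  rw [Subtype.ext h]

/-- Writing `x* x = 2 z - z²` with `z` self-adjoint, `⟨v, v⟩ - ⟨π(x) v, π(x) v⟩` equals the square
of the vector `v - π(z) v`, hence is positive. -/
theorem norm_π_apply_le_of_norm_le_one {x : A} (hx : ‖x‖ ≤ 1) (v : E) : ‖g.π x v‖ ≤ ‖v‖ := by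
  have hx' : ‖star x * x‖ ≤ 1 := by
    rw [CStarRing.norm_star_mul_self]; nlinarith [norm_nonneg x]
  obtain ⟨z, hz, hxz⟩ := exists_eq_two_smul_sub_mul_self (star_mul_self_nonneg x) hx'
  have h1 := rip_self_nonneg (B := B) (v - g.π z v)
  have e1 : rip B v (g.π z v) = rip B (g.π z v) v := by rw [g.rip_π, hz]
  have e2 : rip B (g.π z v) (g.π z v) = rip B (g.π (z * z) v) v := by
    rw [map_mul, ContinuousLinearMap.mul_def, ContinuousLinearMap.comp_apply, g.rip_π z (g.π z v),
      hz]
  have e3 : rip B (g.π x v) (g.π x v) = (2 : ℝ) • rip B (g.π z v) v - rip B (g.π (z * z) v) v := by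
    have h2 : rip B (g.π (star x * x) v) v = rip B (g.π x v) (g.π x v) := by
      rw [map_mul, ContinuousLinearMap.mul_def, ContinuousLinearMap.comp_apply, g.rip_π, star_star]
    rw [← h2, hxz, map_sub, ← Complex.coe_smul, map_smul, _root_.sub_apply,
      _root_.smul_apply, rip_sub_left, rip_real_smul_left]
  rw [rip_sub_left, rip_sub_right, rip_sub_right, e1, e2] at h1
  have h2 : rip B (g.π x v) (g.π x v) ≤ rip B v v := by
    rw [← sub_nonneg, e3]
    refine h1.trans_eq ?_
    rw [two_smul]; abel
  have h3 := CStarAlgebra.norm_le_norm_of_nonneg_of_le (rip_self_nonneg _) h2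
  rw [← norm_sq_eq_norm_rip, ← norm_sq_eq_norm_rip] at h3
  exact abs_le_of_sq_le_sq' h3 (norm_nonneg _) |>.2

theorem norm_π_le (x : A) : ‖g.π x‖ ≤ ‖x‖ := by
  refine ContinuousLinearMap.opNorm_le_bound _ (norm_nonneg _) fun v => ?_
  rcases eq_or_ne x 0 with rfl | hx
  · simp
  have hx' : 0 < ‖x‖ := norm_pos_iff.2 hx
  have h := g.norm_π_apply_le_of_norm_le_one (x := ((‖x‖⁻¹ : ℝ) : ℂ) • x)
    (by rw [norm_smul, Complex.norm_real, norm_inv, norm_norm, inv_mul_cancel₀ hx'.ne']) v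
  rw [map_smul, _root_.smul_apply, norm_smul, Complex.norm_real, norm_inv,
    norm_norm, inv_mul_le_iff₀ hx'] at h
  exact h

theorem π_mul_apply (x y : A) (v : E) : g.π (x * y) v = g.π x (g.π y v) := by
  rw [map_mul]; rfl

/-- An operator `R` with `⟨R Λ(a) b, R Λ(a) b⟩` controlled by a bounded map is bounded in `a`. -/
theorem exists_norm_apply_Λ_le {R : E → E} {ρ : A →ₗ[ℂ] 𝓜(ℂ, B)} (hρ : IsStrict ρ)
    (h : ∀ (a : φ.N) (b : B), ‖R ((g.Λ a).1 b)‖ ^ 2 ≤ ‖star b * (ρ (star (a : A) * a)).fst b‖) :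
    ∃ C, 0 ≤ C ∧ ∀ (a : φ.N) (b : B), ‖R ((g.Λ a).1 b)‖ ≤ C * ‖(a : A)‖ * ‖b‖ := by
  obtain ⟨C, hC0, hC⟩ := hρ.exists_norm_le
  refine ⟨√C, Real.sqrt_nonneg _, fun a b => ?_⟩
  refine abs_le_of_sq_le_sq' ((h a b).trans ?_) (by positivity) |>.2
  have h1 := DoubleCentralizer.norm_fst_apply_le (ρ (star (a : A) * a)) b
  have h2 := hC (star (a : A) * a)
  rw [CStarRing.norm_star_mul_self] at h2
  calc ‖star b * (ρ (star (a : A) * a)).fst b‖ ≤ ‖star b‖ * ‖(ρ (star (a : A) * a)).fst b‖ :=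
        norm_mul_le _ _
    _ ≤ ‖b‖ * (C * (‖(a : A)‖ * ‖(a : A)‖) * ‖b‖) := by
        rw [norm_star]; gcongr; exact h1.trans (by gcongr)
    _ = (√C * ‖(a : A)‖ * ‖b‖) ^ 2 := by
        rw [mul_pow, mul_pow, Real.sq_sqrt hC0]; ring

/-- The data attached to a member of a truncating net. -/
structure Truncation (u : 𝓜(ℂ, A)) (S : AdjointableMap B E E) (ρ : A →ₗ[ℂ] 𝓜(ℂ, B)) : Prop where
  norm_u : ‖u‖ ≤ 1
  norm_S : ‖S‖ ≤ 1
  mem : ∀ a ∈ φ.N, u.snd a ∈ φ.N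
  S_Λ : ∀ (a : φ.N) (b : B), S.1 ((g.Λ a).1 b) = (g.Λ ⟨u.snd a, mem a a.2⟩).1 b
  strict : IsStrict ρ
  cp : IsCP ρ
  rep : ∀ (a₁ a₂ : φ.N) (b₁ b₂ : B), star b₂ * (ρ (star (a₂ : A) * a₁)).fst b₁
    = rip B (S.1 ((g.Λ a₁).1 b₁)) (S.1 ((g.Λ a₂).1 b₂))

/-- A truncating net together with the data attached to its members. -/
structure TruncationNet {I : Type uI} [Preorder I] (u : I → 𝓜(ℂ, A)) (S : I → AdjointableMap B E E)
    (ρ : I → A →ₗ[ℂ] 𝓜(ℂ, B)) : Prop where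
  trunc : ∀ i, g.Truncation (u i) (S i) (ρ i)
  u_tendsto : StrictTendsto u atTop 1
  S_tendsto : ∀ v : E, Tendsto (fun i => (S i).1 v) atTop (𝓝 v)

variable {g}

theorem IsTruncatingNet.exists_truncationNet {I : Type uI} [Preorder I] {u : I → 𝓜(ℂ, A)}
    (hu : g.IsTruncatingNet u) : ∃ S ρ, g.TruncationNet u S ρ := by
  obtain ⟨S, h, h1, h2⟩ := hu
  choose hu hS hΛ ρ hρ using h
  refine ⟨S, ρ, fun i => ?_, h1, h2⟩
  obtain ⟨hm, hΛ⟩ := hΛ i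
  exact ⟨hu i, hS i, hm, hΛ, (hρ i).1, (hρ i).2.1, (hρ i).2.2⟩

namespace Truncation

variable {u : 𝓜(ℂ, A)} {S : AdjointableMap B E E} {ρ : A →ₗ[ℂ] 𝓜(ℂ, B)}

theorem exists_norm_S_Λ_le (h : g.Truncation u S ρ) :
    ∃ C, 0 ≤ C ∧ ∀ (a : φ.N) (b : B), ‖S.1 ((g.Λ a).1 b)‖ ≤ C * ‖(a : A)‖ * ‖b‖ :=
  g.exists_norm_apply_Λ_le h.strict fun a b => by rw [norm_sq_eq_norm_rip B, ← h.rep]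

/-- Left and right multiplication commute: both sides send `Λ(a) b` to `Λ(x a u) b`. -/
theorem π_S (h : g.Truncation u S ρ) (x : A) (v : E) : g.π x (S.1 v) = S.1 (g.π x v) := by
  refine congrArg (fun T : E →L[ℂ] E => T v)
    (g.clm_ext (T := g.π x ∘L S.1) (T' := S.1 ∘L g.π x) fun a b => ?_)
  rw [ContinuousLinearMap.comp_apply, ContinuousLinearMap.comp_apply, h.S_Λ, g.π_Λ, g.π_Λ, h.S_Λ]
  exact g.Λ_apply_congr (DoubleCentralizer.snd_mul_apply _ _ _).symm b

end Truncation

namespace TruncationNet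

variable {I : Type uI} [Preorder I] {u : I → 𝓜(ℂ, A)} {S : I → AdjointableMap B E E}
  {ρ : I → A →ₗ[ℂ] 𝓜(ℂ, B)}

theorem eventually_norm_π : ∀ᶠ e in CStarAlgebra.approximateUnit A, ‖g.π e‖ ≤ 1 :=
  eventually_approximateUnit.mono fun e he => (g.norm_π_le e).trans he.2

/-- Nondegeneracy of `π`. Since `a ↦ Sᵢ Λ(a) b` is norm bounded, `π(e) Sᵢ Λ(a) b = Sᵢ Λ(e a) b`
tends to `Sᵢ Λ(a) b`. These vectors approximate `Λ(a) b` as `i` grows, and the set of vectors where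
the limit holds is closed because `‖π(e)‖ ≤ 1` eventually. -/
theorem tendsto_π [IsDirectedOrder I] [Nonempty I] (h : g.TruncationNet u S ρ) (v : E) :
    Tendsto (fun e => g.π e v) (CStarAlgebra.approximateUnit A) (𝓝 v) := by
  refine tendsto_apply_of_dense_span (T₀ := ContinuousLinearMap.id ℂ E) eventually_norm_π
    g.dense_span ?_ v
  rintro _ ⟨a, b, rfl⟩
  refine (isClosed_setOf_tendsto_apply (T₀ := ContinuousLinearMap.id ℂ E)
    (eventually_norm_π (g := g))).mem_of_tendsto (h.S_tendsto ((g.Λ a).1 b))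
    (Eventually.of_forall fun i => ?_)
  obtain ⟨C, hC0, hC⟩ := (h.trunc i).exists_norm_S_Λ_le
  rw [Set.mem_ofPred_eq, ContinuousLinearMap.id_apply, tendsto_iff_norm_sub_tendsto_zero]
  have h0 : Tendsto (fun e : A => C * ‖e * a - a‖ * ‖b‖) (CStarAlgebra.approximateUnit A)
      (𝓝 0) := by
    simpa using ((tendsto_iff_norm_sub_tendsto_zero.1
      (tendsto_approximateUnit_mul (a : A))).const_mul C).mul_const ‖b‖
  refine squeeze_zero (fun _ => norm_nonneg _) (fun e => ?_) h0
  rw [(h.trunc i).π_S, g.π_Λ, ← map_sub]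
  have e1 : (g.Λ ⟨e * a, φ.mul_mem_N e a.2⟩).1 b - (g.Λ a).1 b
      = (g.Λ (⟨e * a, φ.mul_mem_N e a.2⟩ - a)).1 b := by rw [map_sub]; rfl
  rw [e1]
  exact hC _ b

/-- Elements of `E` are determined by `π(f) Sⱼ v`. -/
theorem ext_π_S [IsDirectedOrder I] [Nonempty I] (h : g.TruncationNet u S ρ) {v w : E}
    (hvw : ∀ f j, g.π f ((S j).1 v) = g.π f ((S j).1 w)) : v = w := by
  have h1 : ∀ j, (S j).1 v = (S j).1 w := fun j =>
    tendsto_nhds_unique (h.tendsto_π _) ((h.tendsto_π ((S j).1 w)).congr fun f => (hvw f j).symm)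
  exact tendsto_nhds_unique (h.S_tendsto v) ((h.S_tendsto w).congr fun j => (h1 j).symm)

/-- For a contraction, `⟨S* v - v, S* v - v⟩ ≤ 2⟨v, v⟩ - ⟨S v, v⟩ - ⟨v, S v⟩`, and the right-hand
side only involves `S`. -/
theorem tendsto_adj_S (h : g.TruncationNet u S ρ) (v : E) :
    Tendsto (fun i => AdjointableMap.adj (S i) v) atTop (𝓝 v) := by
  rw [tendsto_iff_norm_sub_tendsto_zero]
  have h1 : Tendsto (fun i => rip B v v - rip B ((S i).1 v) v + (rip B v v - rip B v ((S i).1 v)))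
      atTop (𝓝 0) := by
    have h2 := ((Tendsto.rip (B := B) (h.S_tendsto v) (tendsto_const_nhds (x := v))).const_sub
      (rip B v v)).add ((Tendsto.rip (B := B) (tendsto_const_nhds (x := v))
        (h.S_tendsto v)).const_sub (rip B v v))
    simpa using h2
  have h3 : Tendsto (fun i => ‖AdjointableMap.adj (S i) v - v‖ ^ 2) atTop (𝓝 0) := by
    refine squeeze_zero (fun _ => by positivity) (fun i => ?_) (tendsto_zero_iff_norm_tendsto_zero.1 h1)
    rw [norm_sq_eq_norm_rip B]
    refine CStarAlgebra.norm_le_norm_of_nonneg_of_le (rip_self_nonneg _) ?_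
    have h4 : rip B (AdjointableMap.adj (S i) v) (AdjointableMap.adj (S i) v) ≤ rip B v v := by
      have hadj : IsAdjointPair B (AdjointableMap.adj (S i)) (S i).1 :=
        AdjointableMap.rip_adj_left (S i)
      have := AdjointableMap.rip_apply_self_le (T := ⟨AdjointableMap.adj (S i), (S i).1, hadj⟩)
        (ContinuousLinearMap.opNorm_le_bound _ zero_le_one fun w =>
          (AdjointableMap.norm_adj_apply_le (S i) w).trans
            (by gcongr; exact (h.trunc i).norm_S)) v
      exact this
    rw [rip_sub_left, rip_sub_right, rip_sub_right, AdjointableMap.rip_adj_left (S i) v v,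
      ← AdjointableMap.rip_adj (S i) v v]
    have e : rip B v v - rip B ((S i).1 v) v + (rip B v v - rip B v ((S i).1 v))
      = rip B v v - rip B v ((S i).1 v) - (rip B ((S i).1 v) v - rip B v v) := by abel
    rw [e]
    gcongr
  have h5 := (Real.continuous_sqrt.tendsto 0).comp h3
  simpa [Function.comp_def, Real.sqrt_sq (norm_nonneg _)] using h5

end TruncationNet

/-! ### Representing operators of the maps in `𝒢_φ` -/

/-- The constant `s < 1` is retained because directedness of `𝒢_φ` requires inverting `1 - T`. -/
theorem G.exists_rep (ρ : g.G) : IsStrict ρ.1 ∧ IsCP ρ.1 ∧ ∃ T : AdjointableMap B E E,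
    (∀ v : E, 0 ≤ rip B (T.1 v) v) ∧ (∃ s : ℝ, 0 ≤ s ∧ s < 1 ∧
      ∀ v : E, rip B (T.1 v) v ≤ s • rip B v v) ∧ g.Represents T.1 ρ.1 := by
  obtain ⟨ρ, t, ht0, ht1, η, ⟨hs, hcp, T, hT0, hT1, hT⟩, rfl⟩ := ρ
  refine ⟨hs.smul _, ?_, (t : ℂ) • T, fun v => ?_, ⟨t, ht0, ht1, fun v => ?_⟩,
    fun a₁ a₂ b₁ b₂ => ?_⟩
  · intro n a b
    have h := smul_nonneg ht0 (hcp n a b)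
    rw [Finset.smul_sum] at h
    refine h.trans_eq (Finset.sum_congr rfl fun i _ => ?_)
    rw [Finset.smul_sum]
    refine Finset.sum_congr rfl fun j _ => ?_
    rw [LinearMap.smul_apply, DoubleCentralizer.smul_fst, _root_.smul_apply,
      mul_smul_comm, Complex.coe_smul]
  · have e : ((t : ℂ) • T).1 v = (t : ℂ) • T.1 v := rfl
    rw [e, rip_real_smul_left]
    exact smul_nonneg ht0 (hT0 v)
  · have e : ((t : ℂ) • T).1 v = (t : ℂ) • T.1 v := rfl
    rw [e, rip_real_smul_left]
    exact smul_le_smul_of_nonneg_left (hT1 v) ht0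
  · have e : ((t : ℂ) • T).1 ((g.Λ a₁).1 b₁) = (t : ℂ) • T.1 ((g.Λ a₁).1 b₁) := rfl
    rw [e, rip_smul_left, ← hT, LinearMap.smul_apply, DoubleCentralizer.smul_fst,
      _root_.smul_apply, mul_smul_comm]

theorem G.strict (ρ : g.G) : IsStrict ρ.1 := (G.exists_rep ρ).1

theorem G.cp (ρ : g.G) : IsCP ρ.1 := (G.exists_rep ρ).2.1

/-- The operator representing a map in `𝒢_φ`. -/
def G.op (ρ : g.G) : AdjointableMap B E E := (G.exists_rep ρ).2.2.choose

theorem G.op_nonneg (ρ : g.G) (v : E) : 0 ≤ rip B ((G.op ρ).1 v) v :=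
  (G.exists_rep ρ).2.2.choose_spec.1 v

theorem G.op_le_smul (ρ : g.G) :
    ∃ s : ℝ, 0 ≤ s ∧ s < 1 ∧ ∀ v, rip B ((G.op ρ).1 v) v ≤ s • rip B v v :=
  (G.exists_rep ρ).2.2.choose_spec.2.1

theorem G.op_le (ρ : g.G) (v : E) : rip B ((G.op ρ).1 v) v ≤ rip B v v := by
  obtain ⟨s, _, hs1, hs⟩ := G.op_le_smul ρ
  refine (hs v).trans ?_
  have := smul_le_smul_of_nonneg_right hs1.le (rip_self_nonneg (B := B) v)
  rwa [one_smul] at this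

theorem G.rep (ρ : g.G) : g.Represents (G.op ρ).1 ρ.1 := (G.exists_rep ρ).2.2.choose_spec.2.2

theorem G.op_selfAdj (ρ : g.G) : IsAdjointPair B (G.op ρ).1 (G.op ρ).1 :=
  isAdjointPair_self_of_nonneg (D := ((G.op ρ).1 : E →ₗ[ℂ] E)) (G.op_nonneg ρ)

theorem G.norm_op_apply_sq_le (ρ : g.G) (v : E) :
    ‖(G.op ρ).1 v‖ ^ 2 ≤ ‖rip B ((G.op ρ).1 v) v‖ := by
  have h := norm_apply_sq_le (D := ((G.op ρ).1 : E →ₗ[ℂ] E)) (G.op_nonneg ρ) one_pos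
    (fun v => (G.op_le ρ v).trans_eq (one_smul _ _).symm) v
  rwa [one_mul] at h

theorem G.norm_op_Λ_sq_le (ρ : g.G) (a : φ.N) (b : B) :
    ‖(G.op ρ).1 ((g.Λ a).1 b)‖ ^ 2 ≤ ‖star b * (ρ.1 (star (a : A) * a)).fst b‖ :=
  (G.norm_op_apply_sq_le ρ _).trans_eq (by rw [G.rep ρ])

theorem G.norm_op_le (ρ : g.G) : ‖(G.op ρ).1‖ ≤ 1 :=
  ContinuousLinearMap.opNorm_le_bound _ zero_le_one fun v =>
    norm_apply_le_of_nonneg (D := ((G.op ρ).1 : E →ₗ[ℂ] E)) (G.op_nonneg ρ) one_pos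
      (fun v => (G.op_le ρ v).trans_eq (one_smul _ _).symm) v

/-- The estimate `D² ≤ D` for `D = 1 - T`. It turns convergence of quadratic forms into norm
convergence of vectors. -/
theorem G.norm_sub_op_apply_sq_le (ρ : g.G) (v : E) :
    ‖v - (G.op ρ).1 v‖ ^ 2 ≤ ‖rip B v v - rip B ((G.op ρ).1 v) v‖ := by
  have h := norm_apply_sq_le (B := B) (D := (LinearMap.id - ((G.op ρ).1 : E →ₗ[ℂ] E)))
    (fun v => ?_) one_pos (fun v => ?_) v
  · rw [← rip_sub_left]
    rwa [one_mul] at h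
  · have := sub_nonneg.2 (G.op_le ρ v)
    rwa [← rip_sub_left] at this
  · rw [one_smul]
    have := sub_le_self (rip B v v) (G.op_nonneg ρ v)
    rwa [← rip_sub_left] at this

/-- The operators representing the maps in `𝒢_φ` converge strongly to `1`. -/
theorem LowerSemicontinuous.tendsto_op (hlsc : g.LowerSemicontinuous) (v : E) :
    Tendsto (fun ρ : g.G => (G.op ρ).1 v) atTop (𝓝 v) := by
  refine tendsto_apply_of_dense_span (T := fun ρ : g.G => (G.op ρ).1)
    (T₀ := ContinuousLinearMap.id ℂ E) (Eventually.of_forall G.norm_op_le) g.dense_span ?_ v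
  rintro _ ⟨a, b, rfl⟩
  rw [ContinuousLinearMap.id_apply, tendsto_iff_norm_sub_tendsto_zero]
  -- Lower semi-continuity at `a* a` is exactly convergence of the quadratic forms of the
  -- representing operators at `Λ(a) b`.
  have h1 : Tendsto (fun ρ : g.G => ‖star b * (φ.sesq a a).fst b
      - star b * (ρ.1 (star (a : A) * a)).fst b‖) atTop (𝓝 0) := by
    have h2 := ((hlsc.2 (star (a : A) * a) a.2 b).1.const_mul (star b)).const_sub
      (star b * (φ.sesq a a).fst b)
    rw [CStarWeight.sesq, sub_self] at h2
    exact tendsto_zero_iff_norm_tendsto_zero.1 h2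
  have h3 : Tendsto (fun ρ : g.G => ‖(G.op ρ).1 ((g.Λ a).1 b) - (g.Λ a).1 b‖ ^ 2) atTop (𝓝 0) := by
    refine squeeze_zero (fun _ => by positivity) (fun ρ => ?_) h1
    rw [norm_sub_rev]
    refine (G.norm_sub_op_apply_sq_le ρ _).trans_eq ?_
    rw [G.rep ρ, ← g.rip_Λ]
  have h5 := (Real.continuous_sqrt.tendsto 0).comp h3
  simpa [Function.comp_def, Real.sqrt_sq (norm_nonneg _)] using h5

/-- For `a ∈ 𝒩_φ`-limits, the values `ρ(a* a)` are given by the limit of the `Λ`s. -/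
theorem fst_eq_of_tendsto (ρ : g.G) {x : ℕ → φ.N} {a : A}
    (hx : Tendsto (fun n => (x n : A)) atTop (𝓝 a)) {t : AdjointableMap B B E}
    (ht : Tendsto (fun n => (g.Λ (x n)).1) atTop (𝓝 t.1)) (b : B) :
    (ρ.1 (star a * a)).fst b = AdjointableMap.adj t ((G.op ρ).1 (t.1 b)) := by
  have happ : ∀ b, Tendsto (fun n => (g.Λ (x n)).1 b) atTop (𝓝 (t.1 b)) := fun b =>
    ((ContinuousLinearMap.apply ℂ E b).continuous.tendsto t.1).comp ht
  refine eq_of_forall_mul_left_eq fun z => ?_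
  have h1 : Tendsto (fun n => z * (ρ.1 (star (x n : A) * x n)).fst b) atTop
      (𝓝 (z * (ρ.1 (star a * a)).fst b)) := by
    refine ((StrictTendsto.of_tendsto ?_) b).1.const_mul z
    exact ((G.strict ρ).continuous.tendsto _).comp (hx.star.mul hx)
  refine tendsto_nhds_unique h1 ?_
  have h2 : Tendsto (fun n => rip B ((G.op ρ).1 ((g.Λ (x n)).1 b)) ((g.Λ (x n)).1 (star z))) atTop
      (𝓝 (rip B ((G.op ρ).1 (t.1 b)) (t.1 (star z)))) :=
    Tendsto.rip (((G.op ρ).1.continuous.tendsto _).comp (happ b)) (happ (star z))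
  rw [← AdjointableMap.rip_adj_left t, rip_self_eq, star_star] at h2
  refine h2.congr fun n => ?_
  rw [← G.rep ρ, star_star]

/-- For `ρ ∈ 𝒢_φ` with operator `T` one has `ρ(a* a) = t* T t`. As the operators tend strongly to
`1`, these multipliers converge strictly to `t* t`, and lower semi-continuity puts `a* a` into the
cone. -/
theorem LowerSemicontinuous.mem_N_of_tendsto (hlsc : g.LowerSemicontinuous) {x : ℕ → φ.N} {a : A}
    (hx : Tendsto (fun n => (x n : A)) atTop (𝓝 a)) {t : AdjointableMap B B E}
    (ht : Tendsto (fun n => (g.Λ (x n)).1) atTop (𝓝 t.1)) : a ∈ φ.N := by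
  have hadj : ∀ T : E →L[ℂ] E, IsAdjointPair B T T →
      IsAdjointPair B (fun b => AdjointableMap.adj t (T (t.1 b)))
        (fun b => AdjointableMap.adj t (T (t.1 b))) := fun T hT b b' => by
    rw [AdjointableMap.rip_adj_left, hT, AdjointableMap.rip_adj]
  have hρ : ∀ ρ : g.G, ρ.1 (star a * a) = (hadj (G.op ρ).1 (G.op_selfAdj ρ)).toMultiplier :=
    fun ρ => DoubleCentralizer.ext_fst fun b => fst_eq_of_tendsto ρ hx ht b
  have h1 : IsAdjointPair B (ContinuousLinearMap.id ℂ E) (ContinuousLinearMap.id ℂ E) :=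
    fun _ _ => rfl
  have h : star a * a ∈ φ.carrier := by
    rw [hlsc.1]
    refine ⟨star_mul_self_nonneg a, (hadj _ h1).toMultiplier, fun b => ?_⟩
    simp only [hρ, IsAdjointPair.toMultiplier_fst, IsAdjointPair.toMultiplier_snd]
    have h2 : ∀ b, Tendsto (fun ρ : g.G => AdjointableMap.adj t ((G.op ρ).1 (t.1 b))) atTop
        (𝓝 (AdjointableMap.adj t (t.1 b))) := fun b =>
      ((AdjointableMap.adj t).continuous.tendsto _).comp (hlsc.tendsto_op _)
    exact ⟨h2 b, (h2 (star b)).star⟩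
  exact h

/-! ### Truncations of arbitrary elements of `A`. -/

section Truncated

variable {I : Type uI} [Preorder I] [IsDirectedOrder I] [Nonempty I] {u : I → 𝓜(ℂ, A)}
  {S : I → AdjointableMap B E E} {ρ : I → A →ₗ[ℂ] 𝓜(ℂ, B)}

/-- `Λ` is closed for the norm topologies. -/
theorem TruncationNet.exists_Λ_eq_of_tendsto (h : g.TruncationNet u S ρ)
    (hlsc : g.LowerSemicontinuous) {x : ℕ → φ.N} {a : A}
    (hx : Tendsto (fun n => (x n : A)) atTop (𝓝 a)) {t : AdjointableMap B B E}
    (ht : Tendsto (fun n => (g.Λ (x n)).1) atTop (𝓝 t.1)) : ∃ ha : a ∈ φ.N, g.Λ ⟨a, ha⟩ = t := by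
  have ha := hlsc.mem_N_of_tendsto hx ht
  refine ⟨ha, Subtype.ext (ContinuousLinearMap.ext fun b => ?_)⟩
  -- After applying `Sᵢ` the map `Λ` becomes norm bounded, so `Sᵢ Λ(xₙ) b` also tends to `Sᵢ Λ(a)
  -- b`. Letting `i` grow removes `Sᵢ`.
  have h1 : ∀ i, (S i).1 ((g.Λ ⟨a, ha⟩).1 b) = (S i).1 (t.1 b) := fun i => by
    obtain ⟨C, hC0, hC⟩ := (h.trunc i).exists_norm_S_Λ_le
    have happ : Tendsto (fun n => (S i).1 ((g.Λ (x n)).1 b)) atTop (𝓝 ((S i).1 (t.1 b))) :=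
      ((S i).1.continuous.tendsto _).comp
        (((ContinuousLinearMap.apply ℂ E b).continuous.tendsto t.1).comp ht)
    refine tendsto_nhds_unique ?_ happ
    rw [tendsto_iff_norm_sub_tendsto_zero]
    have h0 : Tendsto (fun n => C * ‖(x n : A) - a‖ * ‖b‖) atTop (𝓝 0) := by
      simpa using ((tendsto_iff_norm_sub_tendsto_zero.1 hx).const_mul C).mul_const ‖b‖
    refine squeeze_zero (fun _ => norm_nonneg _) (fun n => ?_) h0
    have e : (g.Λ (x n)).1 b - (g.Λ ⟨a, ha⟩).1 b = (g.Λ (x n - ⟨a, ha⟩)).1 b := by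
      rw [map_sub]; rfl
    rw [← map_sub, e]
    exact hC _ b
  exact tendsto_nhds_unique (h.S_tendsto _) ((h.S_tendsto _).congr fun i => (h1 i).symm)

/-- For `xₙ ∈ 𝒩_φ` tending to `a`, boundedness of `x ↦ Λ(x uᵢ)` on `𝒩_φ` makes `Λ(xₙ uᵢ)` Cauchy in
norm. Closedness of `Λ` then yields `a uᵢ ∈ 𝒩_φ` and identifies the limit. -/
theorem TruncationNet.exists_seq_tendsto (h : g.TruncationNet u S ρ) (hφ : φ.DenselyDefined)
    (hlsc : g.LowerSemicontinuous) (i : I) (a : A) :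
    ∃ (x : ℕ → φ.N) (ha : (u i).snd a ∈ φ.N), Tendsto (fun n => (x n : A)) atTop (𝓝 a) ∧
      Tendsto (fun n => (g.Λ ⟨(u i).snd (x n), (h.trunc i).mem _ (x n).2⟩).1) atTop
        (𝓝 (g.Λ ⟨(u i).snd a, ha⟩).1) := by
  obtain ⟨x, hxN, hx⟩ := mem_closure_iff_seq_limit.1 (hφ.dense_N a)
  obtain ⟨C, hC0, hC⟩ := (h.trunc i).exists_norm_S_Λ_le
  set y : ℕ → φ.N := fun n => ⟨(u i).snd (x n), (h.trunc i).mem _ (hxN n)⟩ with hy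
  have hcau : CauchySeq fun n => (g.Λ (y n)).1 := by
    rw [cauchySeq_iff_tendsto_dist_atTop_0]
    have h0 := (cauchySeq_iff_tendsto_dist_atTop_0.1 hx.cauchySeq).const_mul C
    rw [mul_zero] at h0
    refine squeeze_zero (fun _ => dist_nonneg) (fun p => ?_) h0
    rw [dist_eq_norm, dist_eq_norm]
    refine ContinuousLinearMap.opNorm_le_bound _ (by positivity) fun b => ?_
    have h1 := hC (⟨x p.1, hxN p.1⟩ - ⟨x p.2, hxN p.2⟩) b
    rw [map_sub g.Λ] at h1
    have e : (S i).1 ((g.Λ ⟨x p.1, hxN p.1⟩ - g.Λ ⟨x p.2, hxN p.2⟩).1 b)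
        = (S i).1 ((g.Λ ⟨x p.1, hxN p.1⟩).1 b) - (S i).1 ((g.Λ ⟨x p.2, hxN p.2⟩).1 b) := by
      rw [← map_sub (S i).1]; rfl
    rw [e, (h.trunc i).S_Λ, (h.trunc i).S_Λ] at h1
    exact h1
  obtain ⟨t, ht⟩ := cauchySeq_tendsto_of_complete hcau
  have htm : t ∈ AdjointableMap B B E :=
    isClosed_adjointableMap.mem_of_tendsto ht (Eventually.of_forall fun n => (g.Λ (y n)).2)
  obtain ⟨ha, hat⟩ := h.exists_Λ_eq_of_tendsto hlsc (x := y) (t := ⟨t, htm⟩)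
    (((u i).snd.continuous.tendsto a).comp hx) ht
  refine ⟨fun n => ⟨x n, hxN n⟩, ha, hx, ?_⟩
  rw [hat]
  exact ht

theorem TruncationNet.snd_mem_N (h : g.TruncationNet u S ρ) (hφ : φ.DenselyDefined)
    (hlsc : g.LowerSemicontinuous) (i : I) (a : A) : (u i).snd a ∈ φ.N := by
  obtain ⟨_, ha, _⟩ := h.exists_seq_tendsto hφ hlsc i a
  exact ha

theorem TruncationNet.exists_norm_Λ_snd_le (h : g.TruncationNet u S ρ) (hφ : φ.DenselyDefined)
    (hlsc : g.LowerSemicontinuous) (i : I) :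
    ∃ C, 0 ≤ C ∧ ∀ a, ‖g.Λ ⟨(u i).snd a, h.snd_mem_N hφ hlsc i a⟩‖ ≤ C * ‖a‖ := by
  obtain ⟨C, hC0, hC⟩ := (h.trunc i).exists_norm_S_Λ_le
  refine ⟨C, hC0, fun a => ?_⟩
  obtain ⟨x, ha, hx, hΛ⟩ := h.exists_seq_tendsto hφ hlsc i a
  refine le_of_tendsto_of_tendsto hΛ.norm (hx.norm.const_mul C) (Eventually.of_forall fun n => ?_)
  refine ContinuousLinearMap.opNorm_le_bound _ (by positivity) fun b => ?_
  have h1 := hC (x n) b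
  rwa [(h.trunc i).S_Λ] at h1

theorem TruncationNet.rip_Λ_snd (h : g.TruncationNet u S ρ) (hφ : φ.DenselyDefined)
    (hlsc : g.LowerSemicontinuous) (i : I) (a : A) (b : B) :
    rip B ((g.Λ ⟨(u i).snd a, h.snd_mem_N hφ hlsc i a⟩).1 b)
      ((g.Λ ⟨(u i).snd a, h.snd_mem_N hφ hlsc i a⟩).1 b)
      = star b * ((ρ i) (star a * a)).fst b := by
  obtain ⟨x, ha, hx, hΛ⟩ := h.exists_seq_tendsto hφ hlsc i a
  have happ := ((ContinuousLinearMap.apply ℂ E b).continuous.tendsto _).comp hΛ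
  have h1 : Tendsto (fun n => star b * ((ρ i) (star (x n : A) * x n)).fst b) atTop
      (𝓝 (star b * ((ρ i) (star a * a)).fst b)) := by
    refine ((StrictTendsto.of_tendsto ?_) b).1.const_mul _
    exact ((h.trunc i).strict.continuous.tendsto _).comp (hx.star.mul hx)
  refine tendsto_nhds_unique (Tendsto.rip happ happ) (h1.congr fun n => ?_)
  rw [(h.trunc i).rep, (h.trunc i).S_Λ]
  rfl

end Truncated

end KSGNS

/-! ### Operator inequalities behind the directedness of `𝒢_φ`. -/

section OperatorBounds

variable {B : Type*} [NonUnitalCStarAlgebra B] [PartialOrder B] [StarOrderedRing B]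
variable {E : Type*} [NormedAddCommGroup E] [NormedSpace ℂ E] [SMul Bᵐᵒᵖ E] [HilbertModule B E]

theorem IsAdjointPair.sub {T T' S S' : E →L[ℂ] E} (h : IsAdjointPair B T S)
    (h' : IsAdjointPair B T' S') : IsAdjointPair B ⇑(T - T') ⇑(S - S') := fun x y => by
  rw [_root_.sub_apply, _root_.sub_apply, rip_sub_left, rip_sub_right, h, h']

theorem IsAdjointPair.add {T T' S S' : E →L[ℂ] E} (h : IsAdjointPair B T S)
    (h' : IsAdjointPair B T' S') : IsAdjointPair B ⇑(T + T') ⇑(S + S') := fun x y => by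
  rw [_root_.add_apply, _root_.add_apply, rip_add_left, rip_add_right, h, h']

theorem IsAdjointPair.mul {T T' S S' : E →L[ℂ] E} (h : IsAdjointPair B T S)
    (h' : IsAdjointPair B T' S') : IsAdjointPair B ⇑(T * T') ⇑(S' * S) := fun x y => by
  rw [mul_apply_eq_comp, mul_apply_eq_comp, h, h']

variable (B) in
theorem isAdjointPair_one : IsAdjointPair B ⇑(1 : E →L[ℂ] E) ⇑(1 : E →L[ℂ] E) := fun _ _ => rfl

theorem IsAdjointPair.inv {P V : E →L[ℂ] E} (h : IsAdjointPair B P P) (h1 : P * V = 1) :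
    IsAdjointPair B V V := fun x y => by
  have e : ∀ z, P (V z) = z := fun z => congrArg (fun T : E →L[ℂ] E => T z) h1
  conv_lhs => rw [← e y]
  conv_rhs => rw [← e x]
  rw [h]

/-- Inversion reverses the order of positive operators. -/
theorem rip_inv_le {P P' V V' : E →L[ℂ] E} (hP : ∀ v, 0 ≤ rip B (P v) v)
    (hPP' : ∀ v, rip B (P v) v ≤ rip B (P' v) v) (h1 : P * V = 1) (h1' : P' * V' = 1) (v : E) :
    rip B (V' v) v ≤ rip B (V v) v := by
  have hsa : IsAdjointPair B P P := isAdjointPair_self_of_nonneg (D := (P : E →ₗ[ℂ] E)) hP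
  have hV := hsa.inv h1
  have e : P (V v) = v := congrArg (fun T : E →L[ℂ] E => T v) h1
  have e' : P' (V' v) = v := congrArg (fun T : E →L[ℂ] E => T v) h1'
  -- Expanding the form of `P` at `V v - V' v` and bounding `⟨P V' v, V' v⟩` by `⟨P' V' v, V' v⟩ =
  -- ⟨v, V' v⟩` leaves the difference of the two inverses.
  have h2 := hP (V v - V' v)
  have h3 := hPP' (V' v)
  rw [map_sub, e, rip_sub_right, rip_sub_left, rip_sub_left, hsa (V' v) (V v), e] at h2
  rw [e'] at h3
  rw [hV v v, ← sub_nonneg]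
  have e4 : rip B v (V v) - rip B (V' v) v - (rip B v (V' v) - rip B (P (V' v)) (V' v))
    = rip B v (V v) - rip B (V' v) v - (rip B v (V' v) - rip B (P (V' v)) (V' v)) := rfl
  exact h2.trans (sub_le_self _ (sub_nonneg.2 h3))

/-- Since `1 ≤ H ≤ c`, the operator `1 - c⁻¹ H` is positive and bounded by `1 - c⁻¹ < 1`, so `c⁻¹ H`
is invertible by a Neumann series. -/
theorem exists_inverse_of_bounded [CompleteSpace E] {H : E →L[ℂ] E} {c : ℝ} (hc : 1 < c)
    (h1 : ∀ v, rip B v v ≤ rip B (H v) v) (h2 : ∀ v, rip B (H v) v ≤ c • rip B v v) :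
    ∃ Q : E →L[ℂ] E, H * Q = 1 ∧ Q * H = 1 ∧ ∀ P, Commute P H → Commute P Q := by
  have hc0 : 0 < c := by linarith
  set s : ℝ := 1 - c⁻¹ with hs
  have hs0 : 0 < s := sub_pos.2 (inv_lt_one_of_one_lt₀ hc)
  have hs1 : s < 1 := sub_lt_self _ (inv_pos.2 hc0)
  set N : E →L[ℂ] E := 1 - ((c⁻¹ : ℝ) : ℂ) • H with hN
  have hNv : ∀ v, rip B (N v) v = rip B v v - c⁻¹ • rip B (H v) v := fun v => by
    rw [hN, _root_.sub_apply, _root_.smul_apply, rip_sub_left, rip_real_smul_left]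
    rfl
  have hnorm : ‖N‖ < 1 := by
    refine (ContinuousLinearMap.opNorm_le_bound _ hs0.le fun v =>
      norm_apply_le_of_nonneg (B := B) (D := (N : E →ₗ[ℂ] E)) (fun v => ?_) hs0 (fun v => ?_)
        v).trans_lt hs1
    · rw [ContinuousLinearMap.coe_coe, hNv, sub_nonneg]
      have := smul_le_smul_of_nonneg_left (h2 v) (inv_pos.2 hc0).le
      rwa [inv_smul_smul₀ hc0.ne'] at this
    · rw [ContinuousLinearMap.coe_coe, hNv, hs, sub_smul, one_smul]
      exact sub_le_sub_left (smul_le_smul_of_nonneg_left (h1 v) (inv_pos.2 hc0).le) _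
  set U := Units.oneSub N hnorm with hU
  have hUval : (U : E →L[ℂ] E) = ((c⁻¹ : ℝ) : ℂ) • H := by
    rw [hU, Units.val_oneSub, hN, sub_sub_cancel]
  refine ⟨((c⁻¹ : ℝ) : ℂ) • (↑U⁻¹ : E →L[ℂ] E), ?_, ?_, fun P hP => ?_⟩
  · rw [mul_smul_comm, ← smul_mul_assoc, ← hUval, Units.mul_inv]
  · rw [smul_mul_assoc, ← mul_smul_comm, ← hUval, Units.inv_mul]
  · refine Commute.smul_right (Commute.units_inv_right ?_) _
    rw [hUval]
    exact hP.smul_right _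

/-- Two positive strict contractions have a common upper bound of a special form. -/
theorem exists_upper_bound [CompleteSpace E] {X₁ X₂ : E →L[ℂ] E} {s : ℝ} (hs0 : 0 < s) (hs1 : s < 1)
    (h₁ : ∀ v, 0 ≤ rip B (X₁ v) v) (h₂ : ∀ v, 0 ≤ rip B (X₂ v) v)
    (h₁' : ∀ v, rip B (X₁ v) v ≤ s • rip B v v) (h₂' : ∀ v, rip B (X₂ v) v ≤ s • rip B v v) :
    ∃ (X Z₁₁ Z₁₂ Z₂₁ Z₂₂ : E →L[ℂ] E) (r : ℝ), 0 < r ∧ r < 1 ∧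
      X = X₁ + X₂ + X₁ * Z₁₁ * X₁ + X₁ * Z₁₂ * X₂ + X₂ * Z₂₁ * X₁ + X₂ * Z₂₂ * X₂ ∧
      (∀ Z ∈ ({Z₁₁, Z₁₂, Z₂₁, Z₂₂} : Set (E →L[ℂ] E)), Z ∈ AdjointableMap B E E ∧
        ∀ P, Commute P X₁ → Commute P X₂ → Commute P Z) ∧
      (∀ v, rip B (X₁ v) v ≤ rip B (X v) v) ∧ (∀ v, rip B (X₂ v) v ≤ rip B (X v) v) ∧
      ∀ v, rip B (X v) v ≤ r • rip B v v := by
  have hone : ∀ v : E, rip B ((1 : E →L[ℂ] E) v) v = rip B v v := fun _ => rfl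
  have key : ∀ X : E →L[ℂ] E, (∀ v, 0 ≤ rip B (X v) v) → (∀ v, rip B (X v) v ≤ s • rip B v v) →
      ∃ Y : E →L[ℂ] E, (1 - X) * Y = 1 ∧ Y * (1 - X) = 1 ∧ IsAdjointPair B Y Y ∧
        (∀ v, rip B v v ≤ rip B (Y v) v) ∧ ∀ P, Commute P X → Commute P Y := by
    intro X hX hX'
    have hnorm : ‖X‖ < 1 := (ContinuousLinearMap.opNorm_le_bound _ hs0.le
      (norm_apply_le_of_nonneg (B := B) (D := (X : E →ₗ[ℂ] E)) hX hs0 hX')).trans_lt hs1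
    set U := Units.oneSub X hnorm with hU
    have hUval : (U : E →L[ℂ] E) = 1 - X := Units.val_oneSub _ _
    have hl : (1 - X) * (↑U⁻¹ : E →L[ℂ] E) = 1 := by rw [← hUval, Units.mul_inv]
    have hsa : IsAdjointPair B X X := isAdjointPair_self_of_nonneg (D := (X : E →ₗ[ℂ] E)) hX
    have hpos : ∀ v, rip B ((1 - X) v) v = rip B v v - rip B (X v) v := fun v => by
      rw [_root_.sub_apply, rip_sub_left, hone]
    refine ⟨↑U⁻¹, hl, ?_, ((isAdjointPair_one B).sub hsa).inv hl, fun v => ?_, fun P hP => ?_⟩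
    · rw [← hUval, Units.inv_mul]
    · refine rip_inv_le (P := 1 - X) (P' := 1) (V' := 1) (fun v => ?_) (fun v => ?_) hl
        (mul_one _) v
      · rw [hpos, sub_nonneg]
        refine (hX' v).trans ?_
        have := smul_le_smul_of_nonneg_right hs1.le (rip_self_nonneg (B := B) v)
        rwa [one_smul] at this
      · rw [hpos, hone]
        exact sub_le_self _ (hX v)
    · refine Commute.units_inv_right ?_
      rw [hUval]
      exact (Commute.one_right P).sub_right hP
  obtain ⟨Y₁, hl₁, hr₁, hsa₁, hge₁, hc₁⟩ := key X₁ h₁ h₁'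
  obtain ⟨Y₂, hl₂, hr₂, hsa₂, hge₂, hc₂⟩ := key X₂ h₂ h₂'
  -- The order preserving map `X ↦ (1 - X)⁻¹ - 1` sends strict positive contractions to positive
  -- operators, which can be added. The upper bound is `1 - H⁻¹`, where `H - 1 = (Y₁ - 1) + (Y₂ -
  -- 1)`.
  set H := Y₁ + Y₂ - 1 with hH
  have hHv : ∀ v, rip B (H v) v = rip B (Y₁ v) v + rip B (Y₂ v) v - rip B v v := fun v => by
    rw [hH, _root_.sub_apply, _root_.add_apply, rip_sub_left, rip_add_left, hone]
  have hHsa : IsAdjointPair B H H := (hsa₁.add hsa₂).sub (isAdjointPair_one B)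
  have hY₁H : ∀ v, rip B (Y₁ v) v ≤ rip B (H v) v := fun v => by
    rw [hHv, add_sub_assoc]; exact le_add_of_nonneg_right (sub_nonneg.2 (hge₂ v))
  have hY₂H : ∀ v, rip B (Y₂ v) v ≤ rip B (H v) v := fun v => by
    rw [hHv, add_sub_right_comm]; exact le_add_of_nonneg_left (sub_nonneg.2 (hge₁ v))
  set c : ℝ := ‖H‖ + 2 with hc
  have hc1 : 1 < c := by linarith [norm_nonneg H]
  have hc0 : 0 < c := by linarith
  have hHc : ∀ v, rip B (H v) v ≤ c • rip B v v :=
    rip_apply_le_of_norm_le (D := (H : E →ₗ[ℂ] E)) hHsa hc0 fun v =>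
      (H.le_opNorm v).trans (by gcongr; linarith)
  have hge : ∀ v, rip B v v ≤ rip B (H v) v := fun v => (hge₁ v).trans (hY₁H v)
  obtain ⟨Q, hHQ, hQH, hcQ⟩ := exists_inverse_of_bounded hc1 hge hHc
  have hQsa : IsAdjointPair B Q Q := hHsa.inv hHQ
  have hX : ∀ v, rip B ((1 - Q) v) v = rip B v v - rip B (Q v) v := fun v => by
    rw [_root_.sub_apply, rip_sub_left, hone]
  have hQ₁ : ∀ v, rip B (Q v) v ≤ rip B ((1 - X₁) v) v :=
    rip_inv_le (fun v => (rip_self_nonneg v).trans (hge₁ v)) hY₁H hr₁ hHQ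
  have hQ₂ : ∀ v, rip B (Q v) v ≤ rip B ((1 - X₂) v) v :=
    rip_inv_le (fun v => (rip_self_nonneg v).trans (hge₂ v)) hY₂H hr₂ hHQ
  have hcQ' : ∀ P, Commute P X₁ → Commute P X₂ → Commute P Q := fun P h h' =>
    hcQ P ((hc₁ P h).add_right (hc₂ P h') |>.sub_right (Commute.one_right P))
  -- The coefficients come from `1 - Q = (H - 1) - (H - 1) Q (H - 1)` and `Yᵢ - 1 = Xᵢ + Xᵢ Yᵢ Xᵢ =
  -- Xᵢ Yᵢ = Yᵢ Xᵢ`. Every term beyond `X₁ + X₂` has some `Xᵢ` on each side, which is what makes it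
  -- represent a strict map later. The bound `r = 1 - c⁻¹` comes from `H ≤ c`.
  refine ⟨1 - Q, Y₁ - Y₁ * Q * Y₁, -(Y₁ * Q * Y₂), -(Y₂ * Q * Y₁), Y₂ - Y₂ * Q * Y₂, 1 - c⁻¹,
    sub_pos.2 (inv_lt_one_of_one_lt₀ hc1), sub_lt_self _ (inv_pos.2 hc0), ?_, ?_,
    fun v => ?_, fun v => ?_, fun v => ?_⟩
  · have e₁ : X₁ * Y₁ = Y₁ - 1 := by rw [← hl₁]; noncomm_ring
    have e₁' : Y₁ * X₁ = Y₁ - 1 := by rw [← hr₁]; noncomm_ring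
    have e₂ : X₂ * Y₂ = Y₂ - 1 := by rw [← hl₂]; noncomm_ring
    have e₂' : Y₂ * X₂ = Y₂ - 1 := by rw [← hr₂]; noncomm_ring
    have eS₁ : X₁ + X₁ * Y₁ * X₁ = Y₁ - 1 := by
      rw [mul_assoc, e₁', mul_sub, e₁, mul_one]; abel
    have eS₂ : X₂ + X₂ * Y₂ * X₂ = Y₂ - 1 := by
      rw [mul_assoc, e₂', mul_sub, e₂, mul_one]; abel
    have eQS : Q * (H - 1) = 1 - Q := by rw [mul_sub, hQH, mul_one]
    have eHQ : (H - 1) * Q = 1 - Q := by rw [sub_mul, hHQ, one_mul]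
    have eS : (H - 1) - (H - 1) * Q * (H - 1) = 1 - Q := by
      rw [mul_assoc, eQS, mul_sub, mul_one, eHQ]; abel
    have eH : H - 1 = (Y₁ - 1) + (Y₂ - 1) := by rw [hH]; abel
    have e3 : X₁ + X₂ + X₁ * (Y₁ - Y₁ * Q * Y₁) * X₁ + X₁ * -(Y₁ * Q * Y₂) * X₂
        + X₂ * -(Y₂ * Q * Y₁) * X₁ + X₂ * (Y₂ - Y₂ * Q * Y₂) * X₂
      = (X₁ + X₁ * Y₁ * X₁) + (X₂ + X₂ * Y₂ * X₂)
        - (X₁ * Y₁ + X₂ * Y₂) * Q * (Y₁ * X₁ + Y₂ * X₂) := by noncomm_ring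
    rw [e3, eS₁, eS₂, e₁, e₁', e₂, e₂', ← eH, eS]
  · rintro Z (rfl | rfl | rfl | rfl)
    · exact ⟨⟨_, hsa₁.sub ((hsa₁.mul hQsa).mul hsa₁)⟩, fun P hP hP' =>
        (hc₁ P hP).sub_right (((hc₁ P hP).mul_right (hcQ' P hP hP')).mul_right (hc₁ P hP))⟩
    · exact ⟨(AdjointableMap B E E).neg_mem ⟨_, (hsa₁.mul hQsa).mul hsa₂⟩, fun P hP hP' =>
        (((hc₁ P hP).mul_right (hcQ' P hP hP')).mul_right (hc₂ P hP')).neg_right⟩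
    · exact ⟨(AdjointableMap B E E).neg_mem ⟨_, (hsa₂.mul hQsa).mul hsa₁⟩, fun P hP hP' =>
        (((hc₂ P hP').mul_right (hcQ' P hP hP')).mul_right (hc₁ P hP)).neg_right⟩
    · exact ⟨⟨_, hsa₂.sub ((hsa₂.mul hQsa).mul hsa₂)⟩, fun P hP hP' =>
        (hc₂ P hP').sub_right (((hc₂ P hP').mul_right (hcQ' P hP hP')).mul_right (hc₂ P hP'))⟩
  · have h := hQ₁ v
    rw [_root_.sub_apply, rip_sub_left, hone] at h
    rw [hX]
    exact le_sub_comm.1 h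
  · have h := hQ₂ v
    rw [_root_.sub_apply, rip_sub_left, hone] at h
    rw [hX]
    exact le_sub_comm.1 h
  · have h := rip_inv_le (B := B) (P := H) (V := Q) (P' := (c : ℂ) • 1)
      (V' := ((c⁻¹ : ℝ) : ℂ) • 1) (fun v => (rip_self_nonneg v).trans (hge v)) (fun v => ?_) hHQ ?_ v
    · rw [_root_.smul_apply, rip_real_smul_left, hone] at h
      rw [hX, sub_smul, one_smul]
      exact sub_le_sub_left h _
    · rw [_root_.smul_apply, rip_real_smul_left, hone]
      exact hHc v
    · rw [smul_mul_smul_comm, one_mul, ← Complex.ofReal_mul, mul_inv_cancel₀ hc0.ne',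
        Complex.ofReal_one, one_smul]

end OperatorBounds

/-! ### Strict continuity of `x ↦ x* x` on bounded sets. -/

section StarMulSelf

open DoubleCentralizer

variable {A : Type uA} {B : Type uB} [NonUnitalCStarAlgebra A] [NonUnitalCStarAlgebra B]

theorem DoubleCentralizer.coe_star (x : A) : ((star x : A) : 𝓜(ℂ, A)) = star (x : 𝓜(ℂ, A)) :=
  ext_fst fun c => by simp [star_fst]

theorem strictTendsto_coe_star_mul_self {ι : Type*} {l : Filter ι} {f : ι → A} {m : 𝓜(ℂ, A)}
    {r : ℝ} (hr : ∀ᶠ i in l, ‖f i‖ ≤ r) (hf : StrictTendsto (fun i => (f i : 𝓜(ℂ, A))) l m) :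
    StrictTendsto (fun i => ((star (f i) * f i : A) : 𝓜(ℂ, A))) l (star m * m) := by
  simp only [coe_star_mul]
  have h : ∀ᶠ i in l, ‖(f i : 𝓜(ℂ, A))‖ ≤ r := hr.mono fun i hi => (norm_coe _).trans_le hi
  exact hf.star.mul hf (h.mono fun i hi => by rwa [norm_star]) h

theorem eventually_norm_star_mul_self_le {ι : Type*} {l : Filter ι} {f : ι → A} {r : ℝ}
    (hr : ∀ᶠ i in l, ‖f i‖ ≤ r) : ∀ᶠ i in l, ‖star (f i) * f i‖ ≤ r * r :=
  hr.mono fun i hi => by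
    rw [CStarRing.norm_star_mul_self]
    exact mul_self_le_mul_self (norm_nonneg _) hi

end StarMulSelf

/-! ### Maps represented by operators, and directedness of `𝒢_φ`. -/

namespace KSGNS

variable {A : Type uA} {B : Type uB} [NonUnitalCStarAlgebra A] [PartialOrder A] [StarOrderedRing A]
variable [NonUnitalCStarAlgebra B] [PartialOrder B] [StarOrderedRing B] {φ : CStarWeight A B}
variable {E : Type uE} [NormedAddCommGroup E] [NormedSpace ℂ E] [CompleteSpace E] [SMul Bᵐᵒᵖ E]
variable [HilbertModule B E] {g : KSGNS φ E}

theorem Represents.add {T T' : E →L[ℂ] E} {ρ ρ' : A →ₗ[ℂ] 𝓜(ℂ, B)} (h : g.Represents T ρ)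
    (h' : g.Represents T' ρ') : g.Represents ⇑(T + T') (ρ + ρ') := fun a₁ a₂ b₁ b₂ => by
  have e : (T + T') ((g.Λ a₁).1 b₁) = T ((g.Λ a₁).1 b₁) + T' ((g.Λ a₁).1 b₁) := rfl
  rw [e, rip_add_left, ← h, ← h', LinearMap.add_apply, DoubleCentralizer.add_fst,
    _root_.add_apply, mul_add]

theorem Represents.smul {T : E →L[ℂ] E} {ρ : A →ₗ[ℂ] 𝓜(ℂ, B)} (h : g.Represents T ρ) (c : ℂ) :
    g.Represents ⇑(c • T) (c • ρ) := fun a₁ a₂ b₁ b₂ => by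
  have e : (c • T) ((g.Λ a₁).1 b₁) = c • T ((g.Λ a₁).1 b₁) := rfl
  rw [e, rip_smul_left, ← h, LinearMap.smul_apply, DoubleCentralizer.smul_fst,
    _root_.smul_apply, mul_smul_comm]

/-- A strict map represented by a positive operator is completely positive. -/
theorem Represents.isCP (hφ : φ.DenselyDefined) {T : E →L[ℂ] E} {ρ : A →ₗ[ℂ] 𝓜(ℂ, B)}
    (hρ : IsStrict ρ) (h : g.Represents T ρ) (hT : ∀ v, 0 ≤ rip B (T v) v) : IsCP ρ := by
  intro n a b
  -- The sum is norm continuous in `a`, so all `a i` may be taken in `𝒩_φ`, where the sum is the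
  -- form of `T` at `∑ Λ(a i) (b i)`.
  have hdense : DenseRange fun (x : Fin n → φ.N) (i : Fin n) => (x i : A) :=
    DenseRange.piMap fun _ => hφ.dense_N.denseRange_val
  refine hdense.induction_on a ?_ fun x => ?_
  · refine CStarAlgebra.isClosed_nonneg.preimage (f := fun a : Fin n → A =>
      ∑ i, ∑ j, star (b j) * (ρ (star (a j) * a i)).fst (b i)) ?_
    refine continuous_finsetSum _ fun i _ => continuous_finsetSum _ fun j _ =>
      continuous_const.mul ?_
    have h1 : Continuous fun m : 𝓜(ℂ, B) => m.fst (b i) :=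
      continuous_iff_continuousAt.2 fun m => (StrictTendsto.of_tendsto tendsto_id (b i)).1
    exact h1.comp (hρ.continuous.comp
      ((continuous_apply j).star.mul (continuous_apply i)))
  · have h1 := hT (∑ i, (g.Λ (x i)).1 (b i))
    simp only [map_sum, rip_sum_left, rip_sum_right] at h1
    rw [Finset.sum_comm] at h1
    simpa only [h (x _) (x _)] using h1

/-- Paired with `Λ(a') b'`, both sides at `v = Λ(a) b` give `b'* ρ(a'* x a) b`. -/
theorem G.op_π (ρ : g.G) (x : A) (v : E) : (G.op ρ).1 (g.π x v) = g.π x ((G.op ρ).1 v) := by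
  refine congrArg (fun T : E →L[ℂ] E => T v)
    (g.clm_ext (T := (G.op ρ).1 ∘L g.π x) (T' := g.π x ∘L (G.op ρ).1) fun a b => ?_)
  refine g.ext_rip fun a' b' => ?_
  rw [ContinuousLinearMap.comp_apply, ContinuousLinearMap.comp_apply, g.π_Λ, g.rip_π, g.π_Λ,
    ← G.rep ρ, ← G.rep ρ]
  simp [mul_assoc]

/-- `R Λ(f) b → 0` if `f → 0` strictly and `R Λ(·) b` is controlled by a strict map. -/
theorem tendsto_apply_Λ_zero {R : E → E} {ρ : A →ₗ[ℂ] 𝓜(ℂ, B)} (hρ : IsStrict ρ)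
    (h : ∀ (a : φ.N) (b : B), ‖R ((g.Λ a).1 b)‖ ^ 2 ≤ ‖star b * (ρ (star (a : A) * a)).fst b‖)
    {ι : Type*} {l : Filter ι} {f : ι → φ.N} {r : ℝ} (hr : ∀ᶠ i in l, ‖(f i : A)‖ ≤ r)
    (hf : StrictTendsto (fun i => ((f i : A) : 𝓜(ℂ, A))) l 0) (b : B) :
    Tendsto (fun i => R ((g.Λ (f i)).1 b)) l (𝓝 0) := by
  have h1 := strictTendsto_coe_star_mul_self hr hf
  rw [mul_zero, ← DoubleCentralizer.coe_zero] at h1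
  have h2 := ((hρ.tendsto (eventually_norm_star_mul_self_le hr) h1) b).1.const_mul (star b)
  rw [map_zero, DoubleCentralizer.zero_fst, _root_.zero_apply, mul_zero] at h2
  have h3 := (Real.continuous_sqrt.tendsto 0).comp
    (squeeze_zero (fun _ => by positivity) (fun i => h (f i) b)
      (tendsto_zero_iff_norm_tendsto_zero.1 h2))
  rw [tendsto_zero_iff_norm_tendsto_zero]
  simpa [Function.comp_def, Real.sqrt_sq (norm_nonneg _)] using h3

variable {I : Type uI} [Preorder I] [IsDirectedOrder I] [Nonempty I] {u : I → 𝓜(ℂ, A)}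
  {S : I → AdjointableMap B E E} {ρ : I → A →ₗ[ℂ] 𝓜(ℂ, B)}

/-- On vectors `π(e) v` strict convergence of `f` gives norm convergence of `f e`. Such vectors
approximate `v` by nondegeneracy, and the bound on `f` passes to the limit. -/
theorem TruncationNet.tendsto_π_apply (h : g.TruncationNet u S ρ) {ι : Type*} {l : Filter ι}
    {f : ι → A} {x : A} {r : ℝ} (hr : ∀ᶠ i in l, ‖f i‖ ≤ r)
    (hf : StrictTendsto (fun i => (f i : 𝓜(ℂ, A))) l x) (v : E) :
    Tendsto (fun i => g.π (f i) v) l (𝓝 (g.π x v)) := by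
  have hr' : ∀ᶠ i in l, ‖g.π (f i)‖ ≤ r := hr.mono fun i hi => (g.norm_π_le _).trans hi
  refine (isClosed_setOf_tendsto_apply hr').mem_of_tendsto (h.tendsto_π v)
    (Eventually.of_forall fun e => ?_)
  rw [Set.mem_ofPred_eq]
  simp only [← g.π_mul_apply]
  have h1 : Tendsto (fun i => f i * e) l (𝓝 (x * e)) := by
    simpa only [DoubleCentralizer.coe_fst_apply] using (hf e).1
  have h2 : Continuous fun y : A => g.π y v := by
    let L : A →ₗ[ℂ] E :=
      { toFun := fun y => g.π y v
        map_add' := fun y y' => by rw [map_add]; rfl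
        map_smul' := fun c y => by rw [map_smul]; rfl }
    exact (L.mkContinuous ‖v‖ fun y =>
      ((g.π y).le_of_opNorm_le (g.norm_π_le y) v).trans_eq (mul_comm _ _)).continuous
  exact (h2.tendsto _).comp h1

theorem TruncationNet.dense_π_star (h : g.TruncationNet u S ρ) (hφ : φ.DenselyDefined) :
    Dense {w : E | ∃ (x : φ.N) (v : E), w = g.π (star (x : A)) v} := by
  intro v
  have h1 : ∀ e : A, g.π e v ∈ closure {w : E | ∃ (x : φ.N) (v : E), w = g.π (star (x : A)) v} := by
    intro e
    obtain ⟨x, hxN, hx⟩ := mem_closure_iff_seq_limit.1 (hφ.dense_N (star e))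
    have hx' : Tendsto (fun n => star (x n)) atTop (𝓝 e) := by simpa using hx.star
    have hb : ∀ᶠ n in atTop, ‖star (x n)‖ ≤ ‖e‖ + 1 :=
      (hx'.norm.eventually (gt_mem_nhds (lt_add_one _))).mono fun _ h => le_of_lt h
    exact mem_closure_of_tendsto
      (h.tendsto_π_apply hb (StrictTendsto.coe_of_tendsto hx') v)
      (Eventually.of_forall fun n => ⟨⟨x n, hxN n⟩, v, rfl⟩)
  exact isClosed_closure.mem_of_tendsto (h.tendsto_π v) (Eventually.of_forall h1)

/-- The vector operator `W` with `π(x) W = R Λ(x)`. -/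
theorem TruncationNet.exists_vector (h : g.TruncationNet u S ρ) (hφ : φ.DenselyDefined)
    {R : AdjointableMap B E E} {η : A →ₗ[ℂ] 𝓜(ℂ, B)} (hη : IsStrict η)
    (hR : ∀ (a : φ.N) (b : B), ‖R.1 ((g.Λ a).1 b)‖ ^ 2 ≤ ‖star b * (η (star (a : A) * a)).fst b‖)
    (hπ : ∀ x v, R.1 (g.π x v) = g.π x (R.1 v)) :
    ∃ W : AdjointableMap B B E, ∀ (x : φ.N) (b : B), g.π x (W.1 b) = R.1 ((g.Λ x).1 b) := by
  -- The vector `W b` is the limit of `R Λ(x) b` as `x ∈ 𝒩_φ` tends strictly to `1` within a ball.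
  -- It is Cauchy because `R Λ(·) b` is strictly continuous at `0` on bounded sets.
  obtain ⟨l, hne, hl, hl1⟩ := exists_strict_approx (1 : 𝓜(ℂ, A)) hφ.dense_N
  set r := ‖(1 : 𝓜(ℂ, A))‖ + 1
  set l' : Filter φ.N := comap Subtype.val l with hl'
  have hmap : map Subtype.val l' = l := map_comap_of_mem (by
    rw [Subtype.range_coe_subtype]
    exact hl.mono fun x hx => hx.1)
  have hne' : l'.NeBot := by
    rw [← map_neBot_iff (Subtype.val : φ.N → A), hmap]; exact hne
  have hval : Tendsto (Subtype.val : φ.N → A) l' l := tendsto_comap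
  have hr : ∀ᶠ x : φ.N in l', ‖(x : A)‖ ≤ r := (hval.eventually hl).mono fun x hx => hx.2
  have h1 : StrictTendsto (fun x : φ.N => ((x : A) : 𝓜(ℂ, A))) l' 1 := hl1.comp hval
  have hcau : ∀ b, Cauchy (map (fun x : φ.N => R.1 ((g.Λ x).1 b)) l') := by
    intro b
    refine cauchy_map_of_tendsto_sub ?_
    have h2 : StrictTendsto (fun p : φ.N × φ.N => (((p.1 - p.2 : φ.N) : A) : 𝓜(ℂ, A)))
        (l' ×ˢ l') 0 := by
      have := (h1.comp (tendsto_fst (g := l'))).sub (h1.comp (tendsto_snd (f := l')))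
      simpa only [← DoubleCentralizer.coe_sub, sub_self, ← Submodule.coe_sub] using this
    have h3 : ∀ᶠ p : φ.N × φ.N in l' ×ˢ l', ‖((p.1 - p.2 : φ.N) : A)‖ ≤ r + r := by
      filter_upwards [hr.prod_mk hr] with p hp
      exact (norm_sub_le _ _).trans (add_le_add hp.1 hp.2)
    refine (tendsto_apply_Λ_zero hη hR h3 h2 b).congr fun p => ?_
    rw [← map_sub, map_sub]
    rfl
  choose W hW using fun b => CompleteSpace.complete (hcau b)
  have hW' : ∀ b, Tendsto (fun x : φ.N => R.1 ((g.Λ x).1 b)) l' (𝓝 (W b)) := hW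
  let WL : B →ₗ[ℂ] E :=
    { toFun := W
      map_add' := fun b b' => by
        refine tendsto_nhds_unique (hW' (b + b')) (((hW' b).add (hW' b')).congr fun x => ?_)
        rw [map_add, map_add]
      map_smul' := fun c b => by
        refine tendsto_nhds_unique (hW' (c • b)) (((hW' b).const_smul c).congr fun x => ?_)
        rw [map_smul, map_smul] }
  have hπW : ∀ (x : φ.N) (b : B), g.π x (W b) = R.1 ((g.Λ x).1 b) := by
    intro x b
    have h2 := ((g.π (x : A)).continuous.tendsto _).comp (hW' b)
    refine tendsto_nhds_unique h2 ?_
    have h3 : Tendsto (fun y : φ.N => (x : A) * y) l' (𝓝 x) := by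
      have := (h1 x).2
      simpa only [DoubleCentralizer.coe_snd_apply, DoubleCentralizer.one_snd,
        one_apply_eq_self] using this
    have h4 : Tendsto (fun y : φ.N => (x : A) * y - x) l' (𝓝 0) := by
      simpa using h3.sub_const (x : A)
    have h5 := tendsto_apply_Λ_zero (l := l')
      (f := fun y : φ.N => ⟨x * y, φ.mul_mem_N x y.2⟩ - x) (r := 1) hη hR
      ((h4.norm.eventually (gt_mem_nhds (by simp))).mono fun y hy => le_of_lt hy)
      (by rw [← DoubleCentralizer.coe_zero]; exact StrictTendsto.coe_of_tendsto h4) b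
    have h6 := h5.add_const (R.1 ((g.Λ x).1 b))
    rw [zero_add] at h6
    refine h6.congr fun y => ?_
    rw [Function.comp_apply, ← hπ, g.π_Λ, ← map_add, map_sub]
    congr 1
    exact sub_add_cancel _ _
  -- On the dense set of vectors `π(x*) v` the adjoint of `W` is `Λ(x)* R* v`.
  obtain ⟨T, hT⟩ := exists_adjointable_of_dense WL
    ((h.dense_π_star hφ).mono Submodule.subset_span) (by
      rintro _ ⟨x, v, rfl⟩
      refine ⟨AdjointableMap.adj (g.Λ x) (AdjointableMap.adj R v), fun b => ?_⟩
      rw [← AdjointableMap.rip_adj, ← AdjointableMap.rip_adj, ← hπW, g.rip_π]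
      rfl)
  refine ⟨T, fun x b => ?_⟩
  rw [← hπW]
  exact congrArg (g.π x) (congrArg (fun L : B →ₗ[ℂ] E => L b) hT)

/-- `R₁* Z R₂` represents a strict map if `R₁` and `R₂` are controlled by strict maps. -/
theorem TruncationNet.exists_represents (h : g.TruncationNet u S ρ) (hφ : φ.DenselyDefined)
    (ρ₁ ρ₂ : g.G) {Z : E →L[ℂ] E} (hZ : Z ∈ AdjointableMap B E E)
    (hZπ : ∀ x v, Z (g.π x v) = g.π x (Z v)) :
    ∃ η : A →ₗ[ℂ] 𝓜(ℂ, B), IsStrict η ∧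
      g.Represents ⇑((G.op ρ₁).1 * Z * (G.op ρ₂).1) η := by
  obtain ⟨W₁, hW₁⟩ := h.exists_vector hφ (G.strict ρ₁) (G.norm_op_Λ_sq_le ρ₁) (G.op_π ρ₁)
  obtain ⟨W₂, hW₂⟩ := h.exists_vector hφ (G.strict ρ₂) (G.norm_op_Λ_sq_le ρ₂) (G.op_π ρ₂)
  obtain ⟨Z', hZ'⟩ := hZ
  have hpair : ∀ x : A, IsAdjointPair B
      (fun b => AdjointableMap.adj W₁ (Z (g.π x (W₂.1 b))))
      (fun b => AdjointableMap.adj W₂ (g.π (star x) (Z' (W₁.1 b)))) := fun x b b' => by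
    rw [AdjointableMap.rip_adj_left, hZ', g.rip_π, AdjointableMap.rip_adj]
  -- The map `x ↦ W₁* Z π(x) W₂` inherits strictness from `π`. At `a₂* a₁` the factors `π(a₁) W₂`
  -- and `π(a₂) W₁` become `T₂ Λ(a₁)` and `T₁ Λ(a₂)`, with `T₁` and `T₂` the operators of `ρ₁` and
  -- `ρ₂`.
  let η : A →ₗ[ℂ] 𝓜(ℂ, B) :=
    { toFun := fun x => (hpair x).toMultiplier
      map_add' := fun x y => DoubleCentralizer.ext_fst fun b => by
        simp only [IsAdjointPair.toMultiplier_fst, DoubleCentralizer.add_fst, _root_.add_apply,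
          map_add]
      map_smul' := fun c x => DoubleCentralizer.ext_fst fun b => by
        simp only [IsAdjointPair.toMultiplier_fst, DoubleCentralizer.smul_fst, _root_.smul_apply,
          map_smul, RingHom.id_apply] }
  refine ⟨η, fun r l x hr hl b => ⟨?_, ?_⟩, fun a₁ a₂ b₁ b₂ => ?_⟩
  · have h1 := h.tendsto_π_apply hr hl (W₂.1 b)
    exact ((AdjointableMap.adj W₁).continuous.tendsto _).comp ((Z.continuous.tendsto _).comp h1)
  · have hl' := hl.star
    simp only [← DoubleCentralizer.coe_star] at hl'
    have h1 := h.tendsto_π_apply (hr.mono fun y hy => by rwa [norm_star]) hl' (Z' (W₁.1 (star b)))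
    exact (((AdjointableMap.adj W₂).continuous.tendsto _).comp h1).star
  · have e1 : star b₂ * (η (star (a₂ : A) * a₁)).fst b₁
        = rip B (AdjointableMap.adj W₁ (Z (g.π (star (a₂ : A) * a₁) (W₂.1 b₁)))) b₂ := rfl
    rw [e1, AdjointableMap.rip_adj_left, g.π_mul_apply, hW₂, hZπ, g.rip_π, star_star, hW₁,
      mul_apply_eq_comp, mul_apply_eq_comp, G.op_selfAdj ρ₁]

theorem G.le_of_op_le (hφ : φ.DenselyDefined) {ρ₁ ρ₂ : g.G} {T : E →L[ℂ] E}
    (h₂ : g.Represents T ρ₂.1) (h : ∀ v, rip B ((G.op ρ₁).1 v) v ≤ rip B (T v) v) : ρ₁ ≤ ρ₂ := by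
  have h1 : g.Represents ⇑(T + (-1 : ℂ) • (G.op ρ₁).1) (ρ₂.1 + (-1 : ℂ) • ρ₁.1) :=
    h₂.add ((G.rep ρ₁).smul (-1))
  have h2 := h1.isCP hφ ((G.strict ρ₂).add ((G.strict ρ₁).smul (-1))) fun v => by
    rw [_root_.add_apply, _root_.smul_apply, rip_add_left, rip_smul_left, neg_one_smul,
      ← sub_eq_add_neg, sub_nonneg]
    exact h v
  have e : ρ₂.1 + (-1 : ℂ) • ρ₁.1 = ρ₂.1 - ρ₁.1 := LinearMap.ext fun x => by
    simp [sub_eq_add_neg]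
  rwa [e] at h2

/-- `𝒢_φ` is directed. -/
theorem TruncationNet.isDirectedOrder (h : g.TruncationNet u S ρ) (hφ : φ.DenselyDefined) :
    IsDirectedOrder g.G := by
  refine ⟨fun ρ₁ ρ₂ => ?_⟩
  obtain ⟨s₁, hs₁, hs₁', hle₁⟩ := G.op_le_smul ρ₁
  obtain ⟨s₂, hs₂, hs₂', hle₂⟩ := G.op_le_smul ρ₂
  -- The `1 / 2` only makes `s` positive.
  set s := max (max s₁ s₂) (1 / 2) with hs
  have hmono : ∀ {t : ℝ} (v : E), t ≤ s → t • rip B v v ≤ s • rip B v v := fun v ht =>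
    smul_le_smul_of_nonneg_right ht (rip_self_nonneg v)
  obtain ⟨X, Z₁₁, Z₁₂, Z₂₁, Z₂₂, r, hr0, hr1, hX, hZ, hX₁, hX₂, hXr⟩ :=
    exists_upper_bound (B := B) (s := s) (lt_max_of_lt_right (by norm_num))
      (max_lt (max_lt hs₁' hs₂') (by norm_num)) (G.op_nonneg ρ₁) (G.op_nonneg ρ₂)
      (fun v => (hle₁ v).trans (hmono v ((le_max_left _ _).trans (le_max_left _ _))))
      (fun v => (hle₂ v).trans (hmono v ((le_max_right _ _).trans (le_max_left _ _))))
  have hπ : ∀ Z ∈ ({Z₁₁, Z₁₂, Z₂₁, Z₂₂} : Set (E →L[ℂ] E)), ∀ x v, Z (g.π x v) = g.π x (Z v) := by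
    intro Z hZ' x v
    have hc : ∀ σ : g.G, Commute (g.π x) (G.op σ).1 := fun σ =>
      ContinuousLinearMap.ext fun v => (G.op_π σ x v).symm
    exact (congrArg (fun T : E →L[ℂ] E => T v) ((hZ Z hZ').2 _ (hc ρ₁) (hc ρ₂))).symm
  have hrep : ∀ (σ τ : g.G), ∀ Z ∈ ({Z₁₁, Z₁₂, Z₂₁, Z₂₂} : Set (E →L[ℂ] E)),
      ∃ η : A →ₗ[ℂ] 𝓜(ℂ, B), IsStrict η ∧ g.Represents ⇑((G.op σ).1 * Z * (G.op τ).1) η :=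
    fun σ τ Z hZ' => h.exists_represents hφ σ τ (hZ Z hZ').1 (hπ Z hZ')
  obtain ⟨η₁₁, hs₁₁, h₁₁⟩ := hrep ρ₁ ρ₁ Z₁₁ (by simp)
  obtain ⟨η₁₂, hs₁₂, h₁₂⟩ := hrep ρ₁ ρ₂ Z₁₂ (by simp)
  obtain ⟨η₂₁, hs₂₁, h₂₁⟩ := hrep ρ₂ ρ₁ Z₂₁ (by simp)
  obtain ⟨η₂₂, hs₂₂, h₂₂⟩ := hrep ρ₂ ρ₂ Z₂₂ (by simp)
  set η := ρ₁.1 + ρ₂.1 + η₁₁ + η₁₂ + η₂₁ + η₂₂ with hη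
  have hηs : IsStrict η :=
    (((((G.strict ρ₁).add (G.strict ρ₂)).add hs₁₁).add hs₁₂).add hs₂₁).add hs₂₂
  have hηrep : g.Represents X η := by
    rw [hX]
    exact (((((G.rep ρ₁).add (G.rep ρ₂)).add h₁₁).add h₁₂).add h₂₁).add h₂₂
  have hX0 : ∀ v, 0 ≤ rip B (X v) v := fun v => (G.op_nonneg ρ₁ v).trans (hX₁ v)
  have hXmem : X ∈ AdjointableMap B E E :=
    ⟨X, isAdjointPair_self_of_nonneg (D := (X : E →ₗ[ℂ] E)) hX0⟩
  have hrep' := hηrep.smul ((r⁻¹ : ℝ) : ℂ)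
  have hform : ∀ v, rip B ((((r⁻¹ : ℝ) : ℂ) • X) v) v = r⁻¹ • rip B (X v) v := fun v => by
    rw [_root_.smul_apply, rip_real_smul_left]
  have hpos : ∀ v, 0 ≤ rip B ((((r⁻¹ : ℝ) : ℂ) • X) v) v := fun v => by
    rw [hform]; exact smul_nonneg (inv_pos.2 hr0).le (hX0 v)
  -- As `X ≤ r < 1`, the map `r⁻¹ η` is in `ℱ_φ` and `η` is its multiple by `r`.
  let σ : g.G := ⟨η, r, hr0.le, hr1, ((r⁻¹ : ℝ) : ℂ) • η,
    ⟨hηs.smul _, hrep'.isCP hφ (hηs.smul _) hpos,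
      ⟨_, (AdjointableMap B E E).smul_mem _ hXmem⟩, hpos, fun v => by
        have := smul_le_smul_of_nonneg_left (hXr v) (inv_pos.2 hr0).le
        rw [inv_smul_smul₀ hr0.ne', ← hform] at this
        exact this, hrep'⟩, by
    rw [smul_smul, ← Complex.ofReal_mul, mul_inv_cancel₀ hr0.ne', Complex.ofReal_one, one_smul]⟩
  exact ⟨σ, G.le_of_op_le hφ (ρ₂ := σ) hηrep hX₁, G.le_of_op_le hφ (ρ₂ := σ) hηrep hX₂⟩

/-- The maps attached to a truncating net, as members of `𝒢_φ`. -/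
def Truncation.toG {u : 𝓜(ℂ, A)} {S : AdjointableMap B E E} {ρ : A →ₗ[ℂ] 𝓜(ℂ, B)}
    (h : g.Truncation u S ρ) (t : ℝ) (ht0 : 0 ≤ t) (ht1 : t < 1) : g.G :=
  ⟨(t : ℂ) • ρ, t, ht0, ht1, ρ, ⟨h.strict, h.cp,
    ⟨AdjointableMap.adj S ∘L S.1, AdjointableMap.adj S ∘L S.1, fun _ _ =>
      (AdjointableMap.rip_adj_left S _ _).trans (AdjointableMap.rip_adj S _ _)⟩,
    fun v => (rip_self_nonneg (S.1 v)).trans_eq (AdjointableMap.rip_adj_left S _ _).symm,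
    fun v => (AdjointableMap.rip_adj_left S _ _).trans_le (AdjointableMap.rip_apply_self_le h.norm_S v),
    fun a₁ a₂ b₁ b₂ => (h.rep a₁ a₂ b₁ b₂).trans (AdjointableMap.rip_adj_left S _ _).symm⟩, rfl⟩

end KSGNS

/-! ### Order and limits: filters as nets, monotonicity of completely positive maps. -/

theorem le_of_tendsto_of_eventually_le {B : Type*} [NonUnitalCStarAlgebra B] [PartialOrder B]
    [StarOrderedRing B] {ι : Type*} {l : Filter ι} [l.NeBot] {f f' : ι → B} {x x' : B}
    (hf : Tendsto f l (𝓝 x)) (hf' : Tendsto f' l (𝓝 x')) (h : ∀ᶠ i in l, f i ≤ f' i) : x ≤ x' :=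
  sub_nonneg.1 (CStarAlgebra.isClosed_nonneg.mem_of_tendsto (hf'.sub hf)
    (h.mono fun _ hi => sub_nonneg.2 hi))

/-- Every proper filter is the limit of a net. -/
theorem exists_net_tendsto.{v, w} {X : Type v} (l : Filter X) [l.NeBot] {P : X → Prop}
    (hP : ∀ᶠ x in l, P x) :
    ∃ (J : Type (max v w)) (_ : Preorder J) (_ : IsDirectedOrder J) (_ : Nonempty J) (k : J → X),
      (∀ j, P (k j)) ∧ Tendsto k atTop l := by
  -- Indices are pairs of a set of the filter and a point of it satisfying `P`, ordered by reverse
  -- inclusion of the sets. The lift only adjusts the universe.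
  let J := ULift.{w} {q : Set X × X // q.1 ∈ l ∧ q.2 ∈ q.1 ∧ P q.2}
  let _ : Preorder J := Preorder.lift fun j => OrderDual.toDual j.down.1.1
  have hmk : ∀ s ∈ l, ∃ j : J, j.down.1.1 = s := fun s hs => by
    obtain ⟨x, hx, hx'⟩ := (Eventually.and (p := fun x => x ∈ s) hs hP).exists
    exact ⟨⟨⟨(s, x), hs, hx, hx'⟩⟩, rfl⟩
  refine ⟨J, inferInstance, ⟨fun i j => ?_⟩, ?_, fun j => j.down.1.2, fun j => j.down.2.2.2,
    fun s hs => ?_⟩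
  · obtain ⟨k, hk⟩ := hmk _ (inter_mem i.down.2.1 j.down.2.1)
    exact ⟨k, hk.le.trans Set.inter_subset_left, hk.le.trans Set.inter_subset_right⟩
  · obtain ⟨j, _⟩ := hmk _ univ_mem
    exact ⟨j⟩
  · obtain ⟨k, hk⟩ := hmk s hs
    rw [mem_map]
    refine mem_of_superset (Ici_mem_atTop k) fun j hj => ?_
    have hj' : j.down.1.1 ⊆ k.down.1.1 := hj
    exact hk ▸ hj' j.down.2.2.1

theorem IsCP.nonneg {A B : Type*} [NonUnitalCStarAlgebra A] [PartialOrder A] [StarOrderedRing A]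
    [NonUnitalCStarAlgebra B] [PartialOrder B] [StarOrderedRing B] {ρ : A →ₗ[ℂ] 𝓜(ℂ, B)}
    (h : IsCP ρ) {x : A} (hx : 0 ≤ x) (b : B) : 0 ≤ star b * (ρ x).fst b := by
  obtain ⟨y, rfl⟩ := CStarAlgebra.nonneg_iff_eq_star_mul_self.1 hx
  simpa using h 1 (fun _ => y) (fun _ => b)

theorem IsCP.apply_mono {A B : Type*} [NonUnitalCStarAlgebra A] [PartialOrder A]
    [StarOrderedRing A] [NonUnitalCStarAlgebra B] [PartialOrder B] [StarOrderedRing B]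
    {ρ : A →ₗ[ℂ] 𝓜(ℂ, B)} (h : IsCP ρ) {x y : A} (hxy : x ≤ y) (b : B) :
    star b * (ρ x).fst b ≤ star b * (ρ y).fst b := by
  have h1 := h.nonneg (sub_nonneg.2 hxy) b
  rw [map_sub, DoubleCentralizer.sub_fst, _root_.sub_apply, mul_sub] at h1
  exact sub_nonneg.1 h1

theorem strictTendsto_fst {B : Type*} [NonUnitalCStarAlgebra B] {ι : Type*} {l : Filter ι}
    {f : ι → 𝓜(ℂ, B)} {y : 𝓜(ℂ, B)} (h : StrictTendsto f l y) (b : B) :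
    Tendsto (fun i => star b * (f i).fst b) l (𝓝 (star b * y.fst b)) := (h b).1.const_mul _

/-- `ρ((e a)* (e a)) ≤ ρ(a* a)` for a multiplier `a` and a contraction `e`. -/
theorem IsCP.apply_snd_le_strictExtension {A : Type uA} {B : Type uB} [NonUnitalCStarAlgebra A]
    [PartialOrder A] [StarOrderedRing A] [NonUnitalCStarAlgebra B] [PartialOrder B]
    [StarOrderedRing B] {ρ : A →ₗ[ℂ] 𝓜(ℂ, B)} (h : IsCP ρ) (hs : IsStrict ρ) (a : 𝓜(ℂ, A)) {e : A}
    (he : ‖e‖ ≤ 1) (b : B) :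
    star b * (ρ (star (a.snd e) * a.snd e)).fst b
      ≤ star b * (strictExtension ρ (star a * a)).fst b := by
  have hr : ∀ᶠ e' in CStarAlgebra.approximateUnit A, ‖a.snd e'‖ ≤ ‖a‖ :=
    eventually_approximateUnit.mono fun e' he' => (DoubleCentralizer.norm_snd_apply_le _ _).trans
      (mul_le_of_le_one_right (norm_nonneg _) he'.2)
  have h1 := hs.tendsto_strictExtension (eventually_norm_star_mul_self_le hr)
    (strictTendsto_coe_star_mul_self hr (strictTendsto_snd_approximateUnit a))
  -- In `A` itself `(e e' a)* (e e' a) ≤ (e' a)* (e' a)`. As `e'` runs through the approximate unit,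
  -- the left side converges in norm and the right side strictly within a ball.
  have h2 : Tendsto (fun e' => e * a.snd e') (CStarAlgebra.approximateUnit A) (𝓝 (a.snd e)) := by
    have := (a.snd.continuous.tendsto e).comp (tendsto_mul_approximateUnit e)
    exact this.congr fun e' => DoubleCentralizer.snd_mul_apply a e e'
  have h3 := StrictTendsto.of_tendsto ((hs.continuous.tendsto _).comp (h2.star.mul h2))
  refine le_of_tendsto_of_eventually_le (strictTendsto_fst h3 b) (strictTendsto_fst h1 b)
    (Eventually.of_forall fun e' => h.apply_mono ?_ b)
  have h4 := CStarAlgebra.star_left_conjugate_le_norm_smul (a := a.snd e') (b := star e * e)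
    (IsSelfAdjoint.star_mul_self e)
  have h5 : ‖star e * e‖ ≤ 1 := by
    rw [CStarRing.norm_star_mul_self]; nlinarith [norm_nonneg e]
  have h6 := smul_le_smul_of_nonneg_right h5 (star_mul_self_nonneg (a.snd e'))
  rw [one_smul] at h6
  refine le_trans (le_of_eq ?_) (h4.trans h6)
  simp only [star_mul, mul_assoc]

/-! ### The net `e a uᵢ` and the values of the closure of `Λ`. -/

namespace KSGNS

variable {A : Type uA} {B : Type uB} [NonUnitalCStarAlgebra A] [PartialOrder A] [StarOrderedRing A]
variable [NonUnitalCStarAlgebra B] [PartialOrder B] [StarOrderedRing B] {φ : CStarWeight A B}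
variable {E : Type uE} [NormedAddCommGroup E] [NormedSpace ℂ E] [CompleteSpace E] [SMul Bᵐᵒᵖ E]
variable [HilbertModule B E] {g : KSGNS φ E}
variable {I : Type uI} [Preorder I] [IsDirectedOrder I] [Nonempty I] {u : I → 𝓜(ℂ, A)}
  {S : I → AdjointableMap B E E} {ρ : I → A →ₗ[ℂ] 𝓜(ℂ, B)}

namespace TruncationNet

/-- The truncation `x uᵢ` of `x ∈ A`, an element of `𝒩_φ`. -/
def cut (h : g.TruncationNet u S ρ) (hφ : φ.DenselyDefined) (hlsc : g.LowerSemicontinuous) (i : I) :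
    A →ₗ[ℂ] φ.N :=
  LinearMap.codRestrict φ.N ((u i).snd : A →ₗ[ℂ] A) (h.snd_mem_N hφ hlsc i)

theorem G_neBot (h : g.TruncationNet u S ρ) (hφ : φ.DenselyDefined) :
    (atTop : Filter g.G).NeBot := by
  have := h.isDirectedOrder hφ
  have : Nonempty g.G := ⟨(h.trunc (Classical.arbitrary I)).toG 0 le_rfl one_pos⟩
  infer_instance

/-- These are the vectors at which the adjoint of a value of the closure is known explicitly. -/
theorem dense_adj_S_π (h : g.TruncationNet u S ρ) :
    Dense {w : E | ∃ (f : A) (j : I) (v : E), w = AdjointableMap.adj (S j) (g.π (star f) v)} := by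
  intro v
  refine isClosed_closure.mem_of_tendsto (h.tendsto_adj_S v) (Eventually.of_forall fun j => ?_)
  refine mem_closure_of_tendsto
    (((AdjointableMap.adj (S j)).continuous.tendsto v).comp (h.tendsto_π v)) ?_
  filter_upwards [eventually_approximateUnit (A := A)] with e he
  exact ⟨e, j, v, by rw [he.1]; rfl⟩

variable (h : g.TruncationNet u S ρ) (hφ : φ.DenselyDefined) (hlsc : g.LowerSemicontinuous)

theorem coe_cut (i : I) (x : A) : (h.cut hφ hlsc i x : A) = (u i).snd x := rfl

theorem norm_cut_le (i : I) (x : A) : ‖(h.cut hφ hlsc i x : A)‖ ≤ ‖x‖ :=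
  (DoubleCentralizer.norm_snd_apply_le _ _).trans
    (mul_le_of_le_one_left (norm_nonneg _) (h.trunc i).norm_u)

theorem exists_norm_Λ_cut_le (i : I) :
    ∃ C, 0 ≤ C ∧ ∀ x, ‖g.Λ (h.cut hφ hlsc i x)‖ ≤ C * ‖x‖ := h.exists_norm_Λ_snd_le hφ hlsc i

theorem tendsto_Λ_cut (i : I) {ι : Type*} {l : Filter ι} {f : ι → A} {x : A}
    (hf : Tendsto f l (𝓝 x)) (b : B) :
    Tendsto (fun k => (g.Λ (h.cut hφ hlsc i (f k))).1 b) l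
      (𝓝 ((g.Λ (h.cut hφ hlsc i x)).1 b)) := by
  obtain ⟨C, hC0, hC⟩ := h.exists_norm_Λ_cut_le hφ hlsc i
  let L : A →ₗ[ℂ] E :=
    { toFun := fun x => (g.Λ (h.cut hφ hlsc i x)).1 b
      map_add' := fun x y => by rw [map_add, map_add]; rfl
      map_smul' := fun c x => by rw [map_smul, map_smul]; rfl }
  have hL : Continuous L := (L.mkContinuous (C * ‖b‖) fun x =>
    ((g.Λ (h.cut hφ hlsc i x)).1.le_of_opNorm_le (hC x) b).trans_eq (by ring)).continuous
  exact (hL.tendsto x).comp hf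

theorem π_S_Λ (f : A) (j : I) (x : φ.N) (b : B) :
    g.π f ((S j).1 ((g.Λ x).1 b)) = (g.Λ (h.cut hφ hlsc j (f * x))).1 b := by
  rw [(h.trunc j).S_Λ, g.π_Λ]
  exact g.Λ_apply_congr (DoubleCentralizer.snd_mul_apply _ _ _).symm b

/-- `e a uᵢ`, indexed by pairs `(e, i)`. -/
def cutNet (a : 𝓜(ℂ, A)) (p : A × I) : φ.N := h.cut hφ hlsc p.2 (a.snd p.1)

theorem eventually_norm_cutNet_le (a : 𝓜(ℂ, A)) :
    ∀ᶠ p in CStarAlgebra.approximateUnit A ×ˢ atTop, ‖(h.cutNet hφ hlsc a p : A)‖ ≤ ‖a‖ := by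
  filter_upwards [tendsto_fst.eventually (eventually_approximateUnit (A := A))] with p hp
  exact (h.norm_cut_le hφ hlsc _ _).trans ((DoubleCentralizer.norm_snd_apply_le _ _).trans
    (mul_le_of_le_one_right (norm_nonneg _) hp.2))

theorem strictTendsto_cutNet (a : 𝓜(ℂ, A)) :
    StrictTendsto (fun p => ((h.cutNet hφ hlsc a p : A) : 𝓜(ℂ, A)))
      (CStarAlgebra.approximateUnit A ×ˢ atTop) a := by
  have h1 : ∀ᶠ p : A × I in CStarAlgebra.approximateUnit A ×ˢ atTop,
      ‖((a.snd p.1 : A) : 𝓜(ℂ, A))‖ ≤ ‖a‖ := by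
    filter_upwards [tendsto_fst.eventually (eventually_approximateUnit (A := A))] with p hp
    rw [DoubleCentralizer.norm_coe]
    exact (DoubleCentralizer.norm_snd_apply_le _ _).trans
      (mul_le_of_le_one_right (norm_nonneg _) hp.2)
  have h2 := ((strictTendsto_snd_approximateUnit a).comp tendsto_fst).mul
    (h.u_tendsto.comp tendsto_snd) h1 (Eventually.of_forall fun p => (h.trunc p.2).norm_u)
  rw [mul_one] at h2
  simp only [← DoubleCentralizer.coe_snd_eq_mul] at h2
  exact h2

/-- `t` is the value of the closure of `Λ` at the multiplier `a`. -/
def IsValue (a : 𝓜(ℂ, A)) (t : B → E) : Prop :=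
  ∀ (f : A) (j : I) (b : B),
    g.π f ((S j).1 (t b)) = (g.Λ (h.cut hφ hlsc j (a.snd f))).1 b

theorem isValue_Λ (a : φ.N) : h.IsValue hφ hlsc (a : A) (g.Λ a).1 := fun f j b => by
  rw [h.π_S_Λ hφ hlsc, DoubleCentralizer.coe_snd_apply]

-- The operators `π(f) Sⱼ` separate the points of `E`.
variable {h hφ hlsc} in
theorem IsValue.eq {a : 𝓜(ℂ, A)} {t t' : B → E} (ht : h.IsValue hφ hlsc a t)
    (ht' : h.IsValue hφ hlsc a t') : t = t' :=
  funext fun b => h.ext_π_S fun f j => by rw [ht, ht']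

/-- One has `π(f) Sⱼ Λ(x) b = Λ(f x uⱼ) b`, which is norm continuous in `f x`, and strict
convergence makes `f x` converge in norm. No bound on the net is needed, so this covers every net
defining the closure. -/
theorem isValue_of_tendsto {a : 𝓜(ℂ, A)} {t : B → E} {ι : Type*} {l : Filter ι} [l.NeBot]
    {x : ι → φ.N} (hx : StrictTendsto (fun k => ((x k : A) : 𝓜(ℂ, A))) l a)
    (ht : ∀ b, Tendsto (fun k => (g.Λ (x k)).1 b) l (𝓝 (t b))) : h.IsValue hφ hlsc a t := by
  intro f j b
  refine tendsto_nhds_unique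
    ((((g.π f) ∘L (S j).1).continuous.tendsto _).comp (ht b)) ?_
  have h1 : Tendsto (fun k => f * (x k : A)) l (𝓝 (a.snd f)) := by
    simpa only [DoubleCentralizer.coe_snd_apply] using (hx f).2
  exact (h.tendsto_Λ_cut hφ hlsc j h1 b).congr fun k => (h.π_S_Λ hφ hlsc f j (x k) b).symm

-- The adjoint of `t` at `Sⱼ* π(f*) v` is `Λ(f a uⱼ)* v`.
variable {h hφ hlsc} in
theorem IsValue.exists_adjointable {a : 𝓜(ℂ, A)} {t : B →ₗ[ℂ] E} (ht : h.IsValue hφ hlsc a t) :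
    ∃ T : AdjointableMap B B E, ((T : B →L[ℂ] E) : B →ₗ[ℂ] E) = t := by
  refine exists_adjointable_of_dense t (h.dense_adj_S_π.mono Submodule.subset_span) ?_
  rintro _ ⟨f, j, v, rfl⟩
  refine ⟨AdjointableMap.adj (g.Λ (h.cut hφ hlsc j (a.snd f))) v, fun b => ?_⟩
  rw [← AdjointableMap.rip_adj, ← AdjointableMap.rip_adj, ← ht, g.rip_π]

section Closure

variable {a : 𝓜(ℂ, A)} {c : B}

theorem rip_Λ_cut (i : I) (x : A) (b : B) :
    rip B ((g.Λ (h.cut hφ hlsc i x)).1 b) ((g.Λ (h.cut hφ hlsc i x)).1 b)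
      = star b * ((ρ i) (star x * x)).fst b := h.rip_Λ_snd hφ hlsc i x b

/-- For `s < 1` the map `s ρᵢ` is in `𝒢_φ`, hence eventually below `σ`, and `b* σ((e a)* (e a)) b ≤
b* σ(a* a) b`. Pass to the limit in `σ`, then let `s → 1`. -/
theorem truncation_le_of_tendsto (h : g.TruncationNet u S ρ) (hφ : φ.DenselyDefined) {b : B}
    (hc : Tendsto (fun σ : g.G => star b * (strictExtension σ.1 (star a * a)).fst b) atTop (𝓝 c))
    (i : I) {e : A} (he : ‖e‖ ≤ 1) :
    star b * ((ρ i) (star (a.snd e) * a.snd e)).fst b ≤ c := by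
  have hne := h.G_neBot hφ
  set z := star b * ((ρ i) (star (a.snd e) * a.snd e)).fst b with hz
  have key : ∀ t : ℝ, 0 ≤ t → t < 1 → t • z ≤ c := by
    intro t ht0 ht1
    refine le_of_tendsto_of_eventually_le tendsto_const_nhds hc ?_
    filter_upwards [Ici_mem_atTop ((h.trunc i).toG t ht0 ht1)] with σ hσ
    have hcp : IsCP (σ.1 - (t : ℂ) • ρ i) := hσ
    have h1 := hcp.nonneg (star_mul_self_nonneg (a.snd e)) b
    rw [LinearMap.sub_apply, LinearMap.smul_apply, DoubleCentralizer.sub_fst,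
      DoubleCentralizer.smul_fst, _root_.sub_apply, _root_.smul_apply, mul_sub, mul_smul_comm,
      Complex.coe_smul, sub_nonneg] at h1
    exact h1.trans ((G.cp σ).apply_snd_le_strictExtension (G.strict σ) a he b)
  have hlim : Tendsto (fun n : ℕ => (1 - 1 / ((n : ℝ) + 1)) • z) atTop (𝓝 z) := by
    have := ((tendsto_one_div_add_atTop_nhds_zero_nat (𝕜 := ℝ)).const_sub 1).smul_const z
    simpa using this
  refine le_of_tendsto_of_eventually_le hlim tendsto_const_nhds (Eventually.of_forall fun n => ?_)
  refine key _ ?_ ?_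
  · rw [sub_nonneg, div_le_one (by positivity)]
    linarith [(Nat.cast_nonneg n : (0 : ℝ) ≤ n)]
  · exact sub_lt_self _ (by positivity)

/-- Three-epsilon argument with a single `σ ∈ 𝒢_φ`, operator `T`, for which `b* σ(a* a) b` is close
to `c`. With `f = Λ(y) b`, the square of `‖f - T f‖` is at most `‖c - b* σ(y* y) b‖`, eventually
small since `y → a` strictly in a ball. The differences of `T f` tend to `0` because `T Λ(·) b` is
controlled by the strict map `σ`. -/
theorem cauchy_Λ_cutNet {b : B}
    (hc : Tendsto (fun σ : g.G => star b * (strictExtension σ.1 (star a * a)).fst b) atTop (𝓝 c)) :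
    Cauchy (map (fun p => (g.Λ (h.cutNet hφ hlsc a p)).1 b)
      (CStarAlgebra.approximateUnit A ×ˢ atTop)) := by
  have hne := h.G_neBot hφ
  set F : Filter (A × I) := CStarAlgebra.approximateUnit A ×ˢ atTop with hF
  set y := h.cutNet hφ hlsc a with hy
  have hyb : ∀ᶠ p in F, ‖(y p : A)‖ ≤ ‖a‖ := h.eventually_norm_cutNet_le hφ hlsc a
  have hys : StrictTendsto (fun p => ((y p : A) : 𝓜(ℂ, A))) F a := h.strictTendsto_cutNet hφ hlsc a
  set f : A × I → E := fun p => (g.Λ (y p)).1 b with hf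
  refine cauchy_map_of_tendsto_sub ?_
  rw [Metric.tendsto_nhds]
  intro ε hε
  have hδ : 0 < (ε / 3) ^ 2 := by positivity
  obtain ⟨σ, hσ⟩ := (((tendsto_iff_norm_sub_tendsto_zero.1 hc).eventually
    (gt_mem_nhds hδ))).exists
  have h1 : ∀ᶠ p in F, ‖f p - (G.op σ).1 (f p)‖ < ε / 3 := by
    have h2 := strictTendsto_fst ((G.strict σ).tendsto_strictExtension
      (eventually_norm_star_mul_self_le hyb) (strictTendsto_coe_star_mul_self hyb hys)) b
    have h3 := (h2.sub_const c).norm.eventually (gt_mem_nhds hσ)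
    filter_upwards [h3, tendsto_fst.eventually (eventually_approximateUnit (A := A))] with p hp hp'
    have h4 := G.norm_sub_op_apply_sq_le σ (f p)
    have h5 : rip B (f p) (f p) ≤ c := by
      rw [hf]
      exact (h.rip_Λ_cut hφ hlsc p.2 (a.snd p.1) b).trans_le
        (h.truncation_le_of_tendsto hφ hc p.2 hp'.2)
    have h6 : rip B ((G.op σ).1 (f p)) (f p) = star b * (σ.1 (star (y p : A) * y p)).fst b :=
      (G.rep σ (y p) (y p) b b).symm
    have h7 : ‖rip B (f p) (f p) - rip B ((G.op σ).1 (f p)) (f p)‖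
        ≤ ‖c - rip B ((G.op σ).1 (f p)) (f p)‖ :=
      CStarAlgebra.norm_le_norm_of_nonneg_of_le (sub_nonneg.2 (G.op_le σ _)) (sub_le_sub_right h5 _)
    rw [h6, norm_sub_rev c] at h7
    rw [h6] at h4
    exact lt_of_pow_lt_pow_left₀ 2 (by positivity) ((h4.trans h7).trans_lt hp)
  have h2 : ∀ᶠ p in F ×ˢ F, ‖(G.op σ).1 (f p.1 - f p.2)‖ < ε / 3 := by
    have h3 : StrictTendsto (fun p : (A × I) × (A × I) => (((y p.1 - y p.2 : φ.N) : A) : 𝓜(ℂ, A)))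
        (F ×ˢ F) 0 := by
      have := (hys.comp (tendsto_fst (g := F))).sub (hys.comp (tendsto_snd (f := F)))
      simpa only [← DoubleCentralizer.coe_sub, sub_self, ← Submodule.coe_sub] using this
    have h4 : ∀ᶠ p in F ×ˢ F, ‖((y p.1 - y p.2 : φ.N) : A)‖ ≤ ‖a‖ + ‖a‖ := by
      filter_upwards [hyb.prod_mk hyb] with p hp
      exact (norm_sub_le _ _).trans (add_le_add hp.1 hp.2)
    have h5 := tendsto_apply_Λ_zero (G.strict σ) (G.norm_op_Λ_sq_le σ) h4 h3 b
    have h6 := h5.norm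
    rw [norm_zero] at h6
    filter_upwards [h6.eventually (gt_mem_nhds (show (0 : ℝ) < ε / 3 by positivity))] with p hp
    rw [map_sub g.Λ] at hp
    exact hp
  filter_upwards [h1.prod_mk h1, h2] with p hp hp'
  rw [dist_zero_right]
  have e : f p.1 - f p.2 = (f p.1 - (G.op σ).1 (f p.1)) + (G.op σ).1 (f p.1 - f p.2)
      - (f p.2 - (G.op σ).1 (f p.2)) := by rw [map_sub]; abel
  rw [e]
  have h3 := norm_sub_le ((f p.1 - (G.op σ).1 (f p.1)) + (G.op σ).1 (f p.1 - f p.2))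
    (f p.2 - (G.op σ).1 (f p.2))
  have h4 := norm_add_le (f p.1 - (G.op σ).1 (f p.1)) ((G.op σ).1 (f p.1 - f p.2))
  linarith [hp.1, hp.2]

/-- Elements of `𝒩̄_φ` belong to the domain of the closure of `Λ`. -/
theorem exists_isValue (ha : a ∈ g.Nbar) :
    ∃ t : AdjointableMap B B E, h.IsValue hφ hlsc a t.1 := by
  obtain ⟨-, hc⟩ := ha
  choose c hc using hc
  choose t ht using fun b => CompleteSpace.complete (h.cauchy_Λ_cutNet hφ hlsc (hc b))
  have ht' : ∀ b, Tendsto (fun p => (g.Λ (h.cutNet hφ hlsc a p)).1 b)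
    (CStarAlgebra.approximateUnit A ×ˢ atTop) (𝓝 (t b)) := ht
  let tL : B →ₗ[ℂ] E :=
    { toFun := t
      map_add' := fun b b' => by
        refine tendsto_nhds_unique (ht' (b + b')) (((ht' b).add (ht' b')).congr fun x => ?_)
        rw [map_add]
      map_smul' := fun z b => by
        refine tendsto_nhds_unique (ht' (z • b)) (((ht' b).const_smul z).congr fun x => ?_)
        rw [map_smul] }
  have hval : h.IsValue hφ hlsc a tL :=
    h.isValue_of_tendsto hφ hlsc (h.strictTendsto_cutNet hφ hlsc a) ht'
  obtain ⟨T, hT⟩ := hval.exists_adjointable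
  exact ⟨T, by rw [← hT] at hval; exact hval⟩

end Closure

section Approximation

variable {h hφ hlsc}
variable {a : 𝓜(ℂ, A)} {t : AdjointableMap B B E}

theorem IsValue.Λ_cut_apply (ht : h.IsValue hφ hlsc a t.1) (i : I) (e : A) (b : B) :
    (g.Λ (h.cut hφ hlsc i (a.snd e))).1 b = g.π e ((S i).1 (t.1 b)) := (ht e i b).symm

theorem IsValue.norm_Λ_cut_le (ht : h.IsValue hφ hlsc a t.1) (i : I) {e : A} (he : ‖e‖ ≤ 1) :
    ‖g.Λ (h.cut hφ hlsc i (a.snd e))‖ ≤ ‖t‖ := by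
  refine ContinuousLinearMap.opNorm_le_bound _ (norm_nonneg _) fun b => ?_
  change ‖(g.Λ (h.cut hφ hlsc i (a.snd e))).1 b‖ ≤ ‖t‖ * ‖b‖
  rw [ht.Λ_cut_apply]
  refine (g.norm_π_apply_le_of_norm_le_one he _).trans ?_
  refine ((S i).1.le_of_opNorm_le (h.trunc i).norm_S _).trans ?_
  rw [one_mul]
  exact t.1.le_opNorm b

/-- Here `Λ(e a uᵢ) = π(e) Sᵢ t`, with adjoint `t* Sᵢ* π(e)` for self-adjoint `e`. Each factor next
to `t` is a bounded net tending strongly to `1`. -/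
theorem IsValue.strongStarTendsto_cutNet (ht : h.IsValue hφ hlsc a t.1) :
    StrongStarTendsto (fun p => g.Λ (h.cutNet hφ hlsc a p))
      (CStarAlgebra.approximateUnit A ×ˢ atTop) t := by
  constructor
  · intro b
    have h1 : Tendsto (fun p : A × I => g.π p.1 ((S p.2).1 (t.1 b)))
        (CStarAlgebra.approximateUnit A ×ˢ atTop) (𝓝 (t.1 b)) :=
      tendsto_apply_of_bounded (T := fun p : A × I => g.π p.1) (T₀ := ContinuousLinearMap.id ℂ E)
        (tendsto_fst.eventually (eventually_norm_π (g := g)))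
        (fun v => (h.tendsto_π v).comp tendsto_fst) ((h.S_tendsto (t.1 b)).comp tendsto_snd)
    exact h1.congr fun p => ht p.1 p.2 b
  · intro v
    have h1 : Tendsto (fun p : A × I => AdjointableMap.adj (S p.2) (g.π p.1 v))
        (CStarAlgebra.approximateUnit A ×ˢ atTop) (𝓝 v) :=
      tendsto_apply_of_bounded (T := fun p : A × I => AdjointableMap.adj (S p.2))
        (T₀ := ContinuousLinearMap.id ℂ E) (r := 1) (Eventually.of_forall fun p =>
          ContinuousLinearMap.opNorm_le_bound _ zero_le_one fun w =>
            (AdjointableMap.norm_adj_apply_le (S p.2) w).trans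
              (by gcongr; exact (h.trunc p.2).norm_S))
        (fun v => (h.tendsto_adj_S v).comp tendsto_snd) ((h.tendsto_π v).comp tendsto_fst)
    refine (((AdjointableMap.adj t).continuous.tendsto v).comp h1).congr' ?_
    filter_upwards [tendsto_fst.eventually (eventually_approximateUnit (A := A))] with p hp
    refine (congrFun (AdjointableMap.adj_eq (T := g.Λ (h.cutNet hφ hlsc a p))
      (S := fun v => AdjointableMap.adj t (AdjointableMap.adj (S p.2) (g.π p.1 v)))
      fun b w => ?_) v).symm
    rw [← AdjointableMap.rip_adj, ← AdjointableMap.rip_adj]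
    have e1 := g.rip_π p.1 ((S p.2).1 (t.1 b)) w
    rw [hp.1] at e1
    rw [← e1, ht p.1 p.2 b]
    rfl

theorem tendsto_cutNet_coe (h : g.TruncationNet u S ρ) (hφ : φ.DenselyDefined)
    (hlsc : g.LowerSemicontinuous) (a : A) :
    Tendsto (fun p => (h.cutNet hφ hlsc a p : A)) (CStarAlgebra.approximateUnit A ×ˢ atTop)
      (𝓝 a) := by
  have h1 : Tendsto (fun p : A × I => (u p.2).snd (p.1 * a))
      (CStarAlgebra.approximateUnit A ×ˢ atTop) (𝓝 a) :=
    tendsto_apply_of_bounded (T := fun p : A × I => (u p.2).snd) (T₀ := ContinuousLinearMap.id ℂ A)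
      (r := 1) (Eventually.of_forall fun p =>
        (DoubleCentralizer.norm_snd _).trans_le (h.trunc p.2).norm_u)
      (fun v => (h.u_tendsto v).2.comp tendsto_snd)
      ((tendsto_approximateUnit_mul a).comp tendsto_fst)
  refine h1.congr fun p => ?_
  rw [cutNet, coe_cut, DoubleCentralizer.coe_snd_apply]

end Approximation

end TruncationNet
end KSGNS

/-! ### Approximation from `L` within both norm bounds. -/

/-- If `z` is within `δ r` of `(1 - δ) y` and `‖y‖ ≤ r`, then `‖z‖ ≤ r` and `z` is close to `y`. -/
theorem norm_le_and_norm_sub_le_of_contraction {V : Type*} [NormedAddCommGroup V]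
    [NormedSpace ℂ V] {y z : V} {r δ : ℝ} (hδ : 0 ≤ δ) (hδ' : δ ≤ 1) (hy : ‖y‖ ≤ r)
    (hz : ‖z - ((1 - δ : ℝ) : ℂ) • y‖ ≤ δ * r) : ‖z‖ ≤ r ∧ ‖z - y‖ ≤ 2 * r * δ := by
  have hr : 0 ≤ r := (norm_nonneg y).trans hy
  constructor
  · have h1 := norm_add_le (z - ((1 - δ : ℝ) : ℂ) • y) (((1 - δ : ℝ) : ℂ) • y)
    rw [sub_add_cancel, norm_smul, Complex.norm_real, Real.norm_of_nonneg (sub_nonneg.2 hδ')] at h1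
    have h2 := mul_le_mul_of_nonneg_left hy (sub_nonneg.2 hδ')
    linarith
  · have e : z - y = (z - ((1 - δ : ℝ) : ℂ) • y) - (δ : ℂ) • y := by
      push_cast
      module
    have h1 := norm_sub_le (z - ((1 - δ : ℝ) : ℂ) • y) ((δ : ℂ) • y)
    rw [← e, norm_smul, Complex.norm_real, Real.norm_of_nonneg hδ] at h1
    have h2 := mul_le_mul_of_nonneg_left hy hδ
    linarith

namespace KSGNS

variable {A : Type uA} {B : Type uB} [NonUnitalCStarAlgebra A] [PartialOrder A] [StarOrderedRing A]
variable [NonUnitalCStarAlgebra B] [PartialOrder B] [StarOrderedRing B] {φ : CStarWeight A B}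
variable {E : Type uE} [NormedAddCommGroup E] [NormedSpace ℂ E] [CompleteSpace E] [SMul Bᵐᵒᵖ E]
variable [HilbertModule B E] {g : KSGNS φ E}
variable {I : Type uI} [Preorder I] [IsDirectedOrder I] [Nonempty I] {u : I → 𝓜(ℂ, A)}
  {S : I → AdjointableMap B E E} {ρ : I → A →ₗ[ℂ] 𝓜(ℂ, B)}

namespace TruncationNet

variable {h : g.TruncationNet u S ρ} {hφ : φ.DenselyDefined} {hlsc : g.LowerSemicontinuous}
variable {a : 𝓜(ℂ, A)} {t : AdjointableMap B B E} {K : Submodule ℂ A}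

/-- The witness is `k uᵢ` with `k ∈ K` near `(1 - δ) e a`. Shrinking by `1 - δ` leaves room `δ ‖a‖`
in `A` and `δ M` for `Λ`. -/
theorem IsValue.exists_mem_truncatedSpan (ht : h.IsValue hφ hlsc a t.1) (hK : Dense (K : Set A))
    (ha : a ≠ 0) {M : ℝ} (hM : 0 < M) (htM : ‖t‖ ≤ M) {δ : ℝ} (hδ : 0 < δ) (hδ' : δ ≤ 1)
    {p : A × I} (hp : ‖p.1‖ ≤ 1) :
    ∃ x : φ.N, (x : A) ∈ truncatedSpan K u ∧
      (‖(x : A)‖ ≤ ‖a‖ ∧ ‖g.Λ x‖ ≤ M) ∧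
      ‖(x : A) - h.cutNet hφ hlsc a p‖ ≤ 2 * ‖a‖ * δ ∧
      ‖g.Λ x - g.Λ (h.cutNet hφ hlsc a p)‖ ≤ 2 * M * δ := by
  obtain ⟨e, i⟩ := p
  obtain ⟨C, hC0, hC⟩ := h.exists_norm_Λ_cut_le hφ hlsc i
  have ha' : 0 < ‖a‖ := norm_pos_iff.2 ha
  -- The two radii serve the norm of `A` and, through the bound `C` for `x ↦ Λ(x uᵢ)`, the norm of
  -- `Λ`. The `+ 1` allows `C = 0`.
  have hη : 0 < min (δ * ‖a‖) (δ * M / (C + 1)) := by positivity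
  obtain ⟨k, hk, hkK⟩ := Metric.dense_iff.1 hK (((1 - δ : ℝ) : ℂ) • a.snd e) _ hη
  rw [Metric.mem_ball, dist_eq_norm, lt_min_iff] at hk
  set y : φ.N := h.cutNet hφ hlsc a (e, i) with hy
  have hsub : h.cut hφ hlsc i k - ((1 - δ : ℝ) : ℂ) • y
      = h.cut hφ hlsc i (k - ((1 - δ : ℝ) : ℂ) • a.snd e) := by
    rw [map_sub, map_smul]; rfl
  have h1 := norm_le_and_norm_sub_le_of_contraction (y := (y : A)) (z := h.cut hφ hlsc i k)
    hδ.le hδ' ((h.norm_cut_le hφ hlsc i _).trans ((DoubleCentralizer.norm_snd_apply_le _ _).trans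
      (mul_le_of_le_one_right (norm_nonneg _) hp))) (by
        refine le_trans (le_of_eq (congrArg (fun z : φ.N => ‖(z : A)‖) hsub)) ?_
        exact (h.norm_cut_le hφ hlsc i _).trans hk.1.le)
  have h2 := norm_le_and_norm_sub_le_of_contraction (y := g.Λ y) (z := g.Λ (h.cut hφ hlsc i k))
    hδ.le hδ' ((ht.norm_Λ_cut_le i hp).trans htM) (by
        rw [← map_smul g.Λ, ← map_sub g.Λ, hsub]
        refine (hC _).trans ((mul_le_mul_of_nonneg_left hk.2.le hC0).trans ?_)
        rw [← mul_div_assoc, div_le_iff₀ (by positivity)]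
        nlinarith [mul_pos hδ hM])
  exact ⟨h.cut hφ hlsc i k, Submodule.subset_span ⟨k, hkK, i, rfl⟩, ⟨h1.1, h2.1⟩, h1.2, h2.2⟩

/-- Kaplansky type approximation of a multiplier and of the value of the closure of `Λ` at it. -/
theorem IsValue.exists_net (ht : h.IsValue hφ hlsc a t.1) (hK : Dense (K : Set A))
    {M : ℝ} (hM : 0 < M) (htM : ‖t‖ ≤ M) :
    ∃ (J : Type (max uA uB uE uI)) (_ : Preorder J) (_ : IsDirectedOrder J) (_ : Nonempty J)
      (x : J → φ.N),
      (∀ j, (x j : A) ∈ truncatedSpan K u) ∧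
      (∀ j, ‖(x j : A)‖ ≤ ‖a‖ ∧ ‖g.Λ (x j)‖ ≤ M) ∧
      StrictTendsto (fun j => ((x j : A) : 𝓜(ℂ, A))) atTop a ∧
      (∀ a' : A, a = a' → Tendsto (fun j => (x j : A)) atTop (𝓝 a')) ∧
      StrongStarTendsto (fun j => g.Λ (x j)) atTop t := by
  -- For `a = 0` there is no slack in `A`, but then `t = 0` and a constant net suffices.
  rcases eq_or_ne a 0 with rfl | ha
  · have ht0 : t = 0 := Subtype.ext <| DFunLike.coe_injective <| ht.eq <| by
      have := h.isValue_Λ hφ hlsc 0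
      rw [map_zero, Submodule.coe_zero, DoubleCentralizer.coe_zero] at this
      exact this
    subst ht0
    refine ⟨PUnit, inferInstance, inferInstance, inferInstance, fun _ => 0,
      fun _ => Submodule.zero_mem _, fun _ => ?_, ?_, fun a' ha' => ?_, ?_⟩
    · simpa using hM.le
    · simp only [Submodule.coe_zero, DoubleCentralizer.coe_zero]
      exact fun _ => ⟨tendsto_const_nhds, tendsto_const_nhds⟩
    · have : ‖a'‖ = 0 := by rw [← DoubleCentralizer.norm_coe, ← ha', norm_zero]
      rw [norm_eq_zero.1 this]
      exact tendsto_const_nhds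
    · simp only [map_zero]
      exact ⟨fun _ => tendsto_const_nhds, fun _ => tendsto_const_nhds⟩
  set F : Filter (A × I) := CStarAlgebra.approximateUnit A ×ˢ atTop with hF
  have hex : ∀ q : (A × I) × ℕ, ∃ x : φ.N, ‖q.1.1‖ ≤ 1 → (x : A) ∈ truncatedSpan K u ∧
      (‖(x : A)‖ ≤ ‖a‖ ∧ ‖g.Λ x‖ ≤ M) ∧
      ‖(x : A) - h.cutNet hφ hlsc a q.1‖ ≤ 2 * ‖a‖ * (1 / ((q.2 : ℝ) + 1)) ∧
      ‖g.Λ x - g.Λ (h.cutNet hφ hlsc a q.1)‖ ≤ 2 * M * (1 / ((q.2 : ℝ) + 1)) := by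
    intro q
    by_cases hq : ‖q.1.1‖ ≤ 1
    · obtain ⟨x, hx⟩ := ht.exists_mem_truncatedSpan hK ha hM htM (δ := 1 / ((q.2 : ℝ) + 1))
        (by positivity) ((div_le_one (by positivity)).2 (by simp)) hq
      exact ⟨x, fun _ => hx⟩
    · exact ⟨0, fun h' => absurd h' hq⟩
  choose x hx using hex
  have hle : ∀ᶠ q : (A × I) × ℕ in F ×ˢ atTop, ‖q.1.1‖ ≤ 1 :=
    (tendsto_fst.comp tendsto_fst).eventually
      ((eventually_approximateUnit (A := A)).mono fun e he => he.2)
  have hsmall : ∀ r : ℝ, Tendsto (fun q : (A × I) × ℕ => r * (1 / ((q.2 : ℝ) + 1))) (F ×ˢ atTop)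
      (𝓝 0) := fun r => by
    have := ((tendsto_one_div_add_atTop_nhds_zero_nat (𝕜 := ℝ)).const_mul r).comp
      (tendsto_snd : Tendsto Prod.snd (F ×ˢ atTop) _)
    rw [mul_zero] at this
    exact this
  have hd : Tendsto (fun q => (x q : A) - h.cutNet hφ hlsc a q.1) (F ×ˢ atTop) (𝓝 0) :=
    squeeze_zero_norm' (hle.mono fun q hq => (hx q hq).2.2.1) (hsmall _)
  have hdΛ : Tendsto (fun q => g.Λ (x q) - g.Λ (h.cutNet hφ hlsc a q.1)) (F ×ˢ atTop) (𝓝 0) :=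
    squeeze_zero_norm' (hle.mono fun q hq => (hx q hq).2.2.2) (hsmall _)
  have hstrict : StrictTendsto (fun q => ((x q : A) : 𝓜(ℂ, A))) (F ×ˢ atTop) a := by
    have := (StrictTendsto.coe_of_tendsto hd).add
      ((h.strictTendsto_cutNet hφ hlsc a).comp tendsto_fst)
    rw [DoubleCentralizer.coe_zero, zero_add] at this
    refine StrictTendsto.congr' this (Eventually.of_forall fun q => ?_)
    beta_reduce
    rw [DoubleCentralizer.coe_sub]
    exact sub_add_cancel _ _
  have hnorm : ∀ a' : A, a = a' → Tendsto (fun q => (x q : A)) (F ×ˢ atTop) (𝓝 a') := by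
    rintro a' rfl
    have := hd.add ((tendsto_cutNet_coe h hφ hlsc a').comp tendsto_fst)
    rw [zero_add] at this
    exact this.congr fun q => sub_add_cancel _ _
  have hstar : StrongStarTendsto (fun q => g.Λ (x q)) (F ×ˢ atTop) t := by
    have hs := ht.strongStarTendsto_cutNet
    have hdn := hdΛ.norm
    rw [norm_zero] at hdn
    constructor
    · intro b
      have h1 : Tendsto (fun q => (g.Λ (x q) - g.Λ (h.cutNet hφ hlsc a q.1)).1 b) (F ×ˢ atTop)
          (𝓝 0) := by
        refine squeeze_zero_norm (fun q => ContinuousLinearMap.le_opNorm _ b) ?_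
        simpa using hdn.mul_const ‖b‖
      have := h1.add ((hs.1 b).comp tendsto_fst)
      rw [zero_add] at this
      exact this.congr fun q => sub_add_cancel _ _
    · intro v
      have h1 : Tendsto (fun q => AdjointableMap.adj
          (g.Λ (x q) - g.Λ (h.cutNet hφ hlsc a q.1)) v) (F ×ˢ atTop) (𝓝 0) := by
        refine squeeze_zero_norm (fun q => AdjointableMap.norm_adj_apply_le _ v) ?_
        simpa using hdn.mul_const ‖v‖
      have := h1.add ((hs.2 v).comp tendsto_fst)
      rw [zero_add] at this
      refine this.congr fun q => ?_
      rw [AdjointableMap.adj_sub]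
      exact sub_add_cancel _ _
  -- Restricting to `‖e‖ ≤ 1` makes the bounds and membership in `L` hold at every index, not just
  -- eventually.
  obtain ⟨J, i1, i2, i3, k, hk, hkl⟩ := exists_net_tendsto.{max uA uI, max uB uE} (F ×ˢ atTop) hle
  exact ⟨J, i1, i2, i3, fun j => x (k j), fun j => (hx _ (hk j)).1, fun j => (hx _ (hk j)).2.1,
    hstrict.comp hkl, fun a' ha' => (hnorm a' ha').comp hkl,
    fun b => (hstar.1 b).comp hkl, fun v => (hstar.2 v).comp hkl⟩

/-- Any limit of `Λ` along a net tending to `a` is again a value at `a`, hence equals `t`;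
conversely the net `e a uᵢ` realizes `t`. -/
theorem lambdaBarGraph_iff (ht : h.IsValue hφ hlsc a t.1) (t' : B →ₗ[ℂ] E) :
    g.LambdaBarGraph a t' ↔ t' = ((t : B →L[ℂ] E) : B →ₗ[ℂ] E) := by
  constructor
  · rintro ⟨l, hl, hla, hlt⟩
    exact DFunLike.coe_injective ((h.isValue_of_tendsto hφ hlsc hla hlt).eq ht)
  · rintro rfl
    refine ⟨map (h.cutNet hφ hlsc a) (CStarAlgebra.approximateUnit A ×ˢ atTop), inferInstance,
      fun c => ⟨tendsto_map'_iff.2 (h.strictTendsto_cutNet hφ hlsc a c).1,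
        tendsto_map'_iff.2 (h.strictTendsto_cutNet hφ hlsc a c).2⟩,
      fun b => tendsto_map'_iff.2 (ht.strongStarTendsto_cutNet.1 b)⟩

end TruncationNet
end KSGNS

end

theorem proposition8p3
    {A : Type uA} [NonUnitalCStarAlgebra A] [PartialOrder A] [StarOrderedRing A]
    {B : Type uB} [NonUnitalCStarAlgebra B] [PartialOrder B] [StarOrderedRing B]
    {φ : CStarWeight A B}
    {E : Type uE} [NormedAddCommGroup E] [NormedSpace ℂ E] [CompleteSpace E] [SMul Bᵐᵒᵖ E]
    [HilbertModule B E] (g : KSGNS φ E)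
    (hφ : φ.DenselyDefined) (hlsc : g.LowerSemicontinuous)
    {I : Type uI} [Preorder I] [IsDirectedOrder I] [Nonempty I]
    (u : I → 𝓜(ℂ, A)) (hu : g.IsTruncatingNet u)
    (K : Submodule ℂ A) (hK : Dense (K : Set A)) :
    truncatedSpan K u ≤ φ.N ∧
    -- elements of `𝒩_φ` with `Λ(a) ≠ 0`
    (∀ a : φ.N, g.Λ a ≠ 0 →
      ∃ (J : Type (max uA uB uE uI)) (_ : Preorder J) (_ : IsDirectedOrder J) (_ : Nonempty J)
        (x : J → φ.N),
        (∀ j, (x j : A) ∈ truncatedSpan K u) ∧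
        (∀ j, ‖(x j : A)‖ ≤ ‖(a : A)‖ ∧ ‖g.Λ (x j)‖ ≤ ‖g.Λ a‖) ∧
        Tendsto (fun j => (x j : A)) atTop (𝓝 (a : A)) ∧
        StrongStarTendsto (fun j => g.Λ (x j)) atTop (g.Λ a)) ∧
    -- elements of `𝒩_φ` with `‖Λ(a)‖ < M`
    (∀ (a : φ.N) (M : ℝ), ‖g.Λ a‖ < M →
      ∃ (J : Type (max uA uB uE uI)) (_ : Preorder J) (_ : IsDirectedOrder J) (_ : Nonempty J)
        (x : J → φ.N),
        (∀ j, (x j : A) ∈ truncatedSpan K u) ∧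
        (∀ j, ‖(x j : A)‖ ≤ ‖(a : A)‖ ∧ ‖g.Λ (x j)‖ ≤ M) ∧
        Tendsto (fun j => (x j : A)) atTop (𝓝 (a : A)) ∧
        StrongStarTendsto (fun j => g.Λ (x j)) atTop (g.Λ a)) ∧
    -- elements of `𝒩̄_φ`; here `t = Λ̄(a)`
    (∀ a ∈ g.Nbar, ∃ t : AdjointableMap B B E,
      (∀ t' : B →ₗ[ℂ] E, g.LambdaBarGraph a t' ↔ t' = ((t : B →L[ℂ] E) : B →ₗ[ℂ] E)) ∧
      (t ≠ 0 →
        ∃ (J : Type (max uA uB uE uI)) (_ : Preorder J) (_ : IsDirectedOrder J) (_ : Nonempty J)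
          (x : J → φ.N),
          (∀ j, (x j : A) ∈ truncatedSpan K u) ∧
          (∀ j, ‖(x j : A)‖ ≤ ‖a‖ ∧ ‖g.Λ (x j)‖ ≤ ‖t‖) ∧
          StrictTendsto (fun j => ((x j : A) : 𝓜(ℂ, A))) atTop a ∧
          StrongStarTendsto (fun j => g.Λ (x j)) atTop t) ∧
      ∀ M : ℝ, ‖t‖ < M →
        ∃ (J : Type (max uA uB uE uI)) (_ : Preorder J) (_ : IsDirectedOrder J) (_ : Nonempty J)
          (x : J → φ.N),
          (∀ j, (x j : A) ∈ truncatedSpan K u) ∧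
          (∀ j, ‖(x j : A)‖ ≤ ‖a‖ ∧ ‖g.Λ (x j)‖ ≤ M) ∧
          StrictTendsto (fun j => ((x j : A) : 𝓜(ℂ, A))) atTop a ∧
          StrongStarTendsto (fun j => g.Λ (x j)) atTop t) := by
  obtain ⟨S, ρ, h⟩ := hu.exists_truncationNet
  refine ⟨Submodule.span_le.2 ?_, fun a ha => ?_, fun a M hM => ?_, fun a ha => ?_⟩
  · rintro _ ⟨x, -, i, rfl⟩
    exact h.snd_mem_N hφ hlsc i x
  -- The approximation requires a positive bound on `Λ`; `Λ a ≠ 0` permits the bound `‖Λ a‖` itself.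
  · obtain ⟨J, i1, i2, i3, x, h1, h2, -, h3, h4⟩ :=
      (h.isValue_Λ hφ hlsc a).exists_net hK (norm_pos_iff.2 ha) le_rfl
    simp only [DoubleCentralizer.norm_coe] at h2
    exact ⟨J, i1, i2, i3, x, h1, h2, h3 a rfl, h4⟩
  · obtain ⟨J, i1, i2, i3, x, h1, h2, -, h3, h4⟩ :=
      (h.isValue_Λ hφ hlsc a).exists_net hK ((norm_nonneg _).trans_lt hM) hM.le
    simp only [DoubleCentralizer.norm_coe] at h2
    exact ⟨J, i1, i2, i3, x, h1, h2, h3 a rfl, h4⟩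
  · obtain ⟨t, ht⟩ := h.exists_isValue hφ hlsc ha
    refine ⟨t, KSGNS.TruncationNet.lambdaBarGraph_iff ht, fun ht0 => ?_, fun M hM => ?_⟩
    · obtain ⟨J, i1, i2, i3, x, h1, h2, h3, -, h4⟩ :=
        ht.exists_net hK (norm_pos_iff.2 ht0) le_rfl
      exact ⟨J, i1, i2, i3, x, h1, h2, h3, h4⟩
    · obtain ⟨J, i1, i2, i3, x, h1, h2, h3, -, h4⟩ :=
        ht.exists_net hK ((norm_nonneg _).trans_lt hM) hM.le
      exact ⟨J, i1, i2, i3, x, h1, h2, h3, h4⟩
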